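/- For graphs $G,H$ with $|V(H)|\le |V(G)|$ let $\mathcal G(G,H)$ be the distribution of the random graph $\hat G$ obtained by sampling a uniformly random injective map $\phi:V(H)\to V(G)$ and setting $V(\hat G)=V(G)$, $E(\hat G)=E(G)\cup\{\{\phi(u),\phi(u')\}:\{u,u'\}\in E(H)\}$. Write $\|G\|=|V(G)|+|E(G)|$, $\log=\log_2$, and $K_{k,k}$ for the complete bipartite graph with sides of size $k$. The computational model is the RAM with words of $\Theta(\log n)$ bits, where $n$ is the number of vertices of the input graph, which is given by sorted adjacency lists. **Theorem.** There exists a deterministic (polynomial-time) algorithm $\mathcal A$ with the following guarantees. Fix any $a\ge 1$ and let $c=c(n)\in(0,1]$ with $c\in\omega(1/\log n)$. For every $n$ large enough (depending on $a$ and on the function $c$) and every $n$-vertex graph $G$, with no assumption on its degrees, when given in input $\hat G\sim\mathcal G(G,K_{cn/2,\,cn/2})$, where $cn/2$ is rounded down if it is not an integer, $\mathcal A$ with probability at least $1-n^{-a}$ returns the sides $L,R$ of a balanced biclique of $\hat G$ (that is, $|L|=|R|$ and every vertex of $L$ is adjacent in $\hat G$ to every vertex of $R$) of size $$|L|=|R|\;\ge\;\frac{c}{48}\cdot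 2^{\sqrt{\frac{c\log n}{2}}}.$$ Moreover $\mathcal A$ runs in time $\tilde O(\|\hat G\|)$, that is $O(\|\hat G\|\cdot\mathrm{polylog}\,\|\hat G\|)$, on every input graph $\hat G$. -/

import Mathlib

open Filter Asymptotics

/-! ### Random planting in an arbitrary graph -/

/-- The graph on the vertex set of `G` whose edges are those of `G` together with the pairs
`{φ u, φ u'}` for `{u, u'}` an edge of `H`. -/
def plant {V W : Type*} (G : SimpleGraph V) (H : SimpleGraph W) (φ : W ↪ V) : SimpleGraph V :=
  G ⊔ H.map φ

/-- The distribution `𝒢(G, H)`: plant `H` into `G` along a uniformly random injective map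
`V(H) → V(G)`; it is defined when `|V(H)| ≤ |V(G)|`. -/
noncomputable def randomPlanting {V W : Type*} [Fintype V] [Fintype W]
    (G : SimpleGraph V) (H : SimpleGraph W) (h : Fintype.card W ≤ Fintype.card V) :
    PMF (SimpleGraph V) :=
  haveI : Nonempty (W ↪ V) := Function.Embedding.nonempty_of_card_le h
  haveI : Fintype (W ↪ V) := Fintype.ofFinite _
  (PMF.uniformOfFintype (W ↪ V)).map (plant G H)

/-- The biclique `K_{k,k}`. -/
abbrev balancedBiclique (k : ℕ) : SimpleGraph (Fin k ⊕ Fin k) :=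
  completeBipartiteGraph (Fin k) (Fin k)

theorem card_balancedBiclique_le {c : ℝ} (hc : c ≤ 1) (n : ℕ) :
    Fintype.card (Fin ⌊c * n / 2⌋₊ ⊕ Fin ⌊c * n / 2⌋₊) ≤ Fintype.card (Fin n) := by
  have h : (⌊c * n / 2⌋₊ : ℕ) ≤ n / 2 := by
    rw [← Nat.floor_div_eq_div (K := ℝ)]
    refine Nat.floor_le_floor ?_
    have : (0 : ℝ) ≤ n := Nat.cast_nonneg n
    push_cast
    nlinarith
  simp only [Fintype.card_sum, Fintype.card_fin]
  omega

/-- `L` and `R` are the sides of a balanced biclique contained in `G` (as a subgraph, not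
necessarily induced). The two sides are automatically disjoint, as `G` has no loops. -/
def IsBalancedBiclique {V : Type*} (G : SimpleGraph V) (L R : Finset V) : Prop :=
  L.card = R.card ∧ ∀ u ∈ L, ∀ v ∈ R, G.Adj u v

/-- `‖G‖ = |V(G)| + |E(G)|`. -/
noncomputable def graphSize {V : Type*} (G : SimpleGraph V) : ℕ :=
  Nat.card V + G.edgeSet.ncard

/-! ### The word RAM

Programs have structured control flow. There are registers and an addressable memory, all of whose
cells hold words of `w` bits, that is natural numbers below `2 ^ w`. Every operation, memory
access, constant, register access and test costs one unit of time. -/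

namespace WordRAM

/-- The machine's binary operations; `sub` is truncated at `0`, and `lt`, `eq` return `1` or `0`. -/
inductive Op
  | add | sub | mul | div | lt | eq

def Op.eval (w : ℕ) : Op → ℕ → ℕ → ℕ
  | .add, x, y => (x + y) % 2 ^ w
  | .sub, x, y => x - y
  | .mul, x, y => (x * y) % 2 ^ w
  | .div, x, y => x / y
  | .lt, x, y => (if x < y then 1 else 0) % 2 ^ w
  | .eq, x, y => (if x = y then 1 else 0) % 2 ^ w

/-- Expressions: constants, registers, memory reads (indirect addressing), binary operations. -/
inductive Expr
  | lit (k : ℕ)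
  | reg (r : ℕ)
  | load (addr : Expr)
  | op (o : Op) (x y : Expr)

/-- Programs. A test succeeds when its value is nonzero. -/
inductive Cmd
  | skip
  | assign (r : ℕ) (e : Expr)
  | store (addr e : Expr)
  | seq (p q : Cmd)
  | ite (e : Expr) (p q : Cmd)
  | while (e : Expr) (p : Cmd)

structure State where
  reg : ℕ → ℕ
  mem : ℕ → ℕ

def Expr.eval (w : ℕ) (s : State) : Expr → ℕ
  | .lit k => k % 2 ^ w
  | .reg r => s.reg r
  | .load a => s.mem (a.eval w s)
  | .op o x y => o.eval w (x.eval w s) (y.eval w s)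

/-- The time to evaluate an expression: one unit per node. -/
def Expr.cost : Expr → ℕ
  | .lit _ => 1
  | .reg _ => 1
  | .load a => a.cost + 1
  | .op _ x y => x.cost + y.cost + 1

/-- `Exec w p s s' t`: on words of `w` bits, the program `p` started in state `s` halts in state
`s'` after `t` units of time. -/
inductive Exec (w : ℕ) : Cmd → State → State → ℕ → Prop
  | skip (s : State) : Exec w .skip s s 1
  | assign (s : State) (r : ℕ) (e : Expr) :
      Exec w (.assign r e) s ⟨Function.update s.reg r (e.eval w s), s.mem⟩ (e.cost + 1)
  | store (s : State) (a e : Expr) :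
      Exec w (.store a e) s ⟨s.reg, Function.update s.mem (a.eval w s) (e.eval w s)⟩
        (a.cost + e.cost + 1)
  | seq {s s₁ s₂ : State} {p q : Cmd} {t₁ t₂ : ℕ} :
      Exec w p s s₁ t₁ → Exec w q s₁ s₂ t₂ → Exec w (.seq p q) s s₂ (t₁ + t₂)
  | iteTrue {s s' : State} {e : Expr} {p q : Cmd} {t : ℕ} :
      e.eval w s ≠ 0 → Exec w p s s' t → Exec w (.ite e p q) s s' (e.cost + 1 + t)
  | iteFalse {s s' : State} {e : Expr} {p q : Cmd} {t : ℕ} :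
      e.eval w s = 0 → Exec w q s s' t → Exec w (.ite e p q) s s' (e.cost + 1 + t)
  | whileTrue {s s₁ s₂ : State} {e : Expr} {p : Cmd} {t₁ t₂ : ℕ} :
      e.eval w s ≠ 0 → Exec w p s s₁ t₁ → Exec w (.while e p) s₁ s₂ t₂ →
        Exec w (.while e p) s s₂ (e.cost + 1 + t₁ + t₂)
  | whileFalse {s : State} {e : Expr} {p : Cmd} :
      e.eval w s = 0 → Exec w (.while e p) s s (e.cost + 1)

/-- Execution is deterministic. -/
theorem Exec.unique {w : ℕ} {p : Cmd} {s s₁ s₂ : State} {t₁ t₂ : ℕ}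
    (h₁ : Exec w p s s₁ t₁) (h₂ : Exec w p s s₂ t₂) : s₁ = s₂ ∧ t₁ = t₂ := by
  induction h₁ generalizing s₂ t₂ with
  | skip | assign | store => cases h₂; exact ⟨rfl, rfl⟩
  | seq _ _ ih₁ ih₂ =>
    cases h₂ with
    | seq a b =>
      obtain ⟨rfl, rfl⟩ := ih₁ a
      obtain ⟨rfl, rfl⟩ := ih₂ b
      exact ⟨rfl, rfl⟩
  | iteTrue h _ ih =>
    cases h₂ with
    | iteTrue _ a => obtain ⟨rfl, rfl⟩ := ih a; exact ⟨rfl, rfl⟩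
    | iteFalse h' _ => exact absurd h' h
  | iteFalse h _ ih =>
    cases h₂ with
    | iteTrue h' _ => exact absurd h h'
    | iteFalse _ a => obtain ⟨rfl, rfl⟩ := ih a; exact ⟨rfl, rfl⟩
  | whileTrue h _ _ ih₁ ih₂ =>
    cases h₂ with
    | whileTrue _ a b =>
      obtain ⟨rfl, rfl⟩ := ih₁ a
      obtain ⟨rfl, rfl⟩ := ih₂ b
      exact ⟨rfl, rfl⟩
    | whileFalse h' => exact absurd h' h
  | whileFalse h =>
    cases h₂ with
    | whileTrue h' _ _ => exact absurd h h'
    | whileFalse _ => exact ⟨rfl, rfl⟩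

/-! ### Input and output -/

/-- Words of logarithmic size: `κ` times the binary length of the number of vertices. -/
def wordSize (κ n : ℕ) : ℕ := κ * (Nat.log 2 n + 1)

open Classical in
/-- The sorted adjacency list of the vertex `v`. -/
noncomputable def adjList {n : ℕ} (G : SimpleGraph (Fin n)) (v : Fin n) : List ℕ :=
  ((List.finRange n).filter (fun u => G.Adj v u)).map Fin.val

/-- The address at which the adjacency list of the vertex `v` starts; for `v = n` it is the first
address after the input. -/
noncomputable def listStart {n : ℕ} (G : SimpleGraph (Fin n)) (v : ℕ) : ℕ :=
  n + 2 + (((List.finRange n).filter (fun u => u.val < v)).map (fun u => (adjList G u).length)).sum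

/-- The input words: cell `0` holds `n`, the cells `1, …, n + 1` hold the start addresses of the
adjacency lists of the vertices `0, …, n - 1` and the first address after the input, and the
sorted adjacency lists follow from cell `n + 2` on. -/
noncomputable def inputWords {n : ℕ} (G : SimpleGraph (Fin n)) : List ℕ :=
  n :: ((List.range (n + 1)).map (listStart G) ++ (List.finRange n).flatMap (adjList G))

/-- The initial state on input `G`; all registers and the rest of the memory are `0`. -/
noncomputable def initState (w : ℕ) {n : ℕ} (G : SimpleGraph (Fin n)) : State where
  reg := fun _ => 0
  mem := fun i => (inputWords G).getD i 0 % 2 ^ w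

/-- The final state `s` describes the pair `L, R` of vertex sets of the same size `k`: cell `0`
holds `k`, the cells `1, …, k` list `L`, and the cells `k + 1, …, 2k` list `R`. -/
def Outputs {n : ℕ} (s : State) (L R : Finset (Fin n)) : Prop :=
  L.card = R.card ∧ s.mem 0 = L.card ∧
    L.image Fin.val = (Finset.range L.card).image (fun i => s.mem (1 + i)) ∧
    R.image Fin.val = (Finset.range L.card).image (fun i => s.mem (1 + L.card + i))

/-- Run on the input graph `G` with words of `κ (⌊log₂ n⌋ + 1)` bits, the program `p` halts after
exactly `t` units of time in the final state `s`. -/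
def RunsTo (p : Cmd) (κ : ℕ) {n : ℕ} (G : SimpleGraph (Fin n)) (s : State) (t : ℕ) : Prop :=
  Exec (wordSize κ n) p (initState (wordSize κ n) G) s t

/-- Run on the input graph `G`, the program `p` halts and returns the sides `L, R`. -/
def Returns (p : Cmd) (κ : ℕ) {n : ℕ} (G : SimpleGraph (Fin n)) (L R : Finset (Fin n)) : Prop :=
  ∃ s t, RunsTo p κ G s t ∧ Outputs s L R

/-- On every input graph `G`, the program `p` halts in time `Õ(‖G‖)`, that is, in time
`O(‖G‖ · polylog ‖G‖)`. The summands `1` only matter for graphs with at most one vertex. -/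
def RunsInSoftLinearTime (p : Cmd) (κ : ℕ) : Prop :=
  ∃ C d : ℕ, ∀ (n : ℕ) (G : SimpleGraph (Fin n)), ∃ s t, RunsTo p κ G s t ∧
    t ≤ C * (graphSize G + 1) * (Nat.log 2 (graphSize G) + 1) ^ d

end WordRAM

/-!
The program `WordRAM.findBiclique` exploits that planting a biclique raises the degrees of the
planted vertices. It sorts the vertices by decreasing degree and cuts the sorted list into blocks of
`q` consecutive vertices, for every power of two `q`. From each block it selects at least a third of
the vertices, and it outputs the largest balanced biclique that a selected set forms with its common
neighbours. The input is very dense, as the planted edges alone are of order `c ^ 2 * n ^ 2`; so time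
of order `n ^ 2 * log n` is affordable, once sparse graphs, on which nothing has to be achieved, have
been rejected (`WordRAM.findBiclique_achieves`).

*Selecting from a block.* Suppose that all vertices of a block are planted ones. The two sides are
completely joined, so that each component of the complement of the block lies in one side. If one of
these components contains a third of the block, it is selected, and the other side consists of common
neighbours. Otherwise some union of components contains between one and two thirds of the block, and
it is completely joined to the rest of the block. A breadth-first search in the complement (`Search`)
finds one of the two. Either way there are at least `q / 3` common neighbours
(`le_card_commonNeighbors_of_planted`).

*A block of planted vertices.* Let `k` be the size of the planted sides and `β = 7 k / (8 n)`. With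
high probability both sides contain the proportion `β` of every large set among the
non-neighbourhoods in `G` and the sets of vertices of codegree (number of non-neighbours) at most `y`
in `G` (`card_not_meetsEvenly_le`, by an exponential moment bound for random injections). Then
planting reduces the codegrees of the planted vertices by the factor `1 - β`. Let `x i` be the
number of vertices of codegree at most `(1 - β) ^ i * n` in `G`, and let
`t = √(c * logb 2 n / 2)`.

* If `x (i + 1) < 2 ^ (-t) * x i` for some `i`, consider the vertices of codegree at most
  `(1 - β) ^ (i + 1) * n` after planting. They form an initial segment of the sorted order. At least
  `2 * β * x i` of them are planted, and fewer than `2 ^ (-t) * x i` are not. For `q ≤ β * 2 ^ t`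
  this initial segment has more blocks than vertices that are not planted, so that some block avoids
  the latter.
* Otherwise, after about `t * log 2 / β` steps there are still many vertices, all of codegree at most
  `n / 2 ^ t`, and for `q ≤ 2 ^ t / 2` any `q` of these have `n / 2` common neighbours.

This is `exists_good_block`. A power of two `q` between `c / 16 * 2 ^ t` and `c / 8 * 2 ^ t` satisfies
all requirements (`exists_block_of_meetsEvenly`) and yields a biclique with sides of size
`q / 3 ≥ c / 48 * 2 ^ t`.
-/

namespace WordRAM

/-! ### Total correctness of programs with a time bound -/

/-- Started in the state `s`, the program `p` halts within `T` units of time, in a state that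
satisfies `Q`. -/
def Achieves (w : ℕ) (p : Cmd) (s : State) (T : ℕ) (Q : State → Prop) : Prop :=
  ∃ s' t, Exec w p s s' t ∧ t ≤ T ∧ Q s'

theorem Achieves.mono {w : ℕ} {p : Cmd} {s : State} {T T' : ℕ} {Q Q' : State → Prop}
    (h : Achieves w p s T Q) (hT : T ≤ T') (hQ : ∀ s', Q s' → Q' s') : Achieves w p s T' Q' := by
  obtain ⟨s', t, he, ht, hq⟩ := h
  exact ⟨s', t, he, ht.trans hT, hQ _ hq⟩

theorem Achieves.seq {w : ℕ} {p q : Cmd} {s : State} {T₁ T₂ : ℕ} {P Q : State → Prop}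
    (hp : Achieves w p s T₁ P) (hq : ∀ s', P s' → Achieves w q s' T₂ Q) :
    Achieves w (.seq p q) s (T₁ + T₂) Q := by
  obtain ⟨s₁, t₁, he₁, ht₁, h₁⟩ := hp
  obtain ⟨s₂, t₂, he₂, ht₂, h₂⟩ := hq s₁ h₁
  exact ⟨s₂, _, .seq he₁ he₂, by omega, h₂⟩

theorem Achieves.ite {w : ℕ} {p q : Cmd} {e : Expr} {s : State} {T : ℕ} {Q : State → Prop}
    (hp : e.eval w s ≠ 0 → Achieves w p s T Q) (hq : e.eval w s = 0 → Achieves w q s T Q) :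
    Achieves w (.ite e p q) s (T + e.cost + 1) Q := by
  by_cases h : e.eval w s = 0
  · obtain ⟨s', t, he, ht, hQ⟩ := hq h
    exact ⟨s', _, .iteFalse h he, by omega, hQ⟩
  · obtain ⟨s', t, he, ht, hQ⟩ := hp h
    exact ⟨s', _, .iteTrue h he, by omega, hQ⟩

/-- A loop is run by an invariant `I` that carries the number of iterations done so far. -/
theorem Achieves.whileLoop {w : ℕ} {p : Cmd} {e : Expr} {T : ℕ} (I : ℕ → State → Prop) (k : ℕ)
    (hstep : ∀ i < k, ∀ s, I i s → e.eval w s ≠ 0 ∧ Achieves w p s T (I (i + 1)))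
    (hend : ∀ s, I k s → e.eval w s = 0) {s : State} (h0 : I 0 s) :
    Achieves w (.while e p) s (k * (T + e.cost + 1) + e.cost + 1) (I k) := by
  suffices H : ∀ j i s, i + j = k → I i s →
      Achieves w (.while e p) s (j * (T + e.cost + 1) + e.cost + 1) (I k) from
    H k 0 s (by omega) h0
  intro j
  induction j with
  | zero =>
    intro i s hi hs
    obtain rfl : i = k := by omega
    exact ⟨s, _, .whileFalse (hend s hs), by omega, hs⟩
  | succ j ih =>
    intro i s hi hs
    obtain ⟨hne, s₁, t₁, he₁, ht₁, h₁⟩ := hstep i (by omega) s hs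
    obtain ⟨s₂, t₂, he₂, ht₂, h₂⟩ := ih (i + 1) s₁ (by omega) h₁
    refine ⟨s₂, _, .whileTrue hne he₁ he₂, ?_, h₂⟩
    rw [Nat.succ_mul]
    omega

/-! ### Programs without loops -/

/-- The state after a program without loops (a loop is treated as `skip`). -/
def Cmd.run (w : ℕ) : Cmd → State → State
  | .skip, s => s
  | .assign r e, s => ⟨Function.update s.reg r (e.eval w s), s.mem⟩
  | .store a e, s => ⟨s.reg, Function.update s.mem (a.eval w s) (e.eval w s)⟩
  | .seq p q, s => q.run w (p.run w s)
  | .ite e p q, s => if e.eval w s = 0 then q.run w s else p.run w s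
  | .while _ _, s => s

/-- An upper bound on the time that a program without loops takes. -/
def Cmd.maxCost : Cmd → ℕ
  | .skip => 1
  | .assign _ e => e.cost + 1
  | .store a e => a.cost + e.cost + 1
  | .seq p q => p.maxCost + q.maxCost
  | .ite e p q => p.maxCost + q.maxCost + e.cost + 1
  | .while _ _ => 0

/-- The program contains no loop. -/
def Cmd.LoopFree : Cmd → Prop
  | .skip | .assign _ _ | .store _ _ => True
  | .seq p q | .ite _ p q => p.LoopFree ∧ q.LoopFree
  | .while _ _ => False

theorem Cmd.LoopFree.achieves {w : ℕ} {p : Cmd} (hp : p.LoopFree) {s : State} {Q : State → Prop}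
    (hQ : Q (p.run w s)) : Achieves w p s p.maxCost Q := by
  suffices H : Achieves w p s p.maxCost (fun s' => s' = p.run w s) from
    H.mono le_rfl (by rintro _ rfl; exact hQ)
  clear hQ Q
  induction p generalizing s with
  | skip => exact ⟨_, _, .skip s, le_rfl, rfl⟩
  | assign r e => exact ⟨_, _, .assign s r e, le_rfl, rfl⟩
  | store a e => exact ⟨_, _, .store s a e, le_rfl, rfl⟩
  | seq p q ihp ihq =>
    exact (ihp hp.1).seq (by rintro _ rfl; exact ihq hp.2)
  | ite e p q ihp ihq =>
    refine (Achieves.ite (T := p.maxCost + q.maxCost) (fun h => ?_) (fun h => ?_)).mono le_rfl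
      (fun _ => id)
    · exact (ihp hp.1).mono (by omega) (by rintro _ rfl; simp [Cmd.run, h])
    · exact (ihq hp.2).mono (by omega) (by rintro _ rfl; simp [Cmd.run, h])
  | _ => exact hp.elim

/-! ### Counting loops -/

instance : Add Expr := ⟨.op .add⟩
instance : Sub Expr := ⟨.op .sub⟩
instance : Mul Expr := ⟨.op .mul⟩

section Eval
variable (w : ℕ) (s : State) (x y : Expr)

@[simp] theorem Expr.eval_add : (x + y).eval w s = (x.eval w s + y.eval w s) % 2 ^ w := rfl
@[simp] theorem Expr.eval_sub : (x - y).eval w s = x.eval w s - y.eval w s := rfl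
@[simp] theorem Expr.eval_mul : (x * y).eval w s = (x.eval w s * y.eval w s) % 2 ^ w := rfl
@[simp] theorem Expr.eval_lit (k : ℕ) : (Expr.lit k).eval w s = k % 2 ^ w := rfl
@[simp] theorem Expr.eval_reg (k : ℕ) : (Expr.reg k).eval w s = s.reg k := rfl
@[simp] theorem Expr.eval_load : (Expr.load x).eval w s = s.mem (x.eval w s) := rfl
@[simp] theorem Expr.eval_lt :
    (Expr.op .lt x y).eval w s = (if x.eval w s < y.eval w s then 1 else 0) % 2 ^ w := rfl
@[simp] theorem Expr.eval_eq :
    (Expr.op .eq x y).eval w s = (if x.eval w s = y.eval w s then 1 else 0) % 2 ^ w := rfl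

end Eval

/-- `for r = a, …, b - 1 do p`. The bound `b` is evaluated anew before every iteration. -/
def forLoop (r : ℕ) (a b : Expr) (p : Cmd) : Cmd :=
  .seq (.assign r a) (.while (.op .lt (.reg r) b) (.seq p (.assign r (.reg r + .lit 1))))

/-- The invariant `I i` holds before the iteration for `i`, and the body must leave the loop
register unchanged. -/
theorem Achieves.forLoop {w r lo hi T : ℕ} {a b : Expr} {p : Cmd} {s : State}
    (I : ℕ → State → Prop) (ha : a.eval w s = lo) (hlo : lo ≤ hi) (hW : hi < 2 ^ w)
    (h0 : I lo ⟨Function.update s.reg r lo, s.mem⟩)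
    (hreg : ∀ i s, lo ≤ i → i ≤ hi → I i s → s.reg r = i ∧ b.eval w s = hi)
    (hbody : ∀ i s, lo ≤ i → i < hi → I i s → Achieves w p s T
      (fun s' => s'.reg r = i ∧ I (i + 1) ⟨Function.update s'.reg r (i + 1), s'.mem⟩)) :
    Achieves w (forLoop r a b p) s ((hi - lo) * (T + b.cost + 7) + a.cost + b.cost + 4)
      (I hi) := by
  have hfirst : Achieves w (.assign r a) s (a.cost + 1) (I lo) :=
    ⟨_, _, .assign s r a, le_rfl, by rw [ha]; exact h0⟩
  have hloop : ∀ s, I lo s → Achieves w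
      (.while (.op .lt (.reg r) b) (.seq p (.assign r (.reg r + .lit 1)))) s
      ((hi - lo) * (T + b.cost + 7) + b.cost + 3) (I hi) := by
    intro s hs
    have key := Achieves.whileLoop (w := w) (e := .op .lt (.reg r) b)
      (p := .seq p (.assign r (.reg r + .lit 1))) (T := T + 4) (s := s)
      (fun i s => I (lo + i) s) (hi - lo) ?_ ?_ hs
    · refine key.mono ?_ ?_
      · simp only [Expr.cost]
        apply le_of_eq
        ring
      · intro s' h
        rwa [Nat.add_sub_cancel' hlo] at h
    · intro i hi' s hs
      obtain ⟨hr, hb⟩ := hreg (lo + i) s (by omega) (by omega) hs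
      have h1 : 1 % 2 ^ w = 1 := Nat.mod_eq_of_lt (by omega)
      constructor
      · simp only [Expr.eval, Op.eval, hr, hb]
        rw [if_pos (by omega), h1]
        exact one_ne_zero
      · refine Achieves.seq (hbody (lo + i) s (by omega) (by omega) hs) ?_
        rintro s' ⟨hr', hI⟩
        refine ⟨_, _, .assign s' r _, ?_, ?_⟩
        · exact le_rfl
        · rw [Expr.eval_add, Expr.eval_lit, h1, Expr.eval_reg, hr']
          rw [Nat.mod_eq_of_lt (by omega)]
          exact hI
    · intro s hs
      obtain ⟨hr, hb⟩ := hreg _ s (by omega) (by omega) hs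
      simp only [Expr.eval, Op.eval, hr, hb]
      rw [if_neg (by omega), Nat.zero_mod]
  refine (hfirst.seq hloop).mono (by omega) (fun _ => id)

/-! ### Arrays -/

/-- Register `1` holds a number `N`, and the array `j` occupies the memory cells
`j * N, …, (j + 1) * N - 1`; this is the address of its entry `e`. -/
def cell (j : ℕ) (e : Expr) : Expr := .lit j * .reg 1 + e

theorem eval_cell {w N j x : ℕ} {s : State} {e : Expr} (hN : 8 * (N * N) ≤ 2 ^ w)
    (h1 : s.reg 1 = N) (hj : j < 8) (he : e.eval w s = x) (hx : x < N) :
    (cell j e).eval w s = j * N + x := by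
  have hN1 : N * 1 ≤ N * N := Nat.mul_le_mul_left N (by omega)
  have hjN : j * N + N ≤ 8 * N := by nlinarith
  rw [cell, Expr.eval_add, Expr.eval_mul, Expr.eval_lit, Expr.eval_reg, h1, he,
    Nat.mod_eq_of_lt (show j < 2 ^ w by omega), Nat.mod_eq_of_lt (show j * N < 2 ^ w by omega),
    Nat.mod_eq_of_lt (by omega)]

/-! ### The layout of the input -/

section Input
variable {n : ℕ} (G : SimpleGraph (Fin n))

theorem filter_finRange_lt (v : ℕ) :
    (List.finRange n).filter (fun u => u.val < v) = (List.finRange n).take v := by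
  conv_lhs => rw [← List.take_append_drop v (List.finRange n)]
  rw [List.filter_append, List.filter_eq_self.2, List.filter_eq_nil_iff.2, List.append_nil]
  · intro a ha
    obtain ⟨i, hi, rfl⟩ := List.getElem_of_mem ha
    simp
  · intro a ha
    obtain ⟨i, hi, rfl⟩ := List.getElem_of_mem ha
    simp at hi ⊢
    omega

theorem listStart_eq (v : ℕ) :
    listStart G v = n + 2 + ((List.finRange n).take v |>.flatMap (adjList G)).length := by
  rw [listStart, filter_finRange_lt, List.length_flatMap]

theorem finRange_split (v : Fin n) :
    List.finRange n = (List.finRange n).take v ++ v :: (List.finRange n).drop (v + 1) := by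
  conv_lhs => rw [← List.take_append_drop v (List.finRange n)]
  rw [List.drop_eq_getElem_cons (by simp)]
  simp

theorem listStart_succ (v : Fin n) :
    listStart G (v + 1) = listStart G v + (adjList G v).length := by
  have : (List.finRange n).take (v + 1) = (List.finRange n).take v ++ [v] := by
    rw [List.take_add_one]; simp
  rw [listStart_eq, listStart_eq, this]
  simp [List.flatMap_append]
  omega

theorem mem_adjList (v : Fin n) (x : ℕ) : x ∈ adjList G v ↔ ∃ u : Fin n, G.Adj v u ∧ u.val = x := by
  simp [adjList]

theorem length_adjList_le (v : Fin n) : (adjList G v).length ≤ n := by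
  rw [adjList, List.length_map]
  exact (List.length_filter_le _ _).trans (by simp)

theorem listStart_zero : listStart G 0 = n + 2 := by
  simp [listStart]

theorem listStart_le (v : ℕ) (hv : v ≤ n) : listStart G v ≤ n + 2 + v * n := by
  induction v with
  | zero => simp [listStart_zero]
  | succ v ih =>
    have := listStart_succ G ⟨v, hv⟩
    have h2 := length_adjList_le G ⟨v, hv⟩
    have h3 := ih (by omega)
    simp only at this
    rw [this, Nat.succ_mul]
    omega

theorem inputWords_start {v : ℕ} (hv : v ≤ n) :
    (inputWords G).getD (1 + v) 0 = listStart G v := by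
  rw [inputWords, add_comm 1 v, List.getD_cons_succ, List.getD_append _ _ _ _ (by simp; omega),
    List.getD_eq_getElem _ _ (by simp; omega)]
  simp

theorem inputWords_list (v : Fin n) {i : ℕ} (hi : i < (adjList G v).length) :
    (inputWords G).getD (listStart G v + i) 0 = (adjList G v)[i] := by
  have h1 : listStart G v + i
      = (((List.finRange n).take v |>.flatMap (adjList G)).length + i + (n + 1)) + 1 := by
    rw [listStart_eq]; ring
  rw [inputWords, h1, List.getD_cons_succ, List.getD_append_right _ _ _ _ (by simp)]
  have h3 : (List.finRange n).flatMap (adjList G) = ((List.finRange n).take v).flatMap (adjList G)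
      ++ (adjList G v ++ ((List.finRange n).drop (v + 1)).flatMap (adjList G)) := by
    conv_lhs => rw [finRange_split v]
    rw [List.flatMap_append, List.flatMap_cons]
  rw [h3, List.getD_append_right _ _ _ _ (by simp)]
  have h2 : ((List.finRange n).take v |>.flatMap (adjList G)).length + i + (n + 1) -
      ((List.range (n + 1)).map (listStart G)).length -
      ((List.finRange n).take v |>.flatMap (adjList G)).length = i := by
    rw [List.length_map, List.length_range]
    omega
  rw [h2, List.getD_append _ _ _ _ hi, List.getD_eq_getElem]

theorem length_inputWords : (inputWords G).length = listStart G n := by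
  rw [listStart_eq, List.take_of_length_le (by simp), inputWords]
  simp
  omega

theorem inputWords_of_le {i : ℕ} (hi : listStart G n ≤ i) : (inputWords G).getD i 0 = 0 :=
  List.getD_eq_default _ _ (by rw [length_inputWords]; exact hi)

theorem inputWords_le (i : ℕ) : (inputWords G).getD i 0 ≤ (n + 2) ^ 2 := by
  by_cases hi : i < (inputWords G).length
  · rw [List.getD_eq_getElem _ _ hi]
    have hm := List.getElem_mem hi
    generalize (inputWords G)[i] = x at hm
    simp only [inputWords, List.mem_cons, List.mem_append, List.mem_map, List.mem_range,
      List.mem_flatMap] at hm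
    rcases hm with rfl | ⟨v, hv, rfl⟩ | ⟨v, -, hx⟩
    · nlinarith
    · have := listStart_le G v (by omega)
      nlinarith
    · obtain ⟨u, -, rfl⟩ := (mem_adjList G v x).1 hx
      have := u.2
      nlinarith
  · rw [List.getD_eq_default _ _ (by omega)]; positivity

theorem initState_mem {w : ℕ} (hw : (n + 2) ^ 2 < 2 ^ w) (i : ℕ) :
    (initState w G).mem i = (inputWords G).getD i 0 :=
  Nat.mod_eq_of_lt ((inputWords_le G i).trans_lt hw)

open Classical in
theorem length_adjList (v : Fin n) : (adjList G v).length = G.degree v := by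
  rw [adjList, List.length_map, ← SimpleGraph.card_neighborFinset_eq_degree,
    SimpleGraph.neighborFinset_eq_filter]
  rw [Finset.card, Finset.filter_val, ← Multiset.coe_card]
  rfl

open Classical in
theorem listStart_eq_sum (v : ℕ) (hv : v ≤ n) :
    listStart G v = n + 2 + ∑ u : Fin n with u.val < v, G.degree u := by
  induction v with
  | zero => simp [listStart_zero]
  | succ v ih =>
    have h1 := listStart_succ G ⟨v, hv⟩
    simp only at h1
    rw [h1, ih (by omega), length_adjList, add_assoc]
    congr 1
    rw [add_comm, ← Finset.sum_insert (f := fun u => G.degree u)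
      (s := Finset.univ.filter fun u : Fin n => u.val < v) (a := ⟨v, hv⟩) (by simp)]
    congr 1
    ext u
    simp only [Finset.mem_insert, Finset.mem_filter_univ, Fin.ext_iff]
    omega

theorem listStart_last : listStart G n = n + 2 + 2 * G.edgeSet.ncard := by
  classical
  rw [listStart_eq_sum G n le_rfl, Finset.filter_true_of_mem (fun u _ => u.2),
    SimpleGraph.sum_degrees_eq_twice_card_edges, ← SimpleGraph.coe_edgeFinset,
    Set.ncard_coe_finset]

end Input

/-- Words hold the addresses of eight arrays of `(n + 2) ^ 2` cells, and products of two numbers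
below `(n + 2) ^ 2`. -/
theorem wordSize_bound (n : ℕ) : 8 * ((n + 2) ^ 2 * (n + 2) ^ 2) ≤ 2 ^ wordSize 11 n := by
  have h1 : n < 2 ^ (Nat.log 2 n + 1) := Nat.lt_pow_succ_log_self (by norm_num) n
  have h2 : 2 ≤ 2 ^ (Nat.log 2 n + 1) := by
    rw [pow_succ]
    have := Nat.one_le_two_pow (n := Nat.log 2 n)
    omega
  rw [wordSize, Nat.mul_comm 11, pow_mul]
  generalize 2 ^ (Nat.log 2 n + 1) = x at h1 h2
  have h3 : n + 2 ≤ x * x := by nlinarith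
  calc 8 * ((n + 2) ^ 2 * (n + 2) ^ 2) ≤ (x * x * x) * ((x * x) ^ 2 * (x * x) ^ 2) := by
        gcongr
        nlinarith [Nat.mul_le_mul h2 h2]
    _ = x ^ 11 := by ring

/-! ### The adjacency matrix -/

section Matrix

/-- Fill the array `1` with the adjacency matrix of the input graph. Register `0` holds `n`, and the
cells `1 + v` and `2 + v` hold the bounds of the adjacency list of `v`. -/
def buildMatrix : Cmd :=
  forLoop 4 (.lit 0) (.reg 0) <|
    forLoop 5 (.load (.lit 1 + .reg 4)) (.load (.lit 2 + .reg 4)) <|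
      .store (cell 1 (.reg 4 * .reg 0 + .load (.reg 5))) (.lit 1)

theorem matrix_index_lt {n u x : ℕ} (hu : u < n) (hx : x < n) : u * n + x < n * n := by
  calc u * n + x < u * n + n := by omega
    _ = (u + 1) * n := by ring
    _ ≤ n * n := Nat.mul_le_mul_right n hu

theorem matrix_index_inj {n : ℕ} {u x u' x' : Fin n} (h : u.val * n + x = u' * n + x') :
    u = u' ∧ x = x' := by
  have hu : u.val = u' := by
    have h1 := congrArg (· / n) h
    have hn : 0 < n := u.pos
    simpa [Nat.add_div_of_dvd_right, hn, Nat.div_eq_of_lt] using h1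
  refine ⟨Fin.ext hu, Fin.ext ?_⟩
  rw [hu] at h
  omega

variable {n w : ℕ} (G : SimpleGraph (Fin n))

/-- The registers `0` and `1` hold `n` and `(n + 2) ^ 2`. -/
def HasSize (n : ℕ) (s : State) : Prop := s.reg 0 = n ∧ s.reg 1 = (n + 2) ^ 2

/-- The array `0` holds the input. -/
def HasInput (s : State) : Prop := ∀ i < (n + 2) ^ 2, s.mem i = (inputWords G).getD i 0

/-- The array `1` holds the indicator matrix of the relation `P`. -/
def HasMatrix (P : Fin n → Fin n → Prop) (s : State) : Prop :=
  ∀ u x : Fin n, (P u x → s.mem ((n + 2) ^ 2 + (u * n + x)) = 1) ∧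
    (¬ P u x → s.mem ((n + 2) ^ 2 + (u * n + x)) = 0)

theorem HasMatrix.congr {P Q : Fin n → Fin n → Prop} {s : State} (h : HasMatrix P s)
    (hPQ : ∀ u x, P u x ↔ Q u x) : HasMatrix Q s := by
  intro u x
  rw [← hPQ]
  exact h u x

theorem le_of_word_bound {n w : ℕ} (hw : 8 * ((n + 2) ^ 2 * (n + 2) ^ 2) ≤ 2 ^ w) :
    n * n + 4 * n + 4 = (n + 2) ^ 2 ∧ 8 * (n + 2) ^ 2 ≤ 2 ^ w := by
  constructor
  · ring
  · have := Nat.mul_le_mul_left ((n + 2) ^ 2) (Nat.one_le_pow 2 (n + 2) (by omega))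
    omega

theorem HasInput.start {s : State} (h : HasInput G s) {v : ℕ} (hv : v ≤ n) :
    s.mem (1 + v) = listStart G v := by
  rw [h (1 + v) (by nlinarith), inputWords_start G hv]

theorem HasInput.entry {s : State} (h : HasInput G s) (v : Fin n) {p : ℕ} (h1 : listStart G v ≤ p)
    (h2 : p < listStart G (v + 1)) : ∃ x : Fin n, s.mem p = x ∧ G.Adj v x ∧
      (adjList G v)[p - listStart G v]? = some x.val := by
  have h3 := listStart_succ G v
  have h4 := listStart_le G (v + 1) v.2
  have h5 : (v.val + 1) * n ≤ n * n := Nat.mul_le_mul_right n v.2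
  have h6 : p - listStart G v < (adjList G v).length := by omega
  have h7 := inputWords_list G v h6
  rw [show listStart G v + (p - listStart G v) = p by omega] at h7
  obtain ⟨x, hx, hxe⟩ := (mem_adjList G v _).1 (List.getElem_mem h6)
  refine ⟨x, ?_, hx, ?_⟩
  · rw [h p (by nlinarith), h7, hxe]
  · rw [List.getElem?_eq_getElem h6, hxe]

theorem buildMatrix_achieves (hw : 8 * ((n + 2) ^ 2 * (n + 2) ^ 2) ≤ 2 ^ w) {s : State}
    (hs : HasSize n s) (hin : HasInput G s)
    (h0 : ∀ i, (n + 2) ^ 2 ≤ i → s.mem i = 0) :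
    Achieves w buildMatrix s (n * (n * 30 + 40) + 20)
      (fun s => HasSize n s ∧ HasInput G s ∧ HasMatrix G.Adj s) := by
  obtain ⟨hN, hN8⟩ := le_of_word_bound hw
  refine (Achieves.forLoop (lo := 0) (hi := n) (T := n * 30 + 20)
    (fun v s => s.reg 4 = v ∧ HasSize n s ∧ HasInput G s ∧
      HasMatrix (fun u x => u.val < v ∧ G.Adj u x) s) ?_ (Nat.zero_le _) (by omega)
    ?_ ?_ ?_).mono ?_ ?_
  · simp
  · refine ⟨by simp, by simpa [HasSize] using hs, hin, fun u x => ?_⟩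
    simp [h0]
  · rintro i s - - ⟨h4, hs, -⟩
    exact ⟨h4, hs.1⟩
  · rintro i s - hi ⟨h4, hs, hin, hM⟩
    have hst := listStart_succ G ⟨i, hi⟩
    have hlen := length_adjList_le G ⟨i, hi⟩
    have hst2 := listStart_le G (i + 1) hi
    have h5 : (i + 1) * n ≤ n * n := Nat.mul_le_mul_right n hi
    simp only at hst
    refine (Achieves.forLoop (lo := listStart G i) (hi := listStart G (i + 1)) (T := 12)
      (fun p s => s.reg 5 = p ∧ s.reg 4 = i ∧ HasSize n s ∧ HasInput G s ∧
        HasMatrix (fun u x => u.val < i ∧ G.Adj u x ∨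
          u.val = i ∧ x.val ∈ (adjList G u).take (p - listStart G i)) s)
      ?_ (by omega) (by omega) ?_ ?_ ?_).mono ?_ ?_
    · simp (disch := omega) [Nat.mod_eq_of_lt, h4, hin.start G hi.le]
    · refine ⟨by simp, by simpa, by simpa [HasSize] using hs, hin, ?_⟩
      exact HasMatrix.congr (s := ⟨_, s.mem⟩) hM (by simp)
    · rintro p s hp1 hp2 ⟨h5, h4, hs, hin, hM⟩
      have := hin.start G hi
      rw [show 1 + (i + 1) = 2 + i by ring] at this
      simp (disch := omega) [Nat.mod_eq_of_lt, h4, h5, this]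
    · rintro p s hp1 hp2 ⟨h5, h4, hs, hin, hM⟩
      obtain ⟨x, hx, hadj, hget⟩ := hin.entry G ⟨i, hi⟩ hp1 hp2
      have hix := matrix_index_lt hi x.2
      have hin0 : i * n ≤ n * n := Nat.mul_le_mul_right n hi.le
      refine Cmd.LoopFree.achieves (p := .store _ _) trivial ?_
      have hc : (cell 1 (.reg 4 * .reg 0 + .load (.reg 5))).eval w s
          = 1 * (n + 2) ^ 2 + (i * n + x.val) := by
        refine eval_cell hw hs.2 (by omega) ?_ (by omega)
        simp (disch := omega) [Nat.mod_eq_of_lt, h4, h5, hs.1, hx]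
      have h1 : (Expr.lit 1).eval w s = 1 := Nat.mod_eq_of_lt (by omega)
      simp only [Cmd.run, hc, h1, one_mul]
      refine ⟨h5, by simp, by simpa, by simpa [HasSize] using hs, fun j hj => ?_, fun u y => ?_⟩
      · simp only [Function.update_apply]
        rw [if_neg (by omega), hin j hj]
      · simp only [Function.update_apply, Nat.add_left_cancel_iff]
        rw [show p + 1 - listStart G i = (p - listStart G i) + 1 by omega]
        by_cases h : u.val * n + y = i * n + x
        · obtain ⟨hu, rfl⟩ := matrix_index_inj (u' := ⟨i, hi⟩) h
          subst hu
          rw [if_pos rfl]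
          refine ⟨fun _ => rfl, fun hn => absurd (Or.inr ⟨rfl, ?_⟩) hn⟩
          rw [List.take_add_one, hget]
          simp
        · rw [if_neg h]
          suffices hP : (u.val < i ∧ G.Adj u y ∨
              u.val = i ∧ y.val ∈ (adjList G u).take (p - listStart G i)) ↔
              (u.val < i ∧ G.Adj u y ∨
              u.val = i ∧ y.val ∈ (adjList G u).take (p - listStart G i + 1)) by
            rw [← hP]
            exact hM u y
          refine or_congr_right (and_congr_right fun hu => ?_)
          rw [List.take_add_one]
          obtain rfl : u = ⟨i, hi⟩ := Fin.ext hu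
          simp only [hget, List.mem_append, Option.mem_toList, Option.some.injEq]
          constructor
          · exact Or.inl
          · rintro (h' | h')
            · exact h'
            · exact absurd (by simp [h']) h
    · have hc : (Expr.load (.lit 2 + .reg 4)).cost = 4 ∧ (Expr.load (.lit 1 + .reg 4)).cost = 4 :=
        ⟨rfl, rfl⟩
      rw [hc.1, hc.2]
      have : (listStart G (i + 1) - listStart G i) * (12 + 4 + 7) ≤ n * 23 :=
        Nat.mul_le_mul_right _ (by omega)
      omega
    · rintro s ⟨-, h4, hs, hin, hM⟩
      refine ⟨h4, by simp, by simpa [HasSize] using hs, hin, ?_⟩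
      refine HasMatrix.congr (s := ⟨_, s.mem⟩) hM fun u x => ?_
      constructor
      · rintro (⟨h1, h2⟩ | ⟨h1, h2⟩)
        · exact ⟨by omega, h2⟩
        · obtain ⟨y, hy, hyx⟩ := (mem_adjList G _ _).1 (List.mem_of_mem_take h2)
          rw [← Fin.ext hyx]
          exact ⟨by omega, hy⟩
      · rintro ⟨h1, h2⟩
        rcases Nat.lt_succ_iff_lt_or_eq.1 h1 with h | h
        · exact Or.inl ⟨h, h2⟩
        · refine Or.inr ⟨h, ?_⟩
          obtain rfl : u = ⟨i, hi⟩ := Fin.ext h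
          rw [List.take_of_length_le (by omega)]
          exact (mem_adjList G _ _).2 ⟨x, h2, rfl⟩
  · have hc : (Expr.reg 0).cost = 1 ∧ (Expr.lit 0).cost = 1 := ⟨rfl, rfl⟩
    rw [hc.1, hc.2, Nat.sub_zero]
    have : n * (n * 30 + 20 + 1 + 7) ≤ n * (n * 30 + 40) := Nat.mul_le_mul_left _ (by omega)
    omega
  · rintro s ⟨-, hs, hin, hM⟩
    exact ⟨hs, hin, hM.congr (by simp)⟩

end Matrix

/-! ### Sorting the vertices by degree -/

section Sorting
variable {n w : ℕ} (G : SimpleGraph (Fin n))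

/-- The vertices are sorted by decreasing degree; ties are broken by the label. -/
noncomputable def sortKey (v : Fin n) : ℕ := (n - (adjList G v).length) * n + v

theorem sortKey_injective : Function.Injective (sortKey G) := by
  intro u v h
  have h1 := congrArg (· % n) h
  simpa [sortKey, Nat.mod_eq_of_lt, Fin.ext_iff] using h1

/-- The position of a vertex in the sorted order. -/
noncomputable def rank (v : Fin n) : ℕ := {u | sortKey G u < sortKey G v}.ncard

theorem rank_lt_rank {u v : Fin n} (h : sortKey G u < sortKey G v) : rank G u < rank G v := by
  refine Set.ncard_lt_ncard ?_ (Set.toFinite _)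
  refine ⟨fun x hx => lt_trans hx h, fun hsub => ?_⟩
  exact lt_irrefl (sortKey G u) (hsub (show u ∈ {x | sortKey G x < sortKey G v} from h))

theorem rank_lt (v : Fin n) : rank G v < n := by
  have h : rank G v < (Set.univ : Set (Fin n)).ncard := by
    refine Set.ncard_lt_ncard ⟨Set.subset_univ _, fun h => ?_⟩ (Set.toFinite _)
    exact lt_irrefl (sortKey G v) (h (Set.mem_univ v))
  simpa using h

theorem rank_injective : Function.Injective (rank G) := by
  intro u v h
  rcases lt_trichotomy (sortKey G u) (sortKey G v) with h' | h' | h'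
  · exact absurd h (rank_lt_rank G h').ne
  · exact sortKey_injective G h'
  · exact absurd h (rank_lt_rank G h').ne'

/-- The bijection between the positions in the sorted order and the vertices. -/
noncomputable def sortedVertex : Fin n ≃ Fin n :=
  (Equiv.ofBijective (fun v : Fin n => (⟨rank G v, rank_lt G v⟩ : Fin n))
    (Finite.injective_iff_bijective.1 fun _ _ h => rank_injective G (Fin.ext_iff.1 h))).symm

theorem rank_sortedVertex (i : Fin n) : rank G (sortedVertex G i) = i := by
  have := (Equiv.ofBijective (fun v : Fin n => (⟨rank G v, rank_lt G v⟩ : Fin n))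
    (Finite.injective_iff_bijective.1 fun _ _ h =>
      rank_injective G (Fin.ext_iff.1 h))).apply_symm_apply i
  exact congrArg Fin.val this

/-- The program's expression for the key of the vertex `e`. -/
def keyExpr (e : Expr) : Expr :=
  (.reg 0 - (.load (.lit 2 + e) - .load (.lit 1 + e))) * .reg 0 + e

/-- Fill the array `2` with the sorted list of the vertices: the position of a vertex is the number
of smaller vertices. -/
def sortVertices : Cmd :=
  forLoop 4 (.lit 0) (.reg 0) <|
    .seq (.assign 6 (.lit 0)) <|
    .seq (forLoop 5 (.lit 0) (.reg 0) <|
      .assign 6 (.reg 6 + .op .lt (keyExpr (.reg 5)) (keyExpr (.reg 4)))) <|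
    .store (cell 2 (.reg 6)) (.reg 4)

variable {G}

theorem eval_keyExpr (hw : 8 * ((n + 2) ^ 2 * (n + 2) ^ 2) ≤ 2 ^ w) {s : State}
    (hs : HasSize n s) (hin : HasInput G s) {e : Expr} (v : Fin n) (he : e.eval w s = v) :
    (keyExpr e).eval w s = sortKey G v := by
  obtain ⟨hN, hN8⟩ := le_of_word_bound hw
  have hv := v.2
  have h1 := hin.start G v.2.le
  have h2 := hin.start G (show v.val + 1 ≤ n from v.2)
  rw [show 1 + (v.val + 1) = 2 + v by ring, listStart_succ] at h2
  have h3 : (n - (adjList G v).length) * n ≤ n * n := Nat.mul_le_mul_right n (Nat.sub_le _ _)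
  simp (disch := omega) [keyExpr, Nat.mod_eq_of_lt, he, hs.1, h1, h2, sortKey]

/-- The array `2` holds the sorted list of the vertices. -/
def HasOrder (G : SimpleGraph (Fin n)) (s : State) : Prop :=
  ∀ v : Fin n, s.mem (2 * (n + 2) ^ 2 + rank G v) = v

theorem HasOrder.get {s : State} (h : HasOrder G s) (i : Fin n) :
    s.mem (2 * (n + 2) ^ 2 + i) = sortedVertex G i := by
  have := h (sortedVertex G i)
  rwa [rank_sortedVertex] at this

theorem sortVertices_achieves (hw : 8 * ((n + 2) ^ 2 * (n + 2) ^ 2) ≤ 2 ^ w) {s : State}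
    (hs : HasSize n s) (hin : HasInput G s) (hM : HasMatrix G.Adj s) :
    Achieves w sortVertices s (n * (n * 50 + 60) + 20)
      (fun s => HasSize n s ∧ HasMatrix G.Adj s ∧ HasOrder G s) := by
  obtain ⟨hN, hN8⟩ := le_of_word_bound hw
  refine (Achieves.forLoop (lo := 0) (hi := n) (T := n * 50 + 30)
    (fun i s => s.reg 4 = i ∧ HasSize n s ∧ HasInput G s ∧ HasMatrix G.Adj s ∧
      ∀ v : Fin n, v.val < i → s.mem (2 * (n + 2) ^ 2 + rank G v) = v) ?_ (Nat.zero_le _) (by omega)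
    ?_ ?_ ?_).mono ?_ ?_
  · simp
  · exact ⟨by simp, by simpa [HasSize] using hs, hin, hM, by simp⟩
  · rintro i s - - ⟨h4, hs, -⟩
    exact ⟨h4, hs.1⟩
  · rintro i s - hi ⟨h4, hs, hin, hM, hO⟩
    have hcount : ∀ s, s.reg 6 = 0 ∧ s.reg 4 = i ∧ HasSize n s ∧ HasInput G s ∧
        HasMatrix G.Adj s ∧ (∀ v : Fin n, v.val < i → s.mem (2 * (n + 2) ^ 2 + rank G v) = v) →
        Achieves w (forLoop 5 (.lit 0) (.reg 0) <|
          .assign 6 (.reg 6 + .op .lt (keyExpr (.reg 5)) (keyExpr (.reg 4)))) s (n * 46 + 6)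
          (fun s => s.reg 6 = rank G ⟨i, hi⟩ ∧ s.reg 4 = i ∧ HasSize n s ∧ HasInput G s ∧
            HasMatrix G.Adj s ∧
            (∀ v : Fin n, v.val < i → s.mem (2 * (n + 2) ^ 2 + rank G v) = v)) := by
      rintro s ⟨h6, h4, hs, hin, hM, hO⟩
      refine (Achieves.forLoop (lo := 0) (hi := n) (T := 38)
        (fun j s => s.reg 6 = {u : Fin n | u.val < j ∧ sortKey G u < sortKey G ⟨i, hi⟩}.ncard ∧
          s.reg 5 = j ∧ s.reg 4 = i ∧ HasSize n s ∧ HasInput G s ∧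
            HasMatrix G.Adj s ∧
            (∀ v : Fin n, v.val < i → s.mem (2 * (n + 2) ^ 2 + rank G v) = v)) ?_ (Nat.zero_le _)
        (by omega) ?_ ?_ ?_).mono ?_ ?_
      · simp
      · exact ⟨by simp [h6], by simp, by simp [h4], by simpa [HasSize] using hs, hin, hM, hO⟩
      · rintro j s - - ⟨-, h5, -, hs, -⟩
        exact ⟨h5, hs.1⟩
      · rintro j s - hj ⟨h6, h5, h4, hs, hin, hM, hO⟩
        refine (Cmd.LoopFree.achieves (p := .assign _ _) trivial ?_).mono
          (show Cmd.maxCost _ ≤ _ by simp [Cmd.maxCost, Expr.cost, keyExpr]; decide) (fun _ => id)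
        have k1 := eval_keyExpr hw hs hin (e := .reg 5) ⟨j, hj⟩ h5
        have k2 := eval_keyExpr hw hs hin (e := .reg 4) ⟨i, hi⟩ h4
        have hle : {u : Fin n | u.val < j ∧ sortKey G u < sortKey G ⟨i, hi⟩}.ncard ≤ n := by
          simpa using Set.ncard_le_ncard (Set.subset_univ
            {u : Fin n | u.val < j ∧ sortKey G u < sortKey G ⟨i, hi⟩})
        refine ⟨by simp [Cmd.run, h5], ?_, by simp, by simp [Cmd.run, h4],
          by simpa [Cmd.run, HasSize] using hs, hin, hM, hO⟩
        simp only [Cmd.run, Expr.eval_add, Expr.eval_lt, k1, k2, Expr.eval_reg, h6]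
        by_cases hlt : sortKey G ⟨j, hj⟩ < sortKey G ⟨i, hi⟩
        · rw [if_pos hlt, Nat.mod_eq_of_lt (show 1 < 2 ^ w by omega), Nat.mod_eq_of_lt (by omega)]
          have : {u : Fin n | u.val < j + 1 ∧ sortKey G u < sortKey G ⟨i, hi⟩} =
              insert ⟨j, hj⟩ {u : Fin n | u.val < j ∧ sortKey G u < sortKey G ⟨i, hi⟩} := by
            ext u
            simp only [Set.mem_insert_iff, Set.mem_ofPred_eq, Fin.ext_iff, Nat.lt_succ_iff_lt_or_eq]
            constructor
            · rintro ⟨h | h, h'⟩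
              · exact Or.inr ⟨h, h'⟩
              · exact Or.inl h
            · rintro (h | h)
              · obtain rfl : u = ⟨j, hj⟩ := Fin.ext h
                exact ⟨Or.inr rfl, hlt⟩
              · exact ⟨Or.inl h.1, h.2⟩
          rw [this, Set.ncard_insert_of_notMem (by simp)]
          simp
        · rw [if_neg hlt, Nat.zero_mod, add_zero, Nat.mod_eq_of_lt (by omega)]
          have : {u : Fin n | u.val < j + 1 ∧ sortKey G u < sortKey G ⟨i, hi⟩} =
              {u : Fin n | u.val < j ∧ sortKey G u < sortKey G ⟨i, hi⟩} := by
            ext u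
            simp only [Set.mem_ofPred_eq, Nat.lt_succ_iff_lt_or_eq]
            constructor
            · rintro ⟨h | h, h'⟩
              · exact ⟨h, h'⟩
              · obtain rfl : u = ⟨j, hj⟩ := Fin.ext h
                exact absurd h' hlt
            · exact fun h => ⟨Or.inl h.1, h.2⟩
          rw [this]
          simp
      · simp only [Expr.cost]
        omega
      · rintro s ⟨h6, -, h⟩
        refine ⟨?_, h⟩
        rw [h6, rank]
        congr 1
        ext u
        simp
    refine ((Cmd.LoopFree.achieves (p := .assign _ _) trivial
      (Q := fun s => s.reg 6 = 0 ∧ s.reg 4 = i ∧ HasSize n s ∧ HasInput G s ∧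
        HasMatrix G.Adj s ∧ ∀ v : Fin n, v.val < i → s.mem (2 * (n + 2) ^ 2 + rank G v) = v)
      ⟨by simp [Cmd.run], by simpa [Cmd.run], by simpa [HasSize, Cmd.run] using hs, hin, hM,
        hO⟩).seq fun s' hs' => (hcount s' hs').seq
      (T₂ := 10) (Q := fun s' => s'.reg 4 = i ∧ s'.reg 4 + 1 = i + 1 ∧ HasSize n s' ∧
        HasInput G s' ∧ HasMatrix G.Adj s' ∧
        ∀ v : Fin n, v.val < i + 1 → s'.mem (2 * (n + 2) ^ 2 + rank G v) = v) ?_).mono ?_ ?_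
    · rintro s ⟨h6, h4, hs, hin, hM, hO⟩
      have hr := rank_lt G ⟨i, hi⟩
      refine (Cmd.LoopFree.achieves (p := .store _ _) trivial ?_).mono (by decide) (fun _ => id)
      have hc : (cell 2 (.reg 6)).eval w s = 2 * (n + 2) ^ 2 + rank G ⟨i, hi⟩ :=
        eval_cell hw hs.2 (by omega) h6 (by omega)
      simp only [Cmd.run, hc, Expr.eval_reg, h4]
      refine ⟨trivial, trivial, hs, fun j hj => ?_, fun u x => ?_, fun v hv => ?_⟩
      · simp only [Function.update_apply]
        rw [if_neg (by omega), hin j hj]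
      · have := matrix_index_lt u.2 x.2
        simp only [Function.update_apply]
        rw [if_neg (by omega)]
        exact hM u x
      · simp only [Function.update_apply, Nat.add_left_cancel_iff]
        by_cases h : v.val = i
        · obtain rfl : v = ⟨i, hi⟩ := Fin.ext h
          simp
        · rw [if_neg, hO v (by omega)]
          intro h'
          exact h (congrArg Fin.val (rank_injective G h'))
    · simp only [Cmd.maxCost, Expr.cost]
      omega
    · rintro s ⟨h4, -, hs, hin, hM, hO⟩
      exact ⟨h4, by simp, by simpa [HasSize] using hs, hin, hM, hO⟩
  · have hc : (Expr.reg 0).cost = 1 ∧ (Expr.lit 0).cost = 1 := ⟨rfl, rfl⟩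
    rw [hc.1, hc.2, Nat.sub_zero]
    have : n * (n * 50 + 30 + 1 + 7) ≤ n * (n * 50 + 60) := Nat.mul_le_mul_left _ (by omega)
    omega
  · rintro s ⟨-, hs, hin, hM, hO⟩
    exact ⟨hs, hM, fun v => hO v v.2⟩

end Sorting

end WordRAM

/-! ### Splitting a block along the components of its complement -/

section Select
variable {n : ℕ} (G : SimpleGraph (Fin n))

/-- The common neighbours of the vertices in `A`. -/
noncomputable def commonNeighbors (A : Finset (Fin n)) : Finset (Fin n) :=
  open Classical in {v | ∀ a ∈ A, G.Adj a v}

variable {G} in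
theorem mem_commonNeighbors {A : Finset (Fin n)} {v : Fin n} :
    v ∈ commonNeighbors G A ↔ ∀ a ∈ A, G.Adj a v := by
  simp [commonNeighbors]

/-- A subset `A` of the block `B` is selectable if it contains at least a third of `B`, and either
it lies on one side of every two-colouring of `B` whose colour classes are completely joined
(as a subset of a component of the complement of `G` in `B` does), or it contains at most two
thirds of `B` and is completely joined to the rest of `B`. -/
def Selectable (B A : Finset (Fin n)) : Prop :=
  A ⊆ B ∧ B.card ≤ 3 * A.card ∧
    ((∀ c : Fin n → Bool, (∀ u ∈ B, ∀ v ∈ B, c u ≠ c v → G.Adj u v) →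
        ∀ u ∈ A, ∀ v ∈ A, c u = c v) ∨
      (3 * A.card ≤ 2 * B.card ∧ ∀ u ∈ A, ∀ v ∈ B \ A, G.Adj u v))

/-- The state of a breadth-first search in the complement of `G` in the block `B` of `q` vertices.
The vertices of `B` are `f 0, …, f (q - 1)`; the first `i` have been discovered, the first `h` have
been processed, those from `s` on belong to the current component, and the vertices from `lo` to
`hi - 1` form the selected set, unless `hi = 0`. -/
structure Search (B : Finset (Fin n)) (q h i s lo hi : ℕ) (f : ℕ → Fin n) : Prop where
  inj : Set.InjOn f (Set.Iio q)
  img : (Finset.range q).image f = B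
  s_le : s ≤ h
  h_le : h ≤ i
  i_le : i ≤ q
  side : ∀ c : Fin n → Bool, (∀ u ∈ B, ∀ v ∈ B, c u ≠ c v → G.Adj u v) →
    ∀ x y, s ≤ x → x < i → s ≤ y → y < i → c (f x) = c (f y)
  sep : ∀ x y, x < h → i ≤ y → y < q → G.Adj (f x) (f y)
  lo_le : lo ≤ hi
  hi_le : hi ≤ i
  choice : hi = 0 ∧ 3 * s < q ∨ Selectable G B ((Finset.Ico lo hi).image f)

variable {G}

theorem card_image_of_injOn_Iio {α : Type*} [DecidableEq α] {f : ℕ → α} {q : ℕ}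
    (hf : Set.InjOn f (Set.Iio q)) {S : Finset ℕ} (hS : ∀ x ∈ S, x < q) :
    (S.image f).card = S.card :=
  Finset.card_image_of_injOn (hf.mono fun x hx => hS x hx)

namespace Search
variable {B : Finset (Fin n)} {q h i s lo hi : ℕ} {f : ℕ → Fin n}

theorem card_eq (S : Search G B q h i s lo hi f) : B.card = q := by
  rw [← S.img, card_image_of_injOn_Iio S.inj (by simp), Finset.card_range]

theorem mem (S : Search G B q h i s lo hi f) {x : ℕ} (hx : x < q) : f x ∈ B := by
  rw [← S.img]
  exact Finset.mem_image_of_mem f (Finset.mem_range.2 hx)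

theorem start (hf : Set.InjOn f (Set.Iio q)) (hB : (Finset.range q).image f = B) (hq : 0 < q) :
    Search G B q 0 0 0 0 0 f where
  inj := hf
  img := hB
  s_le := le_rfl
  h_le := le_rfl
  i_le := Nat.zero_le _
  side := by intros; omega
  sep := by intros; omega
  lo_le := le_rfl
  hi_le := le_rfl
  choice := Or.inl ⟨rfl, by omega⟩

/-- When the queue is empty, the discovered vertices are completely joined to the others. -/
theorem close (S : Search G B q h h s lo hi f) (hq : h < q) (h1 : hi = 0 → 3 * (h - s) < q) :
    (q ≤ 3 * h ∧ 3 * h ≤ 2 * q → Search G B q h (h + 1) h 0 h f) ∧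
    (¬ (q ≤ 3 * h ∧ 3 * h ≤ 2 * q) → Search G B q h (h + 1) h lo hi f) := by
  have side : ∀ c : Fin n → Bool, (∀ u ∈ B, ∀ v ∈ B, c u ≠ c v → G.Adj u v) →
      ∀ x y, h ≤ x → x < h + 1 → h ≤ y → y < h + 1 → c (f x) = c (f y) := by
    intro c _ x y h1 h2 h3 h4
    rw [show x = y by omega]
  have hs := S.s_le
  constructor
  · rintro ⟨h2, h3⟩
    refine ⟨S.inj, S.img, le_rfl, by omega, hq, side, fun x y hx hy => S.sep x y hx (by omega),
      Nat.zero_le _, by omega, Or.inr ⟨?_, ?_, Or.inr ⟨?_, ?_⟩⟩⟩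
    · intro v hv
      obtain ⟨x, hx, rfl⟩ := Finset.mem_image.1 hv
      exact S.mem ((Finset.mem_Ico.1 hx).2.trans hq)
    · rw [card_image_of_injOn_Iio S.inj (by simp; omega), S.card_eq]
      simpa
    · rw [card_image_of_injOn_Iio S.inj (by simp; omega), S.card_eq]
      simpa
    · intro u hu v hv
      obtain ⟨x, hx, rfl⟩ := Finset.mem_image.1 hu
      rw [Finset.mem_sdiff, ← S.img] at hv
      obtain ⟨y, hy, rfl⟩ := Finset.mem_image.1 hv.1
      rw [Finset.mem_Ico] at hx
      refine S.sep x y hx.2 ?_ (Finset.mem_range.1 hy)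
      by_contra! hlt
      exact hv.2 (Finset.mem_image_of_mem f (by simpa))
  · intro hn
    refine ⟨S.inj, S.img, le_rfl, by omega, hq, side, fun x y hx hy => S.sep x y hx (by omega),
      S.lo_le, S.hi_le.trans (by omega), ?_⟩
    rcases S.choice with ⟨h0, h2⟩ | h2
    · have := h1 h0
      exact Or.inl ⟨h0, by omega⟩
    · exact Or.inr h2

/-- A non-neighbour of the vertex in process is discovered and moved to the end of the queue. -/
theorem swap (S : Search G B q h i s lo hi f) (hhi : h < i) {j : ℕ} (hij : i ≤ j) (hj : j < q)
    (hadj : ¬ G.Adj (f h) (f j)) :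
    Search G B q h (i + 1) s lo hi (f ∘ Equiv.swap i j) := by
  have hlt : ∀ x, x < i → (f ∘ Equiv.swap i j) x = f x := fun x hx => by
    rw [Function.comp, Equiv.swap_apply_of_ne_of_ne (by omega) (by omega)]
  have hmaps : ∀ x, x < q → Equiv.swap i j x < q := fun x hx => by
    rw [Equiv.swap_apply_def]
    split_ifs <;> omega
  have hge : ∀ x, i ≤ x → i ≤ Equiv.swap i j x := fun x hx => by
    rw [Equiv.swap_apply_def]
    split_ifs <;> omega
  have hS := S.s_le
  refine ⟨?_, ?_, S.s_le, S.h_le.trans (by omega), by omega, ?_, ?_, S.lo_le,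
    S.hi_le.trans (by omega), ?_⟩
  · intro x hx y hy hxy
    exact (Equiv.swap i j).injective (S.inj (hmaps x hx) (hmaps y hy) hxy)
  · rw [← S.img]
    ext v
    simp only [Finset.mem_image, Finset.mem_range, Function.comp]
    constructor
    · rintro ⟨x, hx, rfl⟩
      exact ⟨_, hmaps x hx, rfl⟩
    · rintro ⟨x, hx, rfl⟩
      exact ⟨_, hmaps x hx, by rw [Equiv.swap_apply_self]⟩
  · intro c hc
    have key : ∀ x, s ≤ x → x < i + 1 → c ((f ∘ Equiv.swap i j) x) = c (f h) := by
      intro x h1 h2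
      rcases Nat.lt_succ_iff_lt_or_eq.1 h2 with h3 | rfl
      · rw [hlt x h3]
        exact S.side c hc x h h1 h3 hS hhi
      · rw [Function.comp, Equiv.swap_apply_left]
        by_contra hne
        exact hadj (hc _ (S.mem (by omega)) _ (S.mem hj) (Ne.symm hne))
    intro x y h1 h2 h3 h4
    rw [key x h1 h2, key y h3 h4]
  · intro x y hx hy hyq
    rw [hlt x (by omega)]
    exact S.sep x _ hx (hge y (by omega)) (hmaps y hyq)
  · rcases S.choice with h0 | h0
    · exact Or.inl h0
    · refine Or.inr ?_
      rwa [Finset.image_congr (g := f)]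
      intro x hx
      have := S.hi_le
      exact hlt x (by simp at hx; omega)

theorem next (S : Search G B q h i s lo hi f) (hhi : h < i)
    (hadj : ∀ y, i ≤ y → y < q → G.Adj (f h) (f y)) : Search G B q (h + 1) i s lo hi f where
  inj := S.inj
  img := S.img
  s_le := S.s_le.trans (by omega)
  h_le := hhi
  i_le := S.i_le
  side := S.side
  sep x y hx hy hyq := by
    rcases Nat.lt_succ_iff_lt_or_eq.1 hx with hx | rfl
    · exact S.sep x y hx hy hyq
    · exact hadj y hy hyq
  lo_le := S.lo_le
  hi_le := S.hi_le
  choice := S.choice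

theorem choose (S : Search G B q h i s lo hi f) (hi' : q ≤ 3 * (i - s)) :
    Search G B q h i s s i f where
  inj := S.inj
  img := S.img
  s_le := S.s_le
  h_le := S.h_le
  i_le := S.i_le
  side := S.side
  sep := S.sep
  lo_le := S.s_le.trans S.h_le
  hi_le := le_rfl
  choice := by
    have hiq := S.i_le
    refine Or.inr ⟨?_, ?_, Or.inl ?_⟩
    · intro v hv
      obtain ⟨x, hx, rfl⟩ := Finset.mem_image.1 hv
      rw [Finset.mem_Ico] at hx
      exact S.mem (by omega)
    · rw [card_image_of_injOn_Iio S.inj (by simp; omega), S.card_eq]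
      simpa
    · intro c hc u hu v hv
      obtain ⟨x, hx, rfl⟩ := Finset.mem_image.1 hu
      obtain ⟨y, hy, rfl⟩ := Finset.mem_image.1 hv
      rw [Finset.mem_Ico] at hx hy
      exact S.side c hc x y hx.1 hx.2 hy.1 hy.2

/-- At the end of the search a set has been selected: otherwise the finished components and the
last component would each contain less than a third of the block. -/
theorem finish (S : Search G B q q i s lo hi f) (h1 : hi = 0 → 3 * (i - s) < q) :
    Selectable G B ((Finset.Ico lo hi).image f) := by
  rcases S.choice with ⟨h0, h2⟩ | h2
  · have h3 := h1 h0
    have h4 := S.h_le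
    omega
  · exact h2

end Search

end Select

namespace WordRAM

section Block
variable {n w : ℕ} (G : SimpleGraph (Fin n))

/-! ### Programs for the search in a block -/

/-- What the program knows throughout the main loop: the size, the adjacency matrix and the sorted
order; the registers `2` and `3` hold the size `q` and the first position `st` of the current
block; and the best biclique found so far has been written to the output cells, register `10` holds
the size of its sides, which is at least `m`. -/
structure Ready (q st m : ℕ) (s : State) : Prop where
  size : HasSize n s
  matrix : HasMatrix G.Adj s
  order : HasOrder G s
  reg2 : s.reg 2 = q
  reg3 : s.reg 3 = st
  best : ∃ L R : Finset (Fin n), Outputs s L R ∧ IsBalancedBiclique G L R ∧ m ≤ L.card ∧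
    s.reg 10 = L.card

variable {G}

theorem card_fin_le (L : Finset (Fin n)) : L.card ≤ n := by
  simpa using Finset.card_le_univ L

theorem Outputs.congr {s s' : State} {L R : Finset (Fin n)}
    (h : Outputs s L R) (hmem : ∀ a < (n + 2) ^ 2, s'.mem a = s.mem a) : Outputs s' L R := by
  obtain ⟨h1, h2, h3, h4⟩ := h
  have hL := card_fin_le L
  refine ⟨h1, by rw [hmem 0 (by positivity), h2], ?_, ?_⟩
  · rw [h3]
    refine Finset.image_congr fun i hi => (hmem _ ?_).symm
    simp at hi
    nlinarith
  · rw [h4]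
    refine Finset.image_congr fun i hi => (hmem _ ?_).symm
    simp at hi
    nlinarith

theorem Ready.congr {q st m : ℕ} {s s' : State} (h : Ready G q st m s)
    (hmem : ∀ a < 3 * (n + 2) ^ 2, s'.mem a = s.mem a) (h0 : s'.reg 0 = s.reg 0)
    (h1 : s'.reg 1 = s.reg 1) (h2 : s'.reg 2 = s.reg 2) (h3 : s'.reg 3 = s.reg 3)
    (h10 : s'.reg 10 = s.reg 10) : Ready G q st m s' where
  size := ⟨h0.trans h.size.1, h1.trans h.size.2⟩
  matrix u x := by
    have := matrix_index_lt u.2 x.2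
    rw [hmem _ (by nlinarith)]
    exact h.matrix u x
  order v := by
    have := rank_lt G v
    rw [hmem _ (by nlinarith)]
    exact h.order v
  reg2 := h2.trans h.reg2
  reg3 := h3.trans h.reg3
  best := by
    obtain ⟨L, R, hO, hB, hm, hr⟩ := h.best
    exact ⟨L, R, hO.congr fun a ha => hmem a (by omega), hB, hm, h10.trans hr⟩

/-- The array `3` holds the vertices `f 0, …, f (q - 1)`. -/
def HasBlock (f : ℕ → Fin n) (q : ℕ) (s : State) : Prop :=
  ∀ x < q, s.mem (3 * (n + 2) ^ 2 + x) = f x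

/-- Copy the current block from the sorted list to the array `3`. -/
def copyBlock : Cmd :=
  forLoop 4 (.lit 0) (.reg 2) (.store (cell 3 (.reg 4)) (.load (cell 2 (.reg 3 + .reg 4))))

theorem copyBlock_achieves (hw : 8 * ((n + 2) ^ 2 * (n + 2) ^ 2) ≤ 2 ^ w) {s : State} {q st m : ℕ}
    (hs : Ready G q st m s) (hq : st + q ≤ n) {f : ℕ → Fin n}
    (hf : ∀ x, (hx : x < q) → f x = sortedVertex G ⟨st + x, by omega⟩) :
    Achieves w copyBlock s (q * 30 + 10) (fun s => Ready G q st m s ∧ HasBlock f q s) := by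
  obtain ⟨hN, hN8⟩ := le_of_word_bound hw
  refine (Achieves.forLoop (lo := 0) (hi := q) (T := 15)
    (fun i s => s.reg 4 = i ∧ Ready G q st m s ∧ HasBlock f i s) ?_ (Nat.zero_le _) (by omega)
    ?_ ?_ ?_).mono ?_ ?_
  · simp
  · exact ⟨by simp, hs.congr (by simp) (by simp) (by simp) (by simp) (by simp) (by simp),
      fun x hx => by omega⟩
  · rintro i s - - ⟨h4, hs, -⟩
    exact ⟨h4, hs.reg2⟩
  · rintro i s - hi ⟨h4, hs, hb⟩
    refine (Cmd.LoopFree.achieves (p := .store _ _) trivial ?_).mono (by decide) (fun _ => id)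
    have hc : (cell 3 (.reg 4)).eval w s = 3 * (n + 2) ^ 2 + i :=
      eval_cell hw hs.size.2 (by omega) h4 (by omega)
    have hc' : (cell 2 (.reg 3 + .reg 4)).eval w s = 2 * (n + 2) ^ 2 + (st + i) :=
      eval_cell hw hs.size.2 (by omega)
        (by simp (disch := omega) [Nat.mod_eq_of_lt, h4, hs.reg3]) (by omega)
    simp only [Cmd.run, hc, Expr.eval_load, hc']
    refine ⟨h4, by simp, hs.congr (fun a ha => ?_) (by simp) (by simp) (by simp) (by simp)
      (by simp), fun x hx => ?_⟩
    · simp only [Function.update_apply]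
      rw [if_neg (by omega)]
    · simp only [Function.update_apply, Nat.add_left_cancel_iff]
      split_ifs with h
      · subst h
        rw [hf x hi]
        exact hs.order.get ⟨st + x, by omega⟩
      · exact hb x (by omega)
  · simp only [Expr.cost]
    omega
  · rintro s ⟨-, hs, hb⟩
    exact ⟨hs, hb⟩

/-- The program's expression for the adjacency of the entries `x` and `y` of the array `3`. -/
def blockAdj (x y : Expr) : Expr :=
  .load (cell 1 (.load (cell 3 x) * .reg 0 + .load (cell 3 y)))

theorem eval_blockAdj (hw : 8 * ((n + 2) ^ 2 * (n + 2) ^ 2) ≤ 2 ^ w) {s : State} {q st m x y : ℕ}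
    (hs : Ready G q st m s) {f : ℕ → Fin n} (hb : HasBlock f q s) (hq : q ≤ n) {ex ey : Expr}
    (hx : ex.eval w s = x) (hy : ey.eval w s = y) (hxq : x < q) (hyq : y < q) :
    (blockAdj ex ey).eval w s = 0 ↔ ¬ G.Adj (f x) (f y) := by
  obtain ⟨hN, hN8⟩ := le_of_word_bound hw
  have h1 : (cell 3 ex).eval w s = 3 * (n + 2) ^ 2 + x :=
    eval_cell hw hs.size.2 (by omega) hx (by omega)
  have h2 : (cell 3 ey).eval w s = 3 * (n + 2) ^ 2 + y :=
    eval_cell hw hs.size.2 (by omega) hy (by omega)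
  have h3 := matrix_index_lt (f x).2 (f y).2
  have h4 : (cell 1 (.load (cell 3 ex) * .reg 0 + .load (cell 3 ey))).eval w s
      = 1 * (n + 2) ^ 2 + ((f x).val * n + (f y).val) := by
    refine eval_cell hw hs.size.2 (by omega) ?_ (by omega)
    simp (disch := omega) [Nat.mod_eq_of_lt, h1, h2, hb x hxq, hb y hyq, hs.size.1]
  have h5 := hs.matrix (f x) (f y)
  rw [blockAdj, Expr.eval_load, h4, one_mul]
  constructor
  · intro h hadj
    rw [h5.1 hadj] at h
    exact one_ne_zero h
  · exact h5.2

/-- Exchange the entries in the registers `5` and `6` of the array `3`, and increase register `6`. -/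
def swapEntries : Cmd :=
  .seq (.assign 11 (.load (cell 3 (.reg 5)))) <|
  .seq (.store (cell 3 (.reg 5)) (.load (cell 3 (.reg 6)))) <|
  .seq (.store (cell 3 (.reg 6)) (.reg 11)) <|
  .assign 6 (.reg 6 + .lit 1)

theorem run_swapEntries (hw : 8 * ((n + 2) ^ 2 * (n + 2) ^ 2) ≤ 2 ^ w) {s : State}
    {q st m i j : ℕ} (hs : Ready G q st m s) {f : ℕ → Fin n} (hb : HasBlock f q s) (hq : q ≤ n)
    (h5 : s.reg 5 = j) (h6 : s.reg 6 = i) (hi : i < q) (hj : j < q) :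
    Ready G q st m (swapEntries.run w s) ∧ HasBlock (f ∘ Equiv.swap i j) q (swapEntries.run w s) ∧
      (swapEntries.run w s).reg 6 = i + 1 ∧
      ∀ r, r ≠ 6 → r ≠ 11 → (swapEntries.run w s).reg r = s.reg r := by
  obtain ⟨hN, hN8⟩ := le_of_word_bound hw
  have h1 := hs.size.2
  have hrun : swapEntries.run w s = ⟨Function.update (Function.update s.reg 11 (f j)) 6 (i + 1),
      Function.update (Function.update s.mem (3 * (n + 2) ^ 2 + j) (f i))
        (3 * (n + 2) ^ 2 + i) (f j)⟩ := by
    simp (disch := omega) [swapEntries, Cmd.run, cell, h1, h5, h6, hb i hi, hb j hj,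
      Nat.mod_eq_of_lt]
  rw [hrun]
  refine ⟨hs.congr (fun a ha => ?_) (by simp) (by simp) (by simp) (by simp) (by simp),
    fun x hx => ?_, by simp, fun r h6 h11 => by simp [h6, h11]⟩
  · simp only [Function.update_apply]
    rw [if_neg (by omega), if_neg (by omega)]
  · simp only [Function.update_apply, Nat.add_left_cancel_iff, Function.comp,
      Equiv.swap_apply_def]
    split_ifs <;> first | rfl | exact hb x hx

/-- The invariant of the search: the registers `4, 6, 7, 8, 9` hold `h, i, s, lo, hi`. -/
structure Searching (B : Finset (Fin n)) (G : SimpleGraph (Fin n)) (q st m h i s lo hi : ℕ)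
    (f : ℕ → Fin n) (σ : State) : Prop where
  ready : Ready G q st m σ
  block : HasBlock f q σ
  search : Search G B q h i s lo hi f
  reg4 : σ.reg 4 = h
  reg6 : σ.reg 6 = i
  reg7 : σ.reg 7 = s
  reg8 : σ.reg 8 = lo
  reg9 : σ.reg 9 = hi

theorem run_ite_lt (hw : 1 < 2 ^ w) (x y : Expr) (p q : Cmd) (s : State) :
    (Cmd.ite (.op .lt x y) p q).run w s =
      if x.eval w s < y.eval w s then p.run w s else q.run w s := by
  rw [Cmd.run, Expr.eval_lt]
  split_ifs with h1 h2 h2 <;> simp_all [Nat.mod_eq_of_lt]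

theorem run_ite_eq (hw : 1 < 2 ^ w) (x y : Expr) (p q : Cmd) (s : State) :
    (Cmd.ite (.op .eq x y) p q).run w s =
      if x.eval w s = y.eval w s then p.run w s else q.run w s := by
  rw [Cmd.run, Expr.eval_eq]
  split_ifs with h1 h2 h2 <;> simp_all [Nat.mod_eq_of_lt]

/-- If the queue is empty, close the component and start a new one. The vertices discovered until
then are selected if they make up between one third and two thirds of the block. -/
def closeComponent : Cmd :=
  .ite (.op .eq (.reg 4) (.reg 6))
    (.seq (.assign 7 (.reg 4)) <|
      .seq (.ite (.op .lt (.reg 2) (.lit 3 * .reg 7 + .lit 1))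
        (.ite (.op .lt (.lit 3 * .reg 7) (.lit 2 * .reg 2 + .lit 1))
          (.seq (.assign 8 (.lit 0)) (.assign 9 (.reg 7))) .skip) .skip) <|
      .assign 6 (.reg 6 + .lit 1))
    .skip

theorem closeComponent_achieves (hw : 8 * ((n + 2) ^ 2 * (n + 2) ^ 2) ≤ 2 ^ w) {σ : State}
    {B : Finset (Fin n)} {q st m h i s lo hi : ℕ} {f : ℕ → Fin n}
    (S : Searching B G q st m h i s lo hi f σ) (hq : q ≤ n) (hh : h < q)
    (h1 : hi = 0 → 3 * (i - s) < q) :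
    Achieves w closeComponent σ 60 (fun σ => ∃ i s lo hi,
      Searching B G q st m h i s lo hi f σ ∧ h < i) := by
  obtain ⟨hN, hN8⟩ := le_of_word_bound hw
  refine (Cmd.LoopFree.achieves (p := closeComponent) (by simp [closeComponent, Cmd.LoopFree])
    ?_).mono (by decide) (fun _ => id)
  obtain ⟨hR, hb, hS, h4, h6, h7, h8, h9⟩ := S
  have h2 := hR.reg2
  rw [closeComponent, run_ite_eq (by omega), Expr.eval_reg, Expr.eval_reg, h4, h6]
  split_ifs with hhi
  · subst hhi
    have hcl := hS.close hh h1
    have hrun : (Cmd.seq (.assign 7 (.reg 4)) <|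
        .seq (.ite (.op .lt (.reg 2) (.lit 3 * .reg 7 + .lit 1))
        (.ite (.op .lt (.lit 3 * .reg 7) (.lit 2 * .reg 2 + .lit 1))
          (.seq (.assign 8 (.lit 0)) (.assign 9 (.reg 7))) .skip) .skip) <|
        .assign 6 (.reg 6 + .lit 1)).run w σ =
        ⟨if q ≤ 3 * h ∧ 3 * h ≤ 2 * q then
          Function.update (Function.update (Function.update (Function.update σ.reg 7 h) 8 0) 9 h)
            6 (h + 1)
          else Function.update (Function.update σ.reg 7 h) 6 (h + 1), σ.mem⟩ := by
      have h1w : 1 < 2 ^ w := by omega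
      rw [Cmd.run, Cmd.run, Cmd.run, run_ite_lt h1w, run_ite_lt h1w]
      simp (disch := omega) only [Cmd.run, Expr.eval_reg, Expr.eval_add, Expr.eval_mul,
        Expr.eval_lit, h4, h2, Nat.mod_eq_of_lt, Function.update_apply, if_true, if_false,
        Nat.reduceEqDiff, Nat.lt_succ_iff]
      split_ifs <;> first | omega | simp (disch := omega) [h6, Nat.mod_eq_of_lt]
    rw [hrun]
    split_ifs with hA
    · refine ⟨h + 1, h, 0, h, ?_, by omega⟩
      exact ⟨hR.congr (by simp) (by simp) (by simp) (by simp) (by simp) (by simp), hb,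
        hcl.1 hA, by simp [h4], by simp, by simp, by simp, by simp⟩
    · refine ⟨h + 1, h, lo, hi, ?_, by omega⟩
      exact ⟨hR.congr (by simp) (by simp) (by simp) (by simp) (by simp) (by simp), hb,
        hcl.2 hA, by simp [h4], by simp, by simp, by simp [h8], by simp [h9]⟩
  · have := hS.h_le
    exact ⟨i, s, lo, hi, ⟨hR, hb, hS, h4, h6, h7, h8, h9⟩, by omega⟩

/-- Discover the undiscovered non-neighbours of the entry in register `4`. -/
def discover : Cmd :=
  forLoop 5 (.reg 6) (.reg 2) (.ite (blockAdj (.reg 4) (.reg 5)) .skip swapEntries)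

theorem discover_achieves (hw : 8 * ((n + 2) ^ 2 * (n + 2) ^ 2) ≤ 2 ^ w) {σ : State}
    {B : Finset (Fin n)} {q st m h i s lo hi : ℕ} {f : ℕ → Fin n}
    (S : Searching B G q st m h i s lo hi f σ) (hq : q ≤ n) (hh : h < i) :
    Achieves w discover σ (q * 100 + 10) (fun σ => ∃ i f,
      Searching B G q st m (h + 1) i s lo hi f ⟨Function.update σ.reg 4 (h + 1), σ.mem⟩ ∧
      σ.reg 4 = h) := by
  obtain ⟨hN, hN8⟩ := le_of_word_bound hw
  have hiq := S.search.i_le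
  refine (Achieves.forLoop (w := w) (a := .reg 6) (lo := i) (hi := q) (T := 90)
    (fun j σ => ∃ i f, Searching B G q st m h i s lo hi f σ ∧ h < i ∧ i ≤ j ∧ σ.reg 5 = j ∧
      ∀ y, i ≤ y → y < j → G.Adj (f h) (f y)) S.reg6 hiq (by omega)
    ?_ ?_ ?_).mono ?_ ?_
  · obtain ⟨hR, hb, hS, h4, h6, h7, h8, h9⟩ := S
    exact ⟨i, f, ⟨hR.congr (by simp) (by simp) (by simp) (by simp) (by simp) (by simp), hb, hS,
      by simpa, by simpa, by simpa, by simpa, by simpa⟩, hh, le_rfl, by simp, by intros; omega⟩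
  · rintro j σ - - ⟨i, f, S, -, -, h5, -⟩
    exact ⟨h5, S.ready.reg2⟩
  · rintro j σ - hj ⟨i, f, S, hh, hij, h5, hadj⟩
    have hev := eval_blockAdj hw S.ready S.block hq (ex := .reg 4) (ey := .reg 5) S.reg4 h5
      (by omega) hj
    refine (Achieves.ite (T := 50) (fun hne => ?_) (fun h0 => ?_)).mono (by decide) (fun _ => id)
    · refine (Cmd.LoopFree.achieves (p := .skip) trivial ?_).mono (by decide) (fun _ => id)
      obtain ⟨hR, hb, hS, h4, h6, h7, h8, h9⟩ := S
      refine ⟨h5, i, f, ⟨hR.congr (by simp [Cmd.run]) (by simp [Cmd.run]) (by simp [Cmd.run])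
        (by simp [Cmd.run]) (by simp [Cmd.run]) (by simp [Cmd.run]), hb, hS,
        by simpa, by simpa, by simpa, by simpa, by simpa⟩, hh, by omega, by simp,
        fun y hy hyj => ?_⟩
      rcases Nat.lt_succ_iff_lt_or_eq.1 hyj with hyj | rfl
      · exact hadj y hy hyj
      · by_contra hcon
        exact hne (hev.2 hcon)
    · refine (Cmd.LoopFree.achieves (p := swapEntries) (by simp [swapEntries, Cmd.LoopFree])
        ?_).mono (by decide) (fun _ => id)
      obtain ⟨hR, hb, hS, h4, h6, h7, h8, h9⟩ := S
      obtain ⟨r1, r2, r3, r4⟩ := run_swapEntries hw hR hb hq h5 h6 (by omega) hj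
      have hS' := hS.swap hh hij hj (hev.1 h0)
      refine ⟨by rw [r4 5 (by omega) (by omega), h5], i + 1, _,
        ⟨r1.congr (by simp) (by simp) (by simp) (by simp) (by simp) (by simp), r2, hS',
        ?_, ?_, ?_, ?_, ?_⟩, by omega, by omega, by simp, fun y hy hyj => ?_⟩
      · simp [r4, h4]
      · simp [r3]
      · simp [r4, h7]
      · simp [r4, h8]
      · simp [r4, h9]
      · have hfh : (f ∘ Equiv.swap i j) h = f h := by
          rw [Function.comp, Equiv.swap_apply_of_ne_of_ne (by omega) (by omega)]
        rw [hfh, Function.comp]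
        rcases Nat.lt_succ_iff_lt_or_eq.1 hyj with hyj | rfl
        · rw [Equiv.swap_apply_of_ne_of_ne (by omega) (by omega)]
          exact hadj y (by omega) hyj
        · rw [Equiv.swap_apply_right]
          exact hadj i le_rfl (by omega)
  · have hc : (Expr.reg 6).cost = 1 ∧ (Expr.reg 2).cost = 1 := ⟨rfl, rfl⟩
    rw [hc.1, hc.2]
    have : (q - i) * (90 + 1 + 7) ≤ q * 98 := Nat.mul_le_mul_right _ (by omega)
    omega
  · rintro σ ⟨i, f, ⟨hR, hb, hS, h4, h6, h7, h8, h9⟩, hh, hi, h5, hadj⟩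
    exact ⟨i, f, ⟨hR.congr (by simp) (by simp) (by simp) (by simp) (by simp) (by simp), hb,
      hS.next hh hadj, by simp, by simpa, by simpa, by simpa, by simpa⟩, h4⟩

/-- Select the current component if it is large enough. -/
def selectComponent : Cmd :=
  .ite (.op .lt (.reg 2) (.lit 3 * (.reg 6 - .reg 7) + .lit 1))
    (.seq (.assign 8 (.reg 7)) (.assign 9 (.reg 6))) .skip

/-- Breadth-first search in the complement of the block. -/
def searchBlock : Cmd :=
  .seq (.assign 6 (.lit 0)) <| .seq (.assign 7 (.lit 0)) <| .seq (.assign 8 (.lit 0)) <|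
  .seq (.assign 9 (.lit 0)) <|
  forLoop 4 (.lit 0) (.reg 2) (.seq closeComponent (.seq discover selectComponent))

theorem selectComponent_achieves (hw : 8 * ((n + 2) ^ 2 * (n + 2) ^ 2) ≤ 2 ^ w) {σ : State}
    {B : Finset (Fin n)} {q st m h i s lo hi : ℕ} {f : ℕ → Fin n}
    (S : Searching B G q st m (h + 1) i s lo hi f ⟨Function.update σ.reg 4 (h + 1), σ.mem⟩)
    (hq0 : 0 < q) (hq : q ≤ n) (h4 : σ.reg 4 = h) :
    Achieves w selectComponent σ 20 (fun σ => σ.reg 4 = h ∧ ∃ lo hi,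
      Searching B G q st m (h + 1) i s lo hi f ⟨Function.update σ.reg 4 (h + 1), σ.mem⟩ ∧
      (hi = 0 → 3 * (i - s) < q)) := by
  obtain ⟨hN, hN8⟩ := le_of_word_bound hw
  refine (Cmd.LoopFree.achieves (p := selectComponent) (by simp [selectComponent, Cmd.LoopFree])
    ?_).mono (by decide) (fun _ => id)
  obtain ⟨hR, hb, hS, -, h6, h7, h8, h9⟩ := S
  have h2 := hR.reg2
  have hiq := hS.i_le
  simp only [Function.update_apply, Nat.reduceEqDiff, if_false] at h2 h6 h7 h8 h9
  have hev : (Expr.lit 3 * (.reg 6 - .reg 7) + .lit 1).eval w σ = 3 * (i - s) + 1 := by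
    simp (disch := omega) [h6, h7, Nat.mod_eq_of_lt]
  rw [selectComponent, run_ite_lt (by omega), Expr.eval_reg, h2, hev]
  split_ifs with hlt
  · have hS' := hS.choose (Nat.lt_succ_iff.1 hlt)
    refine ⟨by simp [Cmd.run, h4], s, i, ⟨hR.congr (by simp [Cmd.run]) (by simp [Cmd.run])
      (by simp [Cmd.run]) (by simp [Cmd.run]) (by simp [Cmd.run]) (by simp [Cmd.run]), hb, hS',
      by simp, by simp [Cmd.run, h6], by simp [Cmd.run, h7], by simp [Cmd.run, h7],
      by simp [Cmd.run, h6]⟩, fun h0 => ?_⟩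
    omega
  · refine ⟨h4, lo, hi, ⟨hR, hb, hS, by simp, by simpa [Cmd.run], by simpa [Cmd.run],
      by simpa [Cmd.run], by simpa [Cmd.run]⟩, fun _ => by omega⟩

theorem searchBlock_achieves (hw : 8 * ((n + 2) ^ 2 * (n + 2) ^ 2) ≤ 2 ^ w) {σ : State}
    {B : Finset (Fin n)} {q st m : ℕ} {f : ℕ → Fin n} (hR : Ready G q st m σ)
    (hb : HasBlock f q σ) (hf : Set.InjOn f (Set.Iio q)) (hB : (Finset.range q).image f = B)
    (hq0 : 0 < q) (hq : q ≤ n) :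
    Achieves w searchBlock σ (q * (q * 100 + 100) + 20) (fun σ => ∃ i s lo hi f,
      Searching B G q st m q i s lo hi f σ ∧
      Selectable G B ((Finset.Ico lo hi).image f)) := by
  obtain ⟨hN, hN8⟩ := le_of_word_bound hw
  have hloop : ∀ σ, Ready G q st m σ ∧ HasBlock f q σ ∧ σ.reg 6 = 0 ∧ σ.reg 7 = 0 ∧ σ.reg 8 = 0 ∧
      σ.reg 9 = 0 → Achieves w
      (forLoop 4 (.lit 0) (.reg 2) (.seq closeComponent (.seq discover selectComponent))) σ
      (q * (q * 100 + 100) + 6) (fun σ => ∃ i s lo hi f, Searching B G q st m q i s lo hi f σ ∧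
      Selectable G B ((Finset.Ico lo hi).image f)) := by
    rintro σ ⟨hR, hb, h6, h7, h8, h9⟩
    refine (Achieves.forLoop (lo := 0) (hi := q) (T := 60 + ((q * 100 + 10) + 20))
      (fun h σ => ∃ i s lo hi f, Searching B G q st m h i s lo hi f σ ∧
        (hi = 0 → 3 * (i - s) < q)) ?_ (Nat.zero_le _) (by omega) ?_ ?_ ?_).mono ?_ ?_
    · simp
    · exact ⟨0, 0, 0, 0, f, ⟨hR.congr (by simp) (by simp) (by simp) (by simp) (by simp) (by simp),
        hb, Search.start hf hB hq0, by simp, by simpa, by simpa, by simpa, by simpa⟩, fun _ => hq0⟩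
    · rintro h σ - - ⟨i, s, lo, hi, f, S, -⟩
      exact ⟨S.reg4, S.ready.reg2⟩
    · rintro h σ - hh ⟨i, s, lo, hi, f, S, h1⟩
      refine (closeComponent_achieves hw S hq hh h1).seq ?_
      rintro σ ⟨i, s, lo, hi, S, hhi⟩
      refine (discover_achieves hw S hq hhi).seq ?_
      rintro σ ⟨i, f, S, h4⟩
      refine (selectComponent_achieves hw S hq0 hq h4).mono le_rfl ?_
      rintro σ ⟨h4, lo, hi, S, h1⟩
      exact ⟨h4, i, s, lo, hi, f, S, h1⟩
    · simp only [Expr.cost]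
      have : (q - 0) * (60 + (q * 100 + 10 + 20) + 1 + 7) ≤ q * (q * 100 + 100) :=
        Nat.mul_le_mul (by omega) (by omega)
      omega
    · rintro σ ⟨i, s, lo, hi, f, S, h1⟩
      exact ⟨i, s, lo, hi, f, S, S.search.finish h1⟩
  have hz : ∀ σ : State, ∀ r, Cmd.run w (.assign r (.lit 0)) σ = ⟨Function.update σ.reg r 0, σ.mem⟩ :=
    fun σ r => by simp [Cmd.run]
  refine ((Cmd.LoopFree.achieves (p := .assign 6 (.lit 0)) trivial (Q := fun σ =>
    Ready G q st m σ ∧ HasBlock f q σ ∧ σ.reg 6 = 0) ?_).seq fun σ h =>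
    (Cmd.LoopFree.achieves (p := .assign 7 (.lit 0)) trivial (Q := fun σ =>
    Ready G q st m σ ∧ HasBlock f q σ ∧ σ.reg 6 = 0 ∧ σ.reg 7 = 0) ?_).seq fun σ h =>
    (Cmd.LoopFree.achieves (p := .assign 8 (.lit 0)) trivial (Q := fun σ =>
    Ready G q st m σ ∧ HasBlock f q σ ∧ σ.reg 6 = 0 ∧ σ.reg 7 = 0 ∧ σ.reg 8 = 0) ?_).seq fun σ h =>
    (Cmd.LoopFree.achieves (p := .assign 9 (.lit 0)) trivial ?_).seq hloop).mono ?_ (fun _ => id)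
  · rw [hz]
    exact ⟨hR.congr (by simp) (by simp) (by simp) (by simp) (by simp) (by simp), hb, by simp⟩
  · rw [hz]
    exact ⟨h.1.congr (by simp) (by simp) (by simp) (by simp) (by simp) (by simp), h.2.1,
      by simp [h.2.2]⟩
  · rw [hz]
    exact ⟨h.1.congr (by simp) (by simp) (by simp) (by simp) (by simp) (by simp), h.2.1,
      by simp [h.2.2]⟩
  · rw [hz]
    exact ⟨h.1.congr (by simp) (by simp) (by simp) (by simp) (by simp) (by simp), h.2.1,
      by simp [h.2.2]⟩
  · simp only [Cmd.maxCost, Expr.cost]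
    omega

/-! ### Common neighbours and output -/

/-- List the common neighbours of the selected vertices in the array `4`, their number in
register `6`. -/
def listCommon : Cmd :=
  .seq (.assign 6 (.lit 0)) <|
  forLoop 4 (.lit 0) (.reg 0) <|
    .seq (.assign 7 (.lit 1)) <|
    .seq (forLoop 5 (.reg 8) (.reg 9) <|
      .assign 7 (.reg 7 * .load (cell 1 (.load (cell 3 (.reg 5)) * .reg 0 + .reg 4)))) <|
    .ite (.reg 7) (.seq (.store (cell 4 (.reg 6)) (.reg 4)) (.assign 6 (.reg 6 + .lit 1))) .skip

/-- The array `3` holds `f 0, …, f (q - 1)`, and the registers `8` and `9` hold `lo` and `hi`. -/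
structure Selected (G : SimpleGraph (Fin n)) (q st m lo hi : ℕ) (f : ℕ → Fin n) (σ : State) :
    Prop where
  ready : Ready G q st m σ
  block : HasBlock f q σ
  reg8 : σ.reg 8 = lo
  reg9 : σ.reg 9 = hi

theorem Selected.setReg {q st m lo hi : ℕ} {f : ℕ → Fin n} {σ : State}
    (S : Selected G q st m lo hi f σ) {r x : ℕ} (hr : 3 < r ∧ r < 8) :
    Selected G q st m lo hi f ⟨Function.update σ.reg r x, σ.mem⟩ := by
  have h : ∀ k, k ≤ 3 ∨ 8 ≤ k → Function.update σ.reg r x k = σ.reg k := fun k hk => by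
    rw [Function.update_of_ne (by omega)]
  exact ⟨S.ready.congr (fun _ _ => rfl) (h _ (by omega)) (h _ (by omega)) (h _ (by omega))
    (h _ (by omega)) (h _ (by omega)), S.block, (h _ (by omega)).trans S.reg8,
    (h _ (by omega)).trans S.reg9⟩

/-- The array `4` holds the common neighbours of `A` with labels below `v`, without repetition,
and register `6` holds their number. -/
def HasCommon (G : SimpleGraph (Fin n)) (A : Finset (Fin n)) (v : ℕ) (g : ℕ → Fin n)
    (σ : State) : Prop :=
  Set.InjOn g (Set.Iio (σ.reg 6)) ∧
    (Finset.range (σ.reg 6)).image g = (commonNeighbors G A).filter (fun u => u.val < v) ∧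
    ∀ x < σ.reg 6, σ.mem (4 * (n + 2) ^ 2 + x) = g x

theorem listCommon_achieves (hw : 8 * ((n + 2) ^ 2 * (n + 2) ^ 2) ≤ 2 ^ w) {σ : State}
    {q st m lo hi : ℕ} {f : ℕ → Fin n} (S : Selected G q st m lo hi f σ) (hq : q ≤ n)
    (hlo : lo ≤ hi) (hhi : hi ≤ q) :
    Achieves w listCommon σ (n * (q * 50 + 50) + 20) (fun σ => Selected G q st m lo hi f σ ∧
      ∃ g, HasCommon G ((Finset.Ico lo hi).image f) n g σ) := by
  obtain ⟨hN, hN8⟩ := le_of_word_bound hw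
  set A := (Finset.Ico lo hi).image f with hA
  have hcheck : ∀ v (hv : v < n) g σ, (Selected G q st m lo hi f σ ∧ HasCommon G A v g σ ∧
      σ.reg 4 = v ∧ σ.reg 7 = 1) → Achieves w (forLoop 5 (.reg 8) (.reg 9) <|
      .assign 7 (.reg 7 * .load (cell 1 (.load (cell 3 (.reg 5)) * .reg 0 + .reg 4)))) σ
      (q * 40 + 6) (fun σ => Selected G q st m lo hi f σ ∧ HasCommon G A v g σ ∧ σ.reg 4 = v ∧
        (σ.reg 7 = 1 ∧ ⟨v, hv⟩ ∈ commonNeighbors G A ∨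
          σ.reg 7 = 0 ∧ ⟨v, hv⟩ ∉ commonNeighbors G A)) := by
    rintro v hv g σ ⟨S, hC, h4, h7⟩
    refine (Achieves.forLoop (w := w) (a := .reg 8) (lo := lo) (hi := hi) (T := 25)
      (fun p σ => Selected G q st m lo hi f σ ∧ HasCommon G A v g σ ∧ σ.reg 4 = v ∧ σ.reg 5 = p ∧
        (σ.reg 7 = 1 ∧ (∀ x, lo ≤ x → x < p → G.Adj (f x) ⟨v, hv⟩) ∨
          σ.reg 7 = 0 ∧ ¬ (∀ x, lo ≤ x → x < p → G.Adj (f x) ⟨v, hv⟩))) S.reg8 hlo (by omega)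
      ?_ ?_ ?_).mono ?_ ?_
    · exact ⟨S.setReg (by omega), by simpa [HasCommon] using hC, by simpa, by simp,
        Or.inl ⟨by simpa, by intros; omega⟩⟩
    · rintro p σ - - ⟨S, -, -, h5, -⟩
      exact ⟨h5, S.reg9⟩
    · rintro p σ hlp hp ⟨S, hC, h4, h5, h7⟩
      refine (Cmd.LoopFree.achieves (p := .assign _ _) trivial ?_).mono (by decide) (fun _ => id)
      have hb := S.block p (by omega)
      have hs := S.ready.size
      have hm := S.ready.matrix (f p) ⟨v, hv⟩
      have h3 := matrix_index_lt (f p).2 hv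
      have hc1 : (cell 3 (.reg 5)).eval w σ = 3 * (n + 2) ^ 2 + p :=
        eval_cell hw hs.2 (by omega) h5 (by omega)
      have hc2 : (cell 1 (.load (cell 3 (.reg 5)) * .reg 0 + .reg 4)).eval w σ
          = 1 * (n + 2) ^ 2 + ((f p).val * n + v) := by
        refine eval_cell hw hs.2 (by omega) ?_ (by omega)
        simp (disch := omega) [Nat.mod_eq_of_lt, hc1, hb, hs.1, h4]
      rw [one_mul] at hc2
      have hstep : (∀ x, lo ≤ x → x < p + 1 → G.Adj (f x) ⟨v, hv⟩) ↔
          (∀ x, lo ≤ x → x < p → G.Adj (f x) ⟨v, hv⟩) ∧ G.Adj (f p) ⟨v, hv⟩ := by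
        constructor
        · intro h
          exact ⟨fun x h1 h2 => h x h1 (by omega), h p hlp (by omega)⟩
        · rintro ⟨h, h'⟩ x h1 h2
          rcases Nat.lt_succ_iff_lt_or_eq.1 h2 with h3 | rfl
          · exact h x h1 h3
          · exact h'
      have hval : (Expr.reg 7 * .load (cell 1 (.load (cell 3 (.reg 5)) * .reg 0 + .reg 4))).eval w σ
          = σ.reg 7 * σ.mem ((n + 2) ^ 2 + ((f p).val * n + v)) := by
        rw [Expr.eval_mul, Expr.eval_load, hc2, Expr.eval_reg]
        refine Nat.mod_eq_of_lt ?_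
        have hm1 : σ.mem ((n + 2) ^ 2 + ((f p).val * n + v)) ≤ 1 := by
          by_cases hadj : G.Adj (f p) ⟨v, hv⟩
          · exact (hm.1 hadj).le
          · exact (hm.2 hadj).le.trans (by omega)
        rcases h7 with h | h <;> rw [h.1] <;> omega
      simp only [Cmd.run, hval]
      refine ⟨by simpa, (S.setReg (by omega)).setReg (by omega), by simpa [HasCommon] using hC,
        by simpa, by simp, ?_⟩
      rw [hstep]
      simp only [Function.update_apply, Nat.reduceEqDiff, if_false, if_true]
      by_cases hadj : G.Adj (f p) ⟨v, hv⟩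
      · rw [show σ.mem ((n + 2) ^ 2 + ((f p).val * n + v)) = 1 from hm.1 hadj, mul_one]
        rcases h7 with h | h
        · exact Or.inl ⟨h.1, h.2, hadj⟩
        · exact Or.inr ⟨h.1, fun h' => h.2 h'.1⟩
      · rw [show σ.mem ((n + 2) ^ 2 + ((f p).val * n + v)) = 0 from hm.2 hadj, mul_zero]
        exact Or.inr ⟨rfl, fun h' => hadj h'.2⟩
    · simp only [Expr.cost]
      have : (hi - lo) * (25 + 1 + 7) ≤ q * 33 := Nat.mul_le_mul_right _ (by omega)
      omega
    · rintro σ ⟨S, hC, h4, -, h7⟩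
      have hmem : (⟨v, hv⟩ : Fin n) ∈ commonNeighbors G A ↔
          ∀ x, lo ≤ x → x < hi → G.Adj (f x) ⟨v, hv⟩ := by
        simp only [mem_commonNeighbors, hA, Finset.mem_image, Finset.mem_Ico]
        constructor
        · exact fun h x h1 h2 => h _ ⟨x, ⟨h1, h2⟩, rfl⟩
        · rintro h _ ⟨x, ⟨h1, h2⟩, rfl⟩
          exact h x h1 h2
      exact ⟨S, hC, h4, by rwa [hmem]⟩
  have hloop : ∀ σ, Selected G q st m lo hi f σ ∧ σ.reg 6 = 0 → Achieves w
      (forLoop 4 (.lit 0) (.reg 0) <|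
        .seq (.assign 7 (.lit 1)) <|
        .seq (forLoop 5 (.reg 8) (.reg 9) <|
          .assign 7 (.reg 7 * .load (cell 1 (.load (cell 3 (.reg 5)) * .reg 0 + .reg 4)))) <|
        .ite (.reg 7) (.seq (.store (cell 4 (.reg 6)) (.reg 4)) (.assign 6 (.reg 6 + .lit 1))) .skip)
      σ (n * (q * 50 + 50) + 6) (fun σ => Selected G q st m lo hi f σ ∧
        ∃ g, HasCommon G A n g σ) := by
    rintro σ ⟨S, h6⟩
    refine (Achieves.forLoop (lo := 0) (hi := n) (T := 2 + ((q * 40 + 6) + 20))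
      (fun v σ => Selected G q st m lo hi f σ ∧ σ.reg 4 = v ∧ ∃ g, HasCommon G A v g σ)
      ?_ (Nat.zero_le _) (by omega) ?_ ?_ ?_).mono ?_ ?_
    · simp
    · refine ⟨S.setReg (by omega), by simp, fun x => if h : 0 < n then ⟨0, h⟩ else (f x), ?_⟩
      simp [HasCommon, h6]
    · rintro v σ - - ⟨S, h4, -⟩
      exact ⟨h4, S.ready.size.1⟩
    · rintro v σ - hv ⟨S, h4, g, hC⟩
      refine (Cmd.LoopFree.achieves (p := .assign 7 (.lit 1)) trivial ?_).seq fun σ hσ =>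
        (hcheck v hv g σ hσ).seq ?_
      · simp (disch := omega) only [Cmd.run, Expr.eval_lit, Nat.mod_eq_of_lt]
        exact ⟨S.setReg (by omega), by simpa [HasCommon] using hC, by simpa, by simp⟩
      · clear hσ S h4 hC
        rintro σ ⟨S, ⟨hC1, hC2, hC3⟩, h4, h7⟩
        have hcard : σ.reg 6 ≤ v := by
          have h1 := congrArg Finset.card hC2
          rw [card_image_of_injOn_Iio hC1 (by simp), Finset.card_range] at h1
          rw [h1]
          have h2 : ((commonNeighbors G A).filter (fun u => u.val < v)).image Fin.val
              ⊆ Finset.range v := by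
            intro x hx
            obtain ⟨u, hu, rfl⟩ := Finset.mem_image.1 hx
            simpa using (Finset.mem_filter.1 hu).2
          have h3 := Finset.card_le_card h2
          rwa [Finset.card_image_of_injective _ Fin.val_injective, Finset.card_range] at h3
        have hfilter : (commonNeighbors G A).filter (fun u => u.val < v + 1) =
            if (⟨v, hv⟩ : Fin n) ∈ commonNeighbors G A then
              insert ⟨v, hv⟩ ((commonNeighbors G A).filter (fun u => u.val < v))
            else (commonNeighbors G A).filter (fun u => u.val < v) := by
          ext u
          split_ifs with hin <;>
            simp only [Finset.mem_insert, Finset.mem_filter, Nat.lt_succ_iff_lt_or_eq]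
          · constructor
            · rintro ⟨h1, h2 | h2⟩
              · exact Or.inr ⟨h1, h2⟩
              · exact Or.inl (Fin.ext h2)
            · rintro (rfl | h1)
              · exact ⟨hin, Or.inr rfl⟩
              · exact ⟨h1.1, Or.inl h1.2⟩
          · constructor
            · rintro ⟨h1, h2 | h2⟩
              · exact ⟨h1, h2⟩
              · obtain rfl : u = ⟨v, hv⟩ := Fin.ext h2
                exact absurd h1 hin
            · rintro ⟨h1, h2⟩
              exact ⟨h1, Or.inl h2⟩
        refine (Cmd.LoopFree.achieves (p := .ite _ _ _) (by simp [Cmd.LoopFree]) ?_).mono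
          (by decide) (fun _ => id)
        rw [Cmd.run, Expr.eval_reg]
        rcases h7 with ⟨h7, hin⟩ | ⟨h7, hin⟩
        · rw [if_neg (by omega)]
          have hc : (cell 4 (.reg 6)).eval w σ = 4 * (n + 2) ^ 2 + σ.reg 6 :=
            eval_cell hw S.ready.size.2 (by omega) rfl (by omega)
          simp (disch := omega) only [Cmd.run, hc, Expr.eval_reg, Expr.eval_add, Expr.eval_lit,
            Nat.mod_eq_of_lt, h4]
          have hm : ∀ a < 4 * (n + 2) ^ 2, Function.update σ.mem (4 * (n + 2) ^ 2 + σ.reg 6) v a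
              = σ.mem a := fun a ha => by rw [Function.update_of_ne (by omega)]
          refine ⟨by simpa, ⟨S.ready.congr (fun a ha => hm a (by omega)) (by simp) (by simp)
            (by simp) (by simp) (by simp), fun x hx => ?_, by simp [S.reg8], by simp [S.reg9]⟩,
            by simp, Function.update g (σ.reg 6) ⟨v, hv⟩, ?_⟩
          · exact (hm _ (by omega)).trans (S.block x hx)
          · have hg : ∀ x < σ.reg 6, Function.update g (σ.reg 6) ⟨v, hv⟩ x = g x :=
              fun x hx => Function.update_of_ne hx.ne _ _
            have hgv : ∀ x < σ.reg 6, g x ≠ ⟨v, hv⟩ := fun x hx h => by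
              have : g x ∈ (Finset.range (σ.reg 6)).image g :=
                Finset.mem_image_of_mem _ (by simpa)
              rw [hC2, h] at this
              simp at this
            simp only [HasCommon, Function.update_apply, Nat.reduceEqDiff, if_false, if_true]
            refine ⟨?_, ?_, ?_⟩
            · intro x hx y hy hxy
              simp only [Set.mem_Iio] at hx hy
              rw [Function.update_apply, Function.update_apply] at hxy
              split_ifs at hxy with h1 h2 h2
              · omega
              · exact absurd hxy.symm (hgv y (by omega))
              · exact absurd hxy (hgv x (by omega))
              · exact hC1 (show x < _ by omega) (show y < _ by omega) hxy
            · rw [hfilter, if_pos hin, Finset.range_add_one, Finset.image_insert, ← hC2]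
              rw [Function.update_self]
              congr 1
              exact Finset.image_congr fun x hx => hg x (by simpa using hx)
            · intro x hx
              simp only [Nat.add_left_cancel_iff]
              split_ifs with h1
              · rfl
              · exact hC3 x (by omega)
        · rw [if_pos h7]
          simp only [Cmd.run]
          refine ⟨h4, S.setReg (by omega), by simp, g, ?_⟩
          simp only [HasCommon, Function.update_apply, Nat.reduceEqDiff, if_false]
          rw [hfilter, if_neg hin]
          exact ⟨hC1, hC2, hC3⟩
    · simp only [Expr.cost]
      have : (n - 0) * (2 + (q * 40 + 6 + 20) + 1 + 7) ≤ n * (q * 50 + 50) :=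
        Nat.mul_le_mul (by omega) (by omega)
      omega
    · rintro σ ⟨S, -, h⟩
      exact ⟨S, h⟩
  refine ((Cmd.LoopFree.achieves (p := .assign 6 (.lit 0)) trivial ?_).seq hloop).mono
    ?_ (fun _ => id)
  · simp only [Cmd.run, Expr.eval_lit, Nat.zero_mod]
    exact ⟨S.setReg (by omega), by simp⟩
  · simp only [Cmd.maxCost, Expr.cost]
    omega

end Block

section Save
variable {n w : ℕ} {G : SimpleGraph (Fin n)}

theorem Ready.save {q st m : ℕ} {s s' : State} (h : Ready G q st m s)
    (hmem : ∀ a, (n + 2) ^ 2 ≤ a → s'.mem a = s.mem a)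
    (hreg : ∀ r, r ≠ 5 → r ≠ 10 → s'.reg r = s.reg r) {m' : ℕ}
    (hbest : ∃ L R : Finset (Fin n), Outputs s' L R ∧ IsBalancedBiclique G L R ∧ m' ≤ L.card ∧
      s'.reg 10 = L.card) : Ready G q st m' s' where
  size := ⟨(hreg 0 (by omega) (by omega)).trans h.size.1,
    (hreg 1 (by omega) (by omega)).trans h.size.2⟩
  matrix u x := by
    rw [hmem _ (by omega)]
    exact h.matrix u x
  order v := by
    rw [hmem _ (by omega)]
    exact h.order v
  reg2 := (hreg 2 (by omega) (by omega)).trans h.reg2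
  reg3 := (hreg 3 (by omega) (by omega)).trans h.reg3
  best := hbest

/-- Write the first `k` selected vertices and the first `k` of their common neighbours to the output
cells, where `k` is in register `10`. -/
def writeOutput : Cmd :=
  .seq (.store (.lit 0) (.reg 10)) <|
  forLoop 5 (.lit 0) (.reg 10) <|
    .seq (.store (.lit 1 + .reg 5) (.load (cell 3 (.reg 8 + .reg 5)))) <|
    .store (.lit 1 + .reg 10 + .reg 5) (.load (cell 4 (.reg 5)))

theorem writeOutput_achieves (hw : 8 * ((n + 2) ^ 2 * (n + 2) ^ 2) ≤ 2 ^ w) {σ : State}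
    {q st m lo hi k : ℕ} {f g : ℕ → Fin n} (S : Selected G q st m lo hi f σ) (hq : q ≤ n)
    (hhi : hi ≤ q) (hf : Set.InjOn f (Set.Iio q))
    (hC : HasCommon G ((Finset.Ico lo hi).image f) n g σ) (hlo : lo + k ≤ hi)
    (hk : k ≤ σ.reg 6) :
    Achieves w writeOutput ⟨Function.update σ.reg 10 k, σ.mem⟩ (n * 50 + 20) (Ready G q st k) := by
  obtain ⟨hN, hN8⟩ := le_of_word_bound hw
  have hcard : σ.reg 6 ≤ n := by
    rw [← Finset.card_range (σ.reg 6), ← card_image_of_injOn_Iio hC.1 (by simp)]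
    exact card_fin_le _
  have hloop : ∀ σ', (∀ r, r ≠ 5 → r ≠ 10 → σ'.reg r = σ.reg r) ∧ σ'.reg 10 = k ∧
      (∀ a, (n + 2) ^ 2 ≤ a → σ'.mem a = σ.mem a) ∧ σ'.mem 0 = k → Achieves w
      (forLoop 5 (.lit 0) (.reg 10) <|
        .seq (.store (.lit 1 + .reg 5) (.load (cell 3 (.reg 8 + .reg 5)))) <|
        .store (.lit 1 + .reg 10 + .reg 5) (.load (cell 4 (.reg 5)))) σ' (n * 50 + 6)
      (Ready G q st k) := by
    rintro σ' ⟨hreg, h10, hmem, h0⟩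
    refine (Achieves.forLoop (lo := 0) (hi := k) (T := 30)
      (fun j σ' => σ'.reg 5 = j ∧ (∀ r, r ≠ 5 → r ≠ 10 → σ'.reg r = σ.reg r) ∧ σ'.reg 10 = k ∧
        (∀ a, (n + 2) ^ 2 ≤ a → σ'.mem a = σ.mem a) ∧ σ'.mem 0 = k ∧
        (∀ x < j, σ'.mem (1 + x) = f (lo + x)) ∧ ∀ x < j, σ'.mem (1 + k + x) = g x)
      ?_ (Nat.zero_le _) (by omega) ?_ ?_ ?_).mono ?_ ?_
    · simp
    · refine ⟨by simp, fun r hr hr' => ?_, by simpa, hmem, h0, by simp, by simp⟩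
      dsimp only
      rw [Function.update_of_ne hr, hreg r hr hr']
    · rintro j σ' - - ⟨h5, -, h10, -⟩
      exact ⟨h5, h10⟩
    · rintro j σ' - hj ⟨h5, hreg, r10, hmem, h0, h3, h4⟩
      refine (Cmd.LoopFree.achieves (p := .seq (.store _ _) (.store _ _)) (by simp [Cmd.LoopFree])
        ?_).mono (by decide) (fun _ => id)
      have hs1 : ∀ τ : State, τ.reg = σ'.reg → τ.reg 1 = (n + 2) ^ 2 := fun τ hτ => by
        rw [hτ, hreg 1 (by omega) (by omega), S.ready.size.2]
      have r8 : σ'.reg 8 = lo := (hreg 8 (by omega) (by omega)).trans S.reg8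
      have hc1 : (cell 3 (.reg 8 + .reg 5)).eval w σ' = 3 * (n + 2) ^ 2 + (lo + j) :=
        eval_cell hw (hs1 _ rfl) (by omega)
          (by simp (disch := omega) [Nat.mod_eq_of_lt, h5, r8]) (by omega)
      have hc2 : ∀ mem, (cell 4 (.reg 5)).eval w ⟨σ'.reg, mem⟩ = 4 * (n + 2) ^ 2 + j :=
        fun mem => eval_cell hw (hs1 _ rfl) (by omega) h5 (by omega)
      have hb1 : σ'.mem (3 * (n + 2) ^ 2 + (lo + j)) = f (lo + j) :=
        (hmem _ (by omega)).trans (S.block _ (by omega))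
      have hb2 : σ'.mem (4 * (n + 2) ^ 2 + j) = g j :=
        (hmem _ (by omega)).trans (hC.2.2 _ (by omega))
      have hrun : Cmd.run w (.seq (.store (.lit 1 + .reg 5) (.load (cell 3 (.reg 8 + .reg 5))))
          (.store (.lit 1 + .reg 10 + .reg 5) (.load (cell 4 (.reg 5))))) σ' =
          ⟨σ'.reg, Function.update (Function.update σ'.mem (1 + j) (f (lo + j)))
            (1 + k + j) (g j)⟩ := by
        have e1 : (1 + j) % 2 ^ w = 1 + j := Nat.mod_eq_of_lt (by omega)
        have e2 : (1 + k + j) % 2 ^ w = 1 + k + j := Nat.mod_eq_of_lt (by omega)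
        have e3 : 1 % 2 ^ w = 1 := Nat.mod_eq_of_lt (by omega)
        have e4 : (1 + k) % 2 ^ w = 1 + k := Nat.mod_eq_of_lt (by omega)
        simp only [Cmd.run, Expr.eval_add, Expr.eval_lit, Expr.eval_reg, Expr.eval_load, hc1, hc2,
          hb1, h5, r10, e1, e2, e3, e4]
        rw [Function.update_of_ne (by omega), hb2]
      rw [hrun]
      refine ⟨h5, by simp, fun r hr hr' => ?_, by simpa, fun a ha => ?_, ?_, fun x hx => ?_,
        fun x hx => ?_⟩
      · dsimp only
        rw [Function.update_of_ne hr, hreg r hr hr']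
      · dsimp only
        rw [Function.update_of_ne (by omega), Function.update_of_ne (by omega), hmem a ha]
      · dsimp only
        rw [Function.update_of_ne (by omega), Function.update_of_ne (by omega), h0]
      · dsimp only
        rw [Function.update_of_ne (by omega)]
        rcases Nat.lt_succ_iff_lt_or_eq.1 hx with hx | rfl
        · rw [Function.update_of_ne (by omega), h3 x hx]
        · rw [Function.update_self]
      · dsimp only
        rcases Nat.lt_succ_iff_lt_or_eq.1 hx with hx | rfl
        · rw [Function.update_of_ne (by omega), Function.update_of_ne (by omega), h4 x hx]
        · rw [Function.update_self]
    · simp only [Expr.cost]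
      have : (k - 0) * (30 + 1 + 7) ≤ n * 38 := Nat.mul_le_mul_right _ (by omega)
      omega
    · rintro σ' ⟨-, hreg, h10, hmem, h0, h3, h4⟩
      have hcL : ((Finset.Ico lo (lo + k)).image f).card = k := by
        rw [card_image_of_injOn_Iio hf (by simp; omega)]
        simp
      have hcR : ((Finset.range k).image g).card = k := by
        rw [card_image_of_injOn_Iio hC.1 (by simp; omega)]
        simp
      refine S.ready.save hmem hreg
        ⟨(Finset.Ico lo (lo + k)).image f, (Finset.range k).image g,
        ⟨hcL.trans hcR.symm, h0.trans hcL.symm, ?_, ?_⟩, ⟨hcL.trans hcR.symm, ?_⟩, hcL.ge,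
        h10.trans hcL.symm⟩
      · rw [hcL]
        ext v
        simp only [Finset.mem_image, Finset.mem_Ico, Finset.mem_range]
        constructor
        · rintro ⟨_, ⟨x, hx, rfl⟩, rfl⟩
          refine ⟨x - lo, by omega, ?_⟩
          rw [h3 _ (by omega), Nat.add_sub_cancel' hx.1]
        · rintro ⟨x, hx, rfl⟩
          exact ⟨_, ⟨lo + x, by omega, rfl⟩, (h3 x hx).symm⟩
      · rw [hcL]
        ext v
        simp only [Finset.mem_image, Finset.mem_range]
        constructor
        · rintro ⟨_, ⟨x, hx, rfl⟩, rfl⟩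
          exact ⟨x, hx, h4 x hx⟩
        · rintro ⟨x, hx, rfl⟩
          exact ⟨_, ⟨x, hx, rfl⟩, (h4 x hx).symm⟩
      · intro u hu v hv
        obtain ⟨x, hx, rfl⟩ := Finset.mem_image.1 hu
        obtain ⟨y, hy, rfl⟩ := Finset.mem_image.1 hv
        have h5 : g y ∈ (Finset.range (σ.reg 6)).image g :=
          Finset.mem_image_of_mem _ (by simp at hy ⊢; omega)
        rw [hC.2.1, Finset.mem_filter, mem_commonNeighbors] at h5
        exact h5.1 _ (Finset.mem_image_of_mem f (by simp at hx ⊢; omega))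
  refine ((Cmd.LoopFree.achieves (p := .store _ _) trivial ?_).seq hloop).mono
    ?_ (fun _ => id)
  · simp only [Cmd.run, Expr.eval_lit, Nat.zero_mod, Expr.eval_reg]
    refine ⟨fun r _ hr => Function.update_of_ne hr _ _, by simp, fun a ha => ?_, by simp⟩
    rw [Function.update_of_ne (by omega)]
  · simp only [Cmd.maxCost, Expr.cost]
    omega

/-- Update the best biclique found so far. The registers `6` and `9 - 8` hold the numbers of common
neighbours and of selected vertices. -/
def saveBest : Cmd :=
  .ite (.op .lt (.reg 10) (.reg 6))
    (.ite (.op .lt (.reg 10) (.reg 9 - .reg 8))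
      (.seq (.ite (.op .lt (.reg 6) (.reg 9 - .reg 8)) (.assign 10 (.reg 6))
        (.assign 10 (.reg 9 - .reg 8))) writeOutput) .skip) .skip

theorem saveBest_achieves (hw : 8 * ((n + 2) ^ 2 * (n + 2) ^ 2) ≤ 2 ^ w) {σ : State}
    {q st m lo hi : ℕ} {f g : ℕ → Fin n} (S : Selected G q st m lo hi f σ) (hq : q ≤ n)
    (hhi : hi ≤ q) (hf : Set.InjOn f (Set.Iio q))
    (hC : HasCommon G ((Finset.Ico lo hi).image f) n g σ) :
    Achieves w saveBest σ (n * 50 + 60)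
      (Ready G q st (max m (min (hi - lo) (commonNeighbors G ((Finset.Ico lo hi).image f)).card))) := by
  obtain ⟨hN, hN8⟩ := le_of_word_bound hw
  have hcard : (commonNeighbors G ((Finset.Ico lo hi).image f)).card = σ.reg 6 := by
    rw [← Finset.card_range (σ.reg 6), ← card_image_of_injOn_Iio hC.1 (by simp), hC.2.1,
      Finset.filter_true_of_mem (fun u _ => u.2)]
  rw [hcard]
  have h1 : 1 % 2 ^ w = 1 := Nat.mod_eq_of_lt (by omega)
  obtain ⟨L, R, hO, hB, hmL, h10⟩ := S.ready.best
  have hev : (Expr.reg 9 - .reg 8).eval w σ = hi - lo := by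
    simp [S.reg8, S.reg9]
  have hskip : σ.reg 10 ≥ min (hi - lo) (σ.reg 6) → Achieves w .skip σ 1
      (Ready G q st (max m (min (hi - lo) (σ.reg 6)))) := fun h =>
    Cmd.LoopFree.achieves (p := .skip) trivial (S.ready.save (fun _ _ => rfl) (fun _ _ _ => rfl)
      ⟨L, R, hO, hB, by omega, h10⟩)
  refine (Achieves.ite (T := n * 50 + 52) (fun hne => ?_) (fun h0 => ?_)).mono
    (show n * 50 + 52 + 3 + 1 ≤ _ by omega) (fun _ => id)
  · rw [Expr.eval_lt, Expr.eval_reg, Expr.eval_reg] at hne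
    have hlt6 : σ.reg 10 < σ.reg 6 := by
      by_contra hn
      rw [if_neg hn, Nat.zero_mod] at hne
      exact hne rfl
    refine (Achieves.ite (T := n * 50 + 46) (fun hne => ?_) (fun h0 => ?_)).mono
      (show n * 50 + 46 + 5 + 1 ≤ _ by omega) (fun _ => id)
    · rw [Expr.eval_lt, hev, Expr.eval_reg] at hne
      have hlt : σ.reg 10 < hi - lo := by
        by_contra hn
        rw [if_neg hn, Nat.zero_mod] at hne
        exact hne rfl
      have hmin : m ≤ min (hi - lo) (σ.reg 6) := by omega
      rw [max_eq_right hmin]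
      refine ((Cmd.LoopFree.achieves (p := .ite _ (.assign _ _) (.assign _ _))
        (by simp [Cmd.LoopFree]) (Q := fun σ' => σ' =
          ⟨Function.update σ.reg 10 (min (hi - lo) (σ.reg 6)), σ.mem⟩) ?_).seq
          (T₂ := n * 50 + 20) ?_).mono ?_ (fun _ => id)
      · rw [run_ite_lt (by omega), hev, Expr.eval_reg]
        split_ifs with h
        · rw [Cmd.run, Expr.eval_reg, min_eq_right h.le]
        · rw [Cmd.run, hev, min_eq_left (by omega)]
      · rintro _ rfl
        exact writeOutput_achieves hw S hq hhi hf hC (by omega) (by omega)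
      · have hc : (Expr.reg 9 - .reg 8).cost = 3 := rfl
        simp only [Cmd.maxCost, Expr.cost, hc]
        omega
    · rw [Expr.eval_lt, hev, Expr.eval_reg] at h0
      refine (hskip ?_).mono (by omega) (fun _ => id)
      by_contra hn
      rw [if_pos (by omega), h1] at h0
      exact one_ne_zero h0
  · rw [Expr.eval_lt, Expr.eval_reg, Expr.eval_reg] at h0
    refine (hskip ?_).mono (by omega) (fun _ => id)
    by_contra hn
    rw [if_pos (by omega), h1] at h0
    exact one_ne_zero h0

end Save

end WordRAM

/-! ### Blocks of the sorted order -/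

section Blocks
variable {n : ℕ} (G : SimpleGraph (Fin n))

/-- A biclique whose sides have size `m` is at least as large as the one that some selectable set of
the block `B` spans together with its common neighbours. -/
def Beats (B : Finset (Fin n)) (m : ℕ) : Prop :=
  ∃ A, Selectable G B A ∧ min A.card (commonNeighbors G A).card ≤ m

/-- The block of the `q` vertices from position `st` on in the sorted order. -/
noncomputable def sortedBlock (q st : ℕ) : Finset (Fin n) :=
  {v | st ≤ WordRAM.rank G v ∧ WordRAM.rank G v < st + q}

variable {G}

theorem Beats.mono {B : Finset (Fin n)} {m m' : ℕ} (h : Beats G B m) (hm : m ≤ m') :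
    Beats G B m' := by
  obtain ⟨A, h1, h2⟩ := h
  exact ⟨A, h1, h2.trans hm⟩

end Blocks

namespace WordRAM

section Main
variable {n w : ℕ} {G : SimpleGraph (Fin n)}

/-! ### The main program -/

/-- Search the block of `q` vertices from position `st` on. -/
def processBlock : Cmd :=
  .seq copyBlock <| .seq searchBlock <| .seq listCommon saveBest

theorem image_sortedVertex {q st : ℕ} (hq : st + q ≤ n) {f : ℕ → Fin n}
    (hf : ∀ x, (hx : x < q) → f x = sortedVertex G ⟨st + x, by omega⟩) :
    Set.InjOn f (Set.Iio q) ∧ (Finset.range q).image f = sortedBlock G q st := by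
  constructor
  · intro x hx y hy hxy
    rw [hf x hx, hf y hy] at hxy
    have := (sortedVertex G).injective hxy
    simp at this
    exact this
  · ext v
    simp only [sortedBlock, Finset.mem_image, Finset.mem_range, Finset.mem_filter_univ]
    constructor
    · rintro ⟨x, hx, rfl⟩
      rw [hf x hx, rank_sortedVertex]
      simp [hx]
    · rintro ⟨h1, h2⟩
      refine ⟨rank G v - st, by omega, ?_⟩
      rw [hf _ (by omega)]
      refine rank_injective G ?_
      rw [rank_sortedVertex]
      simp [h1]

theorem processBlock_achieves (hw : 8 * ((n + 2) ^ 2 * (n + 2) ^ 2) ≤ 2 ^ w) {σ : State}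
    {q st m : ℕ} (hR : Ready G q st m σ) (hq0 : 0 < q) (hq : st + q ≤ n) :
    Achieves w processBlock σ (600 * (q * n))
      (fun σ => ∃ m', Ready G q st m' σ ∧ m ≤ m' ∧ Beats G (sortedBlock G q st) m') := by
  have hn : 0 < n := by omega
  set f : ℕ → Fin n := fun x => if h : st + x < n then sortedVertex G ⟨st + x, h⟩ else ⟨0, hn⟩
    with hf
  have hfx : ∀ x, (hx : x < q) → f x = sortedVertex G ⟨st + x, by omega⟩ := fun x hx => by
    rw [hf]
    exact dif_pos _
  obtain ⟨hinj, himg⟩ := image_sortedVertex hq hfx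
  have hfinal := (copyBlock_achieves hw hR hq hfx).seq fun σ h =>
    (searchBlock_achieves hw h.1 h.2 hinj himg hq0 (by omega)).seq
      (q := .seq listCommon saveBest) (T₂ := (n * (q * 50 + 50) + 20) + (n * 50 + 60))
      (Q := fun σ => ∃ m', Ready G q st m' σ ∧ m ≤ m' ∧ Beats G (sortedBlock G q st) m') ?_
  · refine hfinal.mono ?_ (fun _ => id)
    have h1 : q * q ≤ q * n := Nat.mul_le_mul_left q (by omega)
    have h2 : q * 1 ≤ q * n := Nat.mul_le_mul_left q (by omega)
    have h3 : 1 * n ≤ q * n := Nat.mul_le_mul_right n (by omega)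
    nlinarith
  · rintro σ ⟨i, s, lo, hi, f', S, hsel⟩
    have hhi := S.search.hi_le.trans S.search.i_le
    refine (listCommon_achieves hw ⟨S.ready, S.block, S.reg8, S.reg9⟩ (by omega)
      S.search.lo_le hhi).seq ?_
    rintro σ ⟨S', g, hC⟩
    refine (saveBest_achieves hw S' (by omega) hhi S.search.inj hC).mono le_rfl fun σ h => ?_
    refine ⟨_, h, le_max_left _ _, _, hsel, le_max_of_le_right ?_⟩
    rw [card_image_of_injOn_Iio S.search.inj (by simp; omega), Nat.card_Ico]

/-- Search all blocks of size `q`. -/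
def processBlocks : Cmd :=
  .while (.op .lt (.reg 3 + .reg 2) (.reg 0 + .lit 1))
    (.seq processBlock (.assign 3 (.reg 3 + .reg 2)))

theorem Ready.setReg3 {q st m x : ℕ} {σ : State} (h : Ready G q st m σ) :
    Ready G q x m ⟨Function.update σ.reg 3 x, σ.mem⟩ where
  size := by simpa [HasSize] using h.size
  matrix := h.matrix
  order := h.order
  reg2 := by simpa using h.reg2
  reg3 := by simp
  best := by simpa [Outputs] using h.best

theorem Ready.setReg2 {q st m x : ℕ} {σ : State} (h : Ready G q st m σ) :
    Ready G x st m ⟨Function.update σ.reg 2 x, σ.mem⟩ where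
  size := by simpa [HasSize] using h.size
  matrix := h.matrix
  order := h.order
  reg2 := by simp
  reg3 := by simpa using h.reg3
  best := by simpa [Outputs] using h.best

theorem processBlocks_achieves (hw : 8 * ((n + 2) ^ 2 * (n + 2) ^ 2) ≤ 2 ^ w) {σ : State}
    {q m : ℕ} (hR : Ready G q 0 m σ) (hq0 : 0 < q) (hq : q ≤ n) :
    Achieves w processBlocks σ (620 * (n * n) + 10) (fun σ => ∃ st m', Ready G q st m' σ ∧
      m ≤ m' ∧ ∀ j, (j + 1) * q ≤ n → Beats G (sortedBlock G q (j * q)) m') := by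
  obtain ⟨hN, hN8⟩ := le_of_word_bound hw
  have hev : ∀ σ st m', Ready G q st m' σ → st ≤ n →
      (Expr.op .lt (.reg 3 + .reg 2) (.reg 0 + .lit 1)).eval w σ = if st + q ≤ n then 1 else 0 := by
    intro σ st m' hR hst
    rw [Expr.eval_lt, Expr.eval_add, Expr.eval_add, Expr.eval_reg, Expr.eval_reg, Expr.eval_reg,
      Expr.eval_lit, hR.reg2, hR.reg3, hR.size.1, Nat.mod_eq_of_lt (show 1 < 2 ^ w by omega),
      Nat.mod_eq_of_lt (show st + q < 2 ^ w by omega), Nat.mod_eq_of_lt (show n + 1 < 2 ^ w by omega)]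
    simp only [Nat.lt_succ_iff]
    split_ifs
    · exact Nat.mod_eq_of_lt (by omega)
    · exact Nat.zero_mod _
  have hdiv : ∀ i, i < n / q ↔ i * q + q ≤ n := fun i => by
    rw [← Nat.succ_mul, ← Nat.le_div_iff_mul_le hq0]
    rfl
  refine (Achieves.whileLoop (w := w) (e := .op .lt (.reg 3 + .reg 2) (.reg 0 + .lit 1))
    (p := .seq processBlock (.assign 3 (.reg 3 + .reg 2))) (T := 600 * (q * n) + 4)
    (fun i σ => ∃ m', Ready G q (i * q) m' σ ∧ m ≤ m' ∧
      ∀ j < i, Beats G (sortedBlock G q (j * q)) m') (n / q) ?_ ?_ ?_).mono ?_ ?_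
  · rintro i hi σ ⟨m', hR, hm, hj⟩
    have hi' := (hdiv i).1 hi
    refine ⟨?_, ?_⟩
    · rw [hev σ _ _ hR (by omega), if_pos hi']
      exact one_ne_zero
    · refine (processBlock_achieves hw hR hq0 hi').seq fun σ hR => ?_
      refine Cmd.LoopFree.achieves (p := .assign _ _) trivial ?_
      obtain ⟨m'', hR, hm', hb⟩ := hR
      refine ⟨m'', ?_, hm.trans hm', fun j hji => ?_⟩
      · rw [Cmd.run, Expr.eval_add, Expr.eval_reg, Expr.eval_reg, hR.reg2, hR.reg3,
          Nat.mod_eq_of_lt (by omega), Nat.succ_mul]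
        exact hR.setReg3
      · rcases Nat.lt_succ_iff_lt_or_eq.1 hji with h | rfl
        · exact (hj j h).mono hm'
        · exact hb
  · rintro σ ⟨m', hR, hm, hj⟩
    rw [hev σ _ _ hR (Nat.div_mul_le_self n q), if_neg]
    rw [← hdiv]
    exact lt_irrefl _
  · exact ⟨m, by simpa using hR, le_rfl, by simp⟩
  · have h1 : n / q * (q * n) ≤ n * n := by
      rw [← mul_assoc]
      exact Nat.mul_le_mul_right n (Nat.div_mul_le_self n q)
    have h2 : n / q ≤ n * n := (Nat.div_le_self n q).trans (by nlinarith)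
    have hc : (Expr.op .lt (.reg 3 + .reg 2) (.reg 0 + .lit 1)).cost = 7 := rfl
    rw [hc]
    nlinarith
  · rintro σ ⟨m', hR, hm, hj⟩
    refine ⟨_, m', hR, hm, fun j h => hj j ?_⟩
    rw [hdiv, ← Nat.succ_mul]
    exact h

/-- Search the blocks of all sizes `q` that are powers of two. -/
def processAll : Cmd :=
  .while (.op .lt (.reg 2) (.reg 0 + .lit 1))
    (.seq (.assign 3 (.lit 0)) (.seq processBlocks (.assign 2 (.reg 2 + .reg 2))))

theorem eval_reg2_le_reg0 (hw : 8 * ((n + 2) ^ 2 * (n + 2) ^ 2) ≤ 2 ^ w) {σ : State} {e : ℕ}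
    (h0 : σ.reg 0 = n) (h2 : σ.reg 2 = 2 ^ e) :
    (Expr.op .lt (.reg 2) (.reg 0 + .lit 1)).eval w σ = if e < Nat.size n then 1 else 0 := by
  obtain ⟨hN, hN8⟩ := le_of_word_bound hw
  rw [Expr.eval_lt, Expr.eval_add, Expr.eval_reg, Expr.eval_reg, Expr.eval_lit, h0, h2,
    Nat.mod_eq_of_lt (show 1 < 2 ^ w by omega), Nat.mod_eq_of_lt (show n + 1 < 2 ^ w by omega)]
  simp only [Nat.lt_succ_iff, Nat.lt_size]
  split_ifs
  · exact Nat.mod_eq_of_lt (by omega)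
  · exact Nat.zero_mod _

theorem processAll_achieves (hw : 8 * ((n + 2) ^ 2 * (n + 2) ^ 2) ≤ 2 ^ w) {σ : State}
    {st : ℕ} (hR : Ready G 1 st 0 σ) :
    Achieves w processAll σ (Nat.size n * (620 * (n * n) + 40) + 10) (fun σ => ∃ q st m,
      Ready G q st m σ ∧ ∀ e j, (j + 1) * 2 ^ e ≤ n →
        Beats G (sortedBlock G (2 ^ e) (j * 2 ^ e)) m) := by
  obtain ⟨hN, hN8⟩ := le_of_word_bound hw
  refine (Achieves.whileLoop (w := w) (e := .op .lt (.reg 2) (.reg 0 + .lit 1))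
    (p := .seq (.assign 3 (.lit 0)) (.seq processBlocks (.assign 2 (.reg 2 + .reg 2))))
    (T := 2 + ((620 * (n * n) + 10) + 4))
    (fun i σ => ∃ st m, Ready G (2 ^ i) st m σ ∧ ∀ e < i, ∀ j, (j + 1) * 2 ^ e ≤ n →
        Beats G (sortedBlock G (2 ^ e) (j * 2 ^ e)) m) (Nat.size n) ?_ ?_ ?_).mono ?_ ?_
  · rintro i hi σ ⟨st, m, hR, hj⟩
    refine ⟨?_, ?_⟩
    · rw [eval_reg2_le_reg0 hw hR.size.1 hR.reg2, if_pos hi]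
      exact one_ne_zero
    · rw [Nat.lt_size] at hi
      refine (Cmd.LoopFree.achieves (p := .assign 3 (.lit 0)) trivial
        (Q := Ready G (2 ^ i) 0 m) ?_).seq fun σ hR =>
        (processBlocks_achieves hw hR (by positivity) hi).seq ?_
      · simp only [Cmd.run, Expr.eval_lit, Nat.zero_mod]
        exact hR.setReg3
      · rintro σ ⟨st, m', hR, hm, hj'⟩
        refine Cmd.LoopFree.achieves (p := .assign _ _) trivial ?_
        refine ⟨st, m', ?_, fun e he j hej => ?_⟩
        · rw [Cmd.run, Expr.eval_add, Expr.eval_reg, hR.reg2,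
            Nat.mod_eq_of_lt (by omega), ← mul_two, ← pow_succ]
          exact hR.setReg2
        · rcases Nat.lt_succ_iff_lt_or_eq.1 he with h | rfl
          · exact (hj e h j hej).mono hm
          · exact hj' j hej
  · rintro σ ⟨st, m, hR, -⟩
    rw [eval_reg2_le_reg0 hw hR.size.1 hR.reg2, if_neg (lt_irrefl _)]
  · exact ⟨st, 0, by simpa using hR, by simp⟩
  · have hc : (Expr.op .lt (.reg 2) (.reg 0 + .lit 1)).cost = 5 := rfl
    rw [hc]
    have : Nat.size n * (2 + (620 * (n * n) + 10 + 4) + 5 + 1) ≤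
      Nat.size n * (620 * (n * n) + 40) := Nat.mul_le_mul_left _ (by omega)
    omega
  · rintro σ ⟨st, m, hR, hj⟩
    refine ⟨_, st, m, hR, fun e j hej => hj e ?_ j hej⟩
    rw [Nat.lt_size]
    nlinarith [Nat.one_le_two_pow (n := e)]

/-- Build the data structures and search all blocks. -/
def searchGraph : Cmd :=
  .seq buildMatrix <| .seq sortVertices <|
    .seq (.seq (.store (.lit 0) (.lit 0)) (.seq (.assign 10 (.lit 0)) (.assign 2 (.lit 1))))
      processAll

theorem searchGraph_achieves (hw : 8 * ((n + 2) ^ 2 * (n + 2) ^ 2) ≤ 2 ^ w) {σ : State}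
    (hs : HasSize n σ) (hin : HasInput G σ) (h0 : ∀ i, (n + 2) ^ 2 ≤ i → σ.mem i = 0) :
    Achieves w searchGraph σ (Nat.size n * (620 * (n * n) + 40) + 200 * (n * n) + 100)
      (fun σ => ∃ L R : Finset (Fin n), Outputs σ L R ∧ IsBalancedBiclique G L R ∧
        ∀ e j, (j + 1) * 2 ^ e ≤ n →
          Beats G (sortedBlock G (2 ^ e) (j * 2 ^ e)) L.card) := by
  obtain ⟨hN, hN8⟩ := le_of_word_bound hw
  refine ((buildMatrix_achieves G hw hs hin h0).seq fun σ h =>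
    (sortVertices_achieves hw h.1 h.2.1 h.2.2).seq fun σ h =>
    (Cmd.LoopFree.achieves (by simp [Cmd.LoopFree]) (Q := Ready G 1 (σ.reg 3) 0) ?_).seq
      fun σ h => (processAll_achieves hw h).mono le_rfl ?_).mono ?_ (fun _ => id)
  · obtain ⟨hs, hM, hO⟩ := h
    have hrun : Cmd.run w (.seq (.store (.lit 0) (.lit 0)) (.seq (.assign 10 (.lit 0))
        (.assign 2 (.lit 1)))) σ = ⟨Function.update (Function.update σ.reg 10 0) 2 1,
          Function.update σ.mem 0 0⟩ := by
      simp (disch := omega) [Cmd.run, Nat.mod_eq_of_lt]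
    rw [hrun]
    have hmem : ∀ a, (n + 2) ^ 2 ≤ a → Function.update σ.mem 0 0 a = σ.mem a := fun a ha => by
      rw [Function.update_of_ne (by omega)]
    refine ⟨by simpa [HasSize] using hs, fun u x => ?_, fun v => ?_, by simp, by simp,
      ∅, ∅, by simp [Outputs], by simp [IsBalancedBiclique], by simp, by simp⟩
    · dsimp only
      rw [hmem _ (by omega)]
      exact hM u x
    · dsimp only
      rw [hmem _ (by omega)]
      exact hO v
  · rintro σ ⟨q, st, m, hR, hv⟩
    obtain ⟨L, R, hO, hB, hm, -⟩ := hR.best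
    exact ⟨L, R, hO, hB, fun e j hej => (hv e j hej).mono hm⟩
  · have hc : (Cmd.seq (.store (.lit 0) (.lit 0)) (.seq (.assign 10 (.lit 0))
      (.assign 2 (.lit 1)))).maxCost = 7 := rfl
    rw [hc]
    nlinarith [Nat.le_mul_self n]

/-- The algorithm. It gives up on a graph with fewer than `n ^ 2 / (2 * size n ^ 2)` edges, so that
time of order `n ^ 2 * size n` is affordable otherwise. The loop leaves `size n` in register `3`, and
twice the number of edges is the length of the adjacency lists. -/
def findBiclique : Cmd :=
  .seq (.seq (.assign 0 (.load (.lit 0))) <|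
    .seq (.assign 1 ((.reg 0 + .lit 2) * (.reg 0 + .lit 2))) <| .assign 2 (.lit 1)) <|
  .seq (.while (.op .lt (.reg 2) (.reg 0 + .lit 1))
    (.seq (.assign 2 (.reg 2 + .reg 2)) (.assign 3 (.reg 3 + .lit 1)))) <|
  .ite (.op .lt ((.load (.lit 1 + .reg 0) - (.reg 0 + .lit 2)) * (.reg 3 * .reg 3))
      (.reg 0 * .reg 0))
    .skip searchGraph

theorem size_le_self (n : ℕ) : Nat.size n ≤ n :=
  Nat.size_le.2 Nat.lt_two_pow_self

theorem findBiclique_achieves (G : SimpleGraph (Fin n)) :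
    ∃ s t, RunsTo findBiclique 11 G s t ∧
      t ≤ 2000 * (graphSize G + 1) * (Nat.log 2 (graphSize G) + 1) ^ 3 ∧
      (n * n ≤ 2 * G.edgeSet.ncard * (Nat.size n * Nat.size n) →
        ∃ L R : Finset (Fin n), Outputs s L R ∧ IsBalancedBiclique G L R ∧
          ∀ e j, (j + 1) * 2 ^ e ≤ n →
            Beats G (sortedBlock G (2 ^ e) (j * 2 ^ e)) L.card) := by
  have hw := wordSize_bound n
  obtain ⟨hN, hN8⟩ := le_of_word_bound hw
  unfold RunsTo
  generalize wordSize 11 n = w at *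
  set E := G.edgeSet.ncard with hE
  set Q : State → Prop := fun s => n * n ≤ 2 * E * (Nat.size n * Nat.size n) →
        ∃ L R : Finset (Fin n), Outputs s L R ∧ IsBalancedBiclique G L R ∧
          ∀ e j, (j + 1) * 2 ^ e ≤ n →
            Beats G (sortedBlock G (2 ^ e) (j * 2 ^ e)) L.card with hQ
  set T := if n * n ≤ 2 * E * (Nat.size n * Nat.size n) then
    Nat.size n * (620 * (n * n) + 40) + 200 * (n * n) + 100 else 1 with hT
  have hin : HasInput G (initState w G) := fun i _ => initState_mem G (by omega) i
  have h0 : ∀ i, (n + 2) ^ 2 ≤ i → (initState w G).mem i = 0 := fun i hi => by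
    rw [initState_mem G (by omega)]
    refine inputWords_of_le G ?_
    have := listStart_le G n le_rfl
    omega
  have hsz := size_le_self n
  have hlast := listStart_last G
  have hlast2 := listStart_le G n le_rfl
  have hstart : (initState w G).mem (1 + n) = n + 2 + 2 * E := by
    rw [hin.start G le_rfl, hlast]
  have main : Achieves w findBiclique (initState w G) (Nat.size n * 14 + T + 40) Q := by
    refine ((Cmd.LoopFree.achieves (by simp [Cmd.LoopFree]) (Q := fun σ => HasSize n σ ∧
      σ.reg 2 = 2 ^ 0 ∧ σ.reg 3 = 0 ∧ σ.mem = (initState w G).mem) ?_).seq fun σ hσ =>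
      (Achieves.whileLoop (T := 8) (fun i σ => HasSize n σ ∧ σ.reg 2 = 2 ^ i ∧ σ.reg 3 = i ∧
        σ.mem = (initState w G).mem) (Nat.size n) ?_ ?_ hσ).seq (T₂ := T + 20) ?_).mono ?_ (fun _ => id)
    · have hm : (initState w G).mem 0 = n := by rw [hin 0 (by positivity)]; rfl
      have e1 : (n + 2) * (n + 2) % 2 ^ w = (n + 2) ^ 2 := by
        rw [← sq, Nat.mod_eq_of_lt (by omega)]
      have e2 : 2 % 2 ^ w = 2 := Nat.mod_eq_of_lt (by omega)
      have e3 : (n + 2) % 2 ^ w = n + 2 := Nat.mod_eq_of_lt (by omega)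
      have e4 : 1 % 2 ^ w = 1 := Nat.mod_eq_of_lt (by omega)
      have hreg : ∀ r, (initState w G).reg r = 0 := fun _ => rfl
      simp [Cmd.run, HasSize, hm, e1, e2, e3, e4, hreg]
    · rintro i hi σ ⟨hs, h2, h3, hmem⟩
      refine ⟨?_, ?_⟩
      · rw [eval_reg2_le_reg0 hw hs.1 h2, if_pos hi]
        exact one_ne_zero
      · refine Cmd.LoopFree.achieves (p := .seq (.assign _ _) (.assign _ _))
          (by simp [Cmd.LoopFree]) ?_
        have hi2 := Nat.lt_size.1 hi
        have e1 : (2 ^ i + 2 ^ i) % 2 ^ w = 2 ^ (i + 1) := by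
          rw [Nat.mod_eq_of_lt (by omega), ← mul_two, ← pow_succ]
        have e2 : (i + 1 % 2 ^ w) % 2 ^ w = i + 1 := by
          rw [Nat.mod_eq_of_lt (show 1 < 2 ^ w by omega), Nat.mod_eq_of_lt (by omega)]
        refine ⟨by simpa [HasSize, Cmd.run] using hs, ?_, ?_, hmem⟩
        · simp [Cmd.run, h2, e1]
        · simp [Cmd.run, h3] at e2 ⊢
          exact e2
    · rintro σ ⟨hs, h2, -, -⟩
      rw [eval_reg2_le_reg0 hw hs.1 h2, if_neg (lt_irrefl _)]
    · rintro σ ⟨hs, h2, h3, hmem⟩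
      have hb1 : Nat.size n * Nat.size n ≤ n * n := Nat.mul_le_mul hsz hsz
      have hb2 : 2 * E * (Nat.size n * Nat.size n) ≤ n * n * (n * n) :=
        Nat.mul_le_mul (by omega) hb1
      have hb3 : n * n * (n * n) ≤ (n + 2) ^ 2 * (n + 2) ^ 2 :=
        Nat.mul_le_mul (by omega) (by omega)
      have hev : (Expr.op .lt ((.load (.lit 1 + .reg 0) - (.reg 0 + .lit 2)) * (.reg 3 * .reg 3))
          (.reg 0 * .reg 0)).eval w σ =
          if 2 * E * (Nat.size n * Nat.size n) < n * n then 1 else 0 := by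
        have e1 : (1 + n) % 2 ^ w = 1 + n := Nat.mod_eq_of_lt (by omega)
        have e2 : (n + 2) % 2 ^ w = n + 2 := Nat.mod_eq_of_lt (by omega)
        have e3 : 1 % 2 ^ w = 1 := Nat.mod_eq_of_lt (by omega)
        have e4 : 2 % 2 ^ w = 2 := Nat.mod_eq_of_lt (by omega)
        have e5 : Nat.size n * Nat.size n % 2 ^ w = Nat.size n * Nat.size n :=
          Nat.mod_eq_of_lt (by omega)
        have e6 : n * n % 2 ^ w = n * n := Nat.mod_eq_of_lt (by omega)
        have e7 : 2 * E * (Nat.size n * Nat.size n) % 2 ^ w = 2 * E * (Nat.size n * Nat.size n) :=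
          Nat.mod_eq_of_lt (by omega)
        simp only [Expr.eval_lt, Expr.eval_mul, Expr.eval_sub, Expr.eval_load, Expr.eval_add,
          Expr.eval_lit, Expr.eval_reg, hs.1, h3, hmem, e3, e4, e1, e2, hstart, e5, e6,
          Nat.add_sub_cancel_left, e7]
        split_ifs
        · exact e3
        · exact Nat.zero_mod _
      refine (Achieves.ite (T := T) (fun hne => ?_) (fun hz => ?_)).mono
        (show T + 16 + 1 ≤ T + 20 by omega) (fun _ => id)
      · rw [hev] at hne
        have hlt : 2 * E * (Nat.size n * Nat.size n) < n * n := by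
          by_contra hcon
          rw [if_neg hcon] at hne
          exact hne rfl
        rw [hT, if_neg (by omega)]
        refine Cmd.LoopFree.achieves (p := .skip) trivial ?_
        intro hcon
        omega
      · rw [hev] at hz
        have hle : n * n ≤ 2 * E * (Nat.size n * Nat.size n) := by
          by_contra hcon
          rw [if_pos (by omega)] at hz
          exact one_ne_zero hz
        rw [hT, if_pos hle]
        refine (searchGraph_achieves hw hs (G := G) ?_ ?_).mono le_rfl (fun s h _ => h)
        · intro i hi
          rw [hmem]
          exact hin i hi
        · intro i hi
          rw [hmem]
          exact h0 i hi
    · have hc1 : (Expr.op .lt (.reg 2) (.reg 0 + .lit 1)).cost = 5 := rfl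
      have hc2 : (Cmd.seq (.assign 0 (.load (.lit 0))) <|
        .seq (.assign 1 ((.reg 0 + .lit 2) * (.reg 0 + .lit 2))) <| .assign 2 (.lit 1)).maxCost
          = 13 := rfl
      rw [hc1, hc2]
      omega
  obtain ⟨s, t, he, ht, hq⟩ := main
  refine ⟨s, t, he, ht.trans ?_, hq⟩
  have hg : graphSize G = n + E := by simp [graphSize, hE]
  have hlog : Nat.size n ≤ Nat.log 2 (graphSize G) + 1 := by
    rw [Nat.size_le]
    refine (show n ≤ graphSize G by omega).trans_lt ?_
    exact Nat.lt_pow_succ_log_self (by norm_num) _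
  have hle1 : 1 ≤ Nat.log 2 (graphSize G) + 1 := by omega
  rw [hg] at *
  generalize Nat.log 2 (n + E) + 1 = l at *
  generalize Nat.size n = z at *
  have h3 : l ≤ l ^ 3 := Nat.le_self_pow (by norm_num) l
  have h4 : z ≤ l ^ 3 := hlog.trans h3
  have h5 : 1 ≤ l ^ 3 := Nat.one_le_pow _ _ hle1
  have h6 : T ≤ 1640 * (E * l ^ 3) + 40 * l ^ 3 + 100 := by
    rw [hT]
    split_ifs with hd
    · have h7 : z * z ≤ l * l := Nat.mul_le_mul hlog hlog
      have h8 : z * (n * n) ≤ 2 * (E * l ^ 3) :=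
        calc z * (n * n) ≤ l * (2 * E * (l * l)) :=
              Nat.mul_le_mul hlog (hd.trans (Nat.mul_le_mul_left _ h7))
          _ = 2 * (E * l ^ 3) := by ring
      have h9 : n * n ≤ 2 * (E * l ^ 3) :=
        calc n * n ≤ 1 * (2 * E * (l * l)) := by
              rw [one_mul]
              exact hd.trans (Nat.mul_le_mul_left _ h7)
          _ ≤ l * (2 * E * (l * l)) := Nat.mul_le_mul_right _ hle1
          _ = 2 * (E * l ^ 3) := by ring
      nlinarith
    · omega
  have h10 : 2000 * (n + E + 1) * l ^ 3 = 2000 * (n * l ^ 3) + 2000 * (E * l ^ 3) + 2000 * l ^ 3 := by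
    ring
  rw [h10]
  omega

end Main

end WordRAM

/-! ### Lower tails for uniformly random injections -/

section Tail
variable {V W : Type*} [Fintype V] [Fintype W] [DecidableEq V] [DecidableEq W]

/-- The event that a random injection maps all of `T` into `U` is at most as likely as for
independent uniform values. For the induction step, composing with the transposition of `φ w` and
`v` turns an injection with `φ w ∈ U` into one with `φ w = v ∉ U`, without moving `φ(T) ⊆ U`. -/
theorem card_embedding_mapsTo_mul_le (T : Finset W) (U : Finset V) :
    (Finset.univ.filter fun φ : W ↪ V => ∀ w ∈ T, φ w ∈ U).card * Fintype.card V ^ T.card ≤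
      U.card ^ T.card * Fintype.card (W ↪ V) := by
  induction T using Finset.induction_on with
  | empty => simp [Finset.card_univ]
  | insert w T hw ih =>
    set a := (Finset.univ.filter fun φ : W ↪ V => (∀ w ∈ T, φ w ∈ U) ∧ φ w ∈ U) with ha
    set b := (Finset.univ.filter fun φ : W ↪ V => (∀ w ∈ T, φ w ∈ U) ∧ φ w ∉ U) with hb
    have hab : (Finset.univ.filter fun φ : W ↪ V => ∀ w ∈ T, φ w ∈ U).card = a.card + b.card := by
      rw [← Finset.card_filter_add_card_filter_not (fun φ : W ↪ V => φ w ∈ U), Finset.filter_filter,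
        Finset.filter_filter]
    have hins : (Finset.univ.filter fun φ : W ↪ V => ∀ x ∈ insert w T, φ x ∈ U) = a := by
      ext φ
      simp only [ha, Finset.mem_filter_univ, Finset.forall_mem_insert]
      exact and_comm
    have hinj : (a ×ˢ Uᶜ).card ≤ (b ×ˢ U).card := by
      refine Finset.card_le_card_of_injOn
        (fun x => (x.1.trans (Equiv.swap (x.1 w) x.2).toEmbedding, x.1 w)) ?_ ?_
      · rintro ⟨φ, v⟩ h
        simp only [ha, hb, Finset.coe_product, Set.mem_prod, Finset.mem_coe, Finset.mem_filter_univ,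
          Finset.mem_compl, Function.Embedding.trans_apply, Equiv.coe_toEmbedding,
          Equiv.swap_apply_left] at h ⊢
        refine ⟨⟨fun x hx => ?_, h.2⟩, h.1.2⟩
        rw [Equiv.swap_apply_of_ne_of_ne]
        · exact h.1.1 x hx
        · intro hxw
          exact hw (φ.injective hxw ▸ hx)
        · rintro rfl
          exact h.2 (h.1.1 x hx)
      · rintro ⟨φ, v⟩ - ⟨ψ, v'⟩ - h
        simp only [Prod.mk.injEq] at h
        obtain ⟨h1, h2⟩ := h
        have h3 := DFunLike.congr_fun h1 w
        simp only [Function.Embedding.trans_apply, Equiv.coe_toEmbedding,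
          Equiv.swap_apply_left] at h3
        subst h3
        refine Prod.ext (DFunLike.ext _ _ fun x => ?_) rfl
        have h4 := DFunLike.congr_fun h1 x
        simp only [Function.Embedding.trans_apply, Equiv.coe_toEmbedding, h2] at h4
        exact (Equiv.swap _ _).injective h4
    rw [Finset.card_product, Finset.card_product, Finset.card_compl] at hinj
    have hU : U.card ≤ Fintype.card V := Finset.card_le_univ U
    have hstep : a.card * Fintype.card V ≤ U.card * (a.card + b.card) := by
      obtain ⟨d, hd⟩ := Nat.exists_eq_add_of_le hU
      rw [hd] at hinj ⊢
      rw [Nat.add_sub_cancel_left] at hinj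
      nlinarith
    rw [hins, Finset.card_insert_of_notMem hw, pow_succ, pow_succ]
    rw [hab] at ih
    calc a.card * (Fintype.card V ^ T.card * Fintype.card V)
        = (a.card * Fintype.card V) * Fintype.card V ^ T.card := by ring
      _ ≤ (U.card * (a.card + b.card)) * Fintype.card V ^ T.card := Nat.mul_le_mul_right _ hstep
      _ = U.card * ((a.card + b.card) * Fintype.card V ^ T.card) := by ring
      _ ≤ U.card * (U.card ^ T.card * Fintype.card (W ↪ V)) := Nat.mul_le_mul_left _ ih
      _ = U.card ^ T.card * U.card * Fintype.card (W ↪ V) := by ring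

/-- The moment generating function of the number of elements of `S` that a random injection maps
into `U` is at most that of the binomial distribution. -/
theorem sum_pow_card_le [Nonempty V] (S : Finset W) (U : Finset V) {z : ℝ} (hz : 0 ≤ z) :
    ∑ φ : W ↪ V, (1 + z) ^ (S.filter fun w => φ w ∈ U).card ≤
      (1 + z * (U.card / Fintype.card V)) ^ S.card * Fintype.card (W ↪ V) := by
  have hV : (0 : ℝ) < Fintype.card V := by exact_mod_cast Fintype.card_pos
  have h1 : ∀ φ : W ↪ V, (1 + z) ^ (S.filter fun w => φ w ∈ U).card =
      ∑ T ∈ S.powerset, z ^ T.card * (if ∀ w ∈ T, φ w ∈ U then 1 else 0) := by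
    intro φ
    have h2 : (1 + z) ^ (S.filter fun w => φ w ∈ U).card =
        ∏ w ∈ S, (1 + if φ w ∈ U then z else 0) := by
      rw [← Finset.prod_const, Finset.prod_filter]
      exact Finset.prod_congr rfl fun w _ => by split_ifs <;> simp
    rw [h2, Finset.prod_one_add]
    refine Finset.sum_congr rfl fun T _ => ?_
    split_ifs with h
    · rw [mul_one, Finset.prod_congr rfl fun w hw => if_pos (h w hw), Finset.prod_const]
    · push Not at h
      obtain ⟨w, hw, hwU⟩ := h
      rw [mul_zero, Finset.prod_eq_zero hw (if_neg hwU)]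
  have h3 : ∀ T : Finset W, ∑ φ : W ↪ V, z ^ T.card * (if ∀ w ∈ T, φ w ∈ U then (1 : ℝ) else 0) ≤
      (z * (U.card / Fintype.card V)) ^ T.card * Fintype.card (W ↪ V) := by
    intro T
    have h4 : ((Finset.univ.filter fun φ : W ↪ V => ∀ w ∈ T, φ w ∈ U).card : ℝ) *
        (Fintype.card V : ℝ) ^ T.card ≤ (U.card : ℝ) ^ T.card * Fintype.card (W ↪ V) := by
      exact_mod_cast card_embedding_mapsTo_mul_le T U
    rw [← Finset.mul_sum, Finset.sum_boole, mul_pow, mul_assoc, div_pow]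
    refine mul_le_mul_of_nonneg_left ?_ (by positivity)
    rw [div_mul_eq_mul_div, le_div_iff₀ (by positivity)]
    exact h4
  calc ∑ φ : W ↪ V, (1 + z) ^ (S.filter fun w => φ w ∈ U).card
      = ∑ T ∈ S.powerset, ∑ φ : W ↪ V, z ^ T.card * (if ∀ w ∈ T, φ w ∈ U then 1 else 0) := by
        rw [Finset.sum_comm]
        exact Finset.sum_congr rfl fun φ _ => h1 φ
    _ ≤ ∑ T ∈ S.powerset, (z * (U.card / Fintype.card V)) ^ T.card * Fintype.card (W ↪ V) :=
        Finset.sum_le_sum fun T _ => h3 T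
    _ = (1 + z * (U.card / Fintype.card V)) ^ S.card * Fintype.card (W ↪ V) := by
        rw [← Finset.sum_mul]
        congr 1
        rw [← Finset.prod_const, Finset.prod_one_add]
        exact Finset.sum_congr rfl fun T _ => (Finset.prod_const _).symm

/-- The number of elements of `S` that a random injection maps into `F` is rarely below `7 / 8` of
its mean `μ = |S| |F| / |V|`. This is Markov's inequality for the exponential moment at `16 / 15` of
the number of elements mapped outside `F`. -/
theorem card_lower_tail_le [Nonempty V] (S : Finset W) (F : Finset V) :
    ((Finset.univ.filter fun φ : W ↪ V => ((S.filter fun w => φ w ∈ F).card : ℝ) ≤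
      7 / 8 * (S.card * F.card / Fintype.card V)).card : ℝ) ≤
      Real.exp (-(S.card * F.card / Fintype.card V) / 240) * Fintype.card (W ↪ V) := by
  have hV : (0 : ℝ) < Fintype.card V := by exact_mod_cast Fintype.card_pos
  set μ : ℝ := S.card * F.card / Fintype.card V with hμ
  set B := Finset.univ.filter fun φ : W ↪ V =>
    ((S.filter fun w => φ w ∈ F).card : ℝ) ≤ 7 / 8 * μ with hB
  set p : ℝ := F.card / Fintype.card V with hp
  have hμp : μ = S.card * p := by rw [hμ, hp, mul_div_assoc]
  have hp1 : p ≤ 1 := by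
    rw [hp, div_le_one hV]
    exact_mod_cast Finset.card_le_univ F
  have hmgf := sum_pow_card_le (W := W) S Fᶜ (z := 1 / 15) (by norm_num)
  have hU : ((Fᶜ).card : ℝ) / Fintype.card V = 1 - p := by
    rw [Finset.card_compl, Nat.cast_sub (Finset.card_le_univ F), sub_div, div_self hV.ne']
  rw [hU] at hmgf
  have hlow : ∀ φ ∈ B, (16 / 15 : ℝ) ^ S.card * Real.exp (-(7 / 120 * μ)) ≤
      (1 + 1 / 15 : ℝ) ^ (S.filter fun w => φ w ∈ Fᶜ).card := by
    intro φ hφ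
    rw [hB, Finset.mem_filter_univ] at hφ
    have hsplit : S.card = (S.filter fun w => φ w ∈ Fᶜ).card + (S.filter fun w => φ w ∈ F).card := by
      rw [← Finset.card_filter_add_card_filter_not (fun w => φ w ∈ F), add_comm]
      simp
    have hexp : (16 / 15 : ℝ) ^ (S.filter fun w => φ w ∈ F).card ≤ Real.exp (7 / 120 * μ) := by
      calc (16 / 15 : ℝ) ^ (S.filter fun w => φ w ∈ F).card
          ≤ Real.exp (1 / 15) ^ (S.filter fun w => φ w ∈ F).card := by
            gcongr
            have := Real.add_one_le_exp (1 / 15 : ℝ)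
            linarith
        _ = Real.exp ((S.filter fun w => φ w ∈ F).card * (1 / 15)) := by
            rw [← Real.exp_nat_mul]
        _ ≤ Real.exp (7 / 120 * μ) := by
            rw [Real.exp_le_exp]
            linarith
    rw [hsplit, pow_add, show (1 + 1 / 15 : ℝ) = 16 / 15 by norm_num, mul_assoc]
    refine mul_le_of_le_one_right (by positivity) ?_
    rw [Real.exp_neg]
    exact mul_inv_le_one_of_le₀ hexp (Real.exp_pos _).le
  have hup : (1 + 1 / 15 * (1 - p)) ^ S.card ≤ (16 / 15 : ℝ) ^ S.card * Real.exp (-(μ / 16)) := by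
    have h1 : (1 + 1 / 15 * (1 - p)) = 16 / 15 * (1 - p / 16) := by ring
    rw [h1, mul_pow]
    refine mul_le_mul_of_nonneg_left ?_ (by positivity)
    calc (1 - p / 16) ^ S.card ≤ Real.exp (-(p / 16)) ^ S.card := by
          refine pow_le_pow_left₀ (by linarith) ?_ _
          have := Real.add_one_le_exp (-(p / 16))
          linarith
      _ = Real.exp (-(μ / 16)) := by
          rw [← Real.exp_nat_mul, hμp]
          congr 1
          ring
  have hsum : (B.card : ℝ) * ((16 / 15 : ℝ) ^ S.card * Real.exp (-(7 / 120 * μ))) ≤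
      ((16 / 15 : ℝ) ^ S.card * Real.exp (-(μ / 16))) * Fintype.card (W ↪ V) := by
    calc (B.card : ℝ) * ((16 / 15 : ℝ) ^ S.card * Real.exp (-(7 / 120 * μ)))
        = ∑ φ ∈ B, (16 / 15 : ℝ) ^ S.card * Real.exp (-(7 / 120 * μ)) := by
          rw [Finset.sum_const, nsmul_eq_mul]
      _ ≤ ∑ φ ∈ B, (1 + 1 / 15 : ℝ) ^ (S.filter fun w => φ w ∈ Fᶜ).card :=
          Finset.sum_le_sum hlow
      _ ≤ ∑ φ : W ↪ V, (1 + 1 / 15 : ℝ) ^ (S.filter fun w => φ w ∈ Fᶜ).card :=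
          Finset.sum_le_univ_sum_of_nonneg fun φ => by positivity
      _ ≤ _ := hmgf.trans (mul_le_mul_of_nonneg_right hup (by positivity))
  have hsplit : Real.exp (-(μ / 16)) = Real.exp (-μ / 240) * Real.exp (-(7 / 120 * μ)) := by
    rw [← Real.exp_add]
    congr 1
    ring
  rw [hsplit] at hsum
  have hc : 0 < (16 / 15 : ℝ) ^ S.card * Real.exp (-(7 / 120 * μ)) := by positivity
  refine le_of_mul_le_mul_right (hsum.trans_eq ?_) hc
  ring

end Tail

/-! ### The random planting -/

section Planting
variable {n k : ℕ}

/-- The positions of the two sides of the planted biclique. -/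
def leftSide (φ : Fin k ⊕ Fin k ↪ Fin n) : Finset (Fin n) := Finset.univ.image fun i => φ (.inl i)

/-- See `leftSide`. -/
def rightSide (φ : Fin k ⊕ Fin k ↪ Fin n) : Finset (Fin n) := Finset.univ.image fun i => φ (.inr i)

/-- Both sides of the planted biclique meet every set of the family `ℱ` with at least `σ` elements
in at least the proportion `7 k / (8 n)`. -/
def MeetsEvenly (ℱ : Finset (Finset (Fin n))) (σ : ℝ) (φ : Fin k ⊕ Fin k ↪ Fin n) : Prop :=
  ∀ F ∈ ℱ, σ ≤ F.card → 7 / 8 * ((k : ℝ) / n) * F.card ≤ (leftSide φ ∩ F).card ∧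
    7 / 8 * ((k : ℝ) / n) * F.card ≤ (rightSide φ ∩ F).card

theorem card_leftSide_inter (φ : Fin k ⊕ Fin k ↪ Fin n) (F : Finset (Fin n)) :
    (leftSide φ ∩ F).card =
      ((Finset.univ.image Sum.inl : Finset (Fin k ⊕ Fin k)).filter fun w => φ w ∈ F).card := by
  rw [← Finset.card_image_of_injective _ φ.injective]
  congr 1
  ext v
  simp only [leftSide, Finset.mem_inter, Finset.mem_image, Finset.mem_univ, true_and,
    Finset.mem_filter]
  constructor
  · rintro ⟨⟨i, rfl⟩, h⟩
    exact ⟨_, ⟨⟨i, rfl⟩, h⟩, rfl⟩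
  · rintro ⟨_, ⟨⟨i, rfl⟩, h⟩, rfl⟩
    exact ⟨⟨i, rfl⟩, h⟩

theorem card_rightSide_inter (φ : Fin k ⊕ Fin k ↪ Fin n) (F : Finset (Fin n)) :
    (rightSide φ ∩ F).card =
      ((Finset.univ.image Sum.inr : Finset (Fin k ⊕ Fin k)).filter fun w => φ w ∈ F).card := by
  rw [← Finset.card_image_of_injective _ φ.injective]
  congr 1
  ext v
  simp only [rightSide, Finset.mem_inter, Finset.mem_image, Finset.mem_univ, true_and,
    Finset.mem_filter]
  constructor
  · rintro ⟨⟨i, rfl⟩, h⟩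
    exact ⟨_, ⟨⟨i, rfl⟩, h⟩, rfl⟩
  · rintro ⟨_, ⟨⟨i, rfl⟩, h⟩, rfl⟩
    exact ⟨⟨i, rfl⟩, h⟩

open Classical in
/-- A union bound over the sets of the family and the two sides. -/
theorem card_not_meetsEvenly_le (hn : 0 < n) (ℱ : Finset (Finset (Fin n))) (σ : ℝ) :
    ((Finset.univ.filter fun φ : Fin k ⊕ Fin k ↪ Fin n => ¬ MeetsEvenly ℱ σ φ).card : ℝ) ≤
      ℱ.card * (2 * Real.exp (-((k : ℝ) / n * σ) / 240)) *
        Fintype.card (Fin k ⊕ Fin k ↪ Fin n) := by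
  have : Nonempty (Fin n) := ⟨⟨0, hn⟩⟩
  set M : ℝ := ((Fintype.card (Fin k ⊕ Fin k ↪ Fin n) : ℕ) : ℝ)
  let bad (S : Finset (Fin k ⊕ Fin k)) (F : Finset (Fin n)) : Finset (Fin k ⊕ Fin k ↪ Fin n) :=
    Finset.univ.filter fun φ => ((S.filter fun w => φ w ∈ F).card : ℝ) ≤
      7 / 8 * (S.card * F.card / Fintype.card (Fin n))
  let SL : Finset (Fin k ⊕ Fin k) := Finset.univ.image Sum.inl
  let SR : Finset (Fin k ⊕ Fin k) := Finset.univ.image Sum.inr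
  have hSL : SL.card = k := by
    simp [SL, Finset.card_image_of_injective _ Sum.inl_injective]
  have hSR : SR.card = k := by
    simp [SR, Finset.card_image_of_injective _ Sum.inr_injective]
  have hbad : ∀ S : Finset (Fin k ⊕ Fin k), S.card = k → ∀ F : Finset (Fin n), σ ≤ F.card →
      ((bad S F).card : ℝ) ≤ Real.exp (-((k : ℝ) / n * σ) / 240) * M := by
    intro S hS F hF
    refine (card_lower_tail_le S F).trans (mul_le_mul_of_nonneg_right ?_ (by positivity))
    rw [hS, Fintype.card_fin]
    gcongr
    rw [div_mul_eq_mul_div]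
    gcongr
  have hsub : (Finset.univ.filter fun φ : Fin k ⊕ Fin k ↪ Fin n => ¬ MeetsEvenly ℱ σ φ) ⊆
      (ℱ.filter fun F => σ ≤ F.card).biUnion fun F => bad SL F ∪ bad SR F := by
    intro φ hφ
    rw [Finset.mem_filter_univ, MeetsEvenly] at hφ
    push Not at hφ
    obtain ⟨F, hF, hσ, hlt⟩ := hφ
    rw [Finset.mem_biUnion]
    refine ⟨F, Finset.mem_filter.2 ⟨hF, hσ⟩, ?_⟩
    rw [Finset.mem_union, Finset.mem_filter_univ, Finset.mem_filter_univ, hSL, hSR, Fintype.card_fin,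
      ← card_leftSide_inter, ← card_rightSide_inter]
    have hr : 7 / 8 * ((k : ℝ) * F.card / n) = 7 / 8 * ((k : ℝ) / n) * F.card := by ring
    rw [hr]
    by_cases h : 7 / 8 * ((k : ℝ) / n) * F.card ≤ (leftSide φ ∩ F).card
    · exact Or.inr (hlt h).le
    · exact Or.inl (not_le.1 h).le
  calc ((Finset.univ.filter fun φ : Fin k ⊕ Fin k ↪ Fin n => ¬ MeetsEvenly ℱ σ φ).card : ℝ)
      ≤ (((ℱ.filter fun F => σ ≤ F.card).biUnion fun F => bad SL F ∪ bad SR F).card : ℝ) := by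
        exact_mod_cast Finset.card_le_card hsub
    _ ≤ ∑ F ∈ ℱ.filter (fun F => σ ≤ F.card), ((bad SL F ∪ bad SR F).card : ℝ) := by
        exact_mod_cast Finset.card_biUnion_le
    _ ≤ ∑ F ∈ ℱ.filter (fun F => σ ≤ F.card), 2 * Real.exp (-((k : ℝ) / n * σ) / 240) * M := by
        refine Finset.sum_le_sum fun F hF => ?_
        have h1 := hbad SL hSL F (Finset.mem_filter.1 hF).2
        have h2 := hbad SR hSR F (Finset.mem_filter.1 hF).2
        have h3 : ((bad SL F ∪ bad SR F).card : ℝ) ≤ (bad SL F).card + (bad SR F).card := by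
          exact_mod_cast Finset.card_union_le _ _
        linarith
    _ ≤ ∑ F ∈ ℱ, 2 * Real.exp (-((k : ℝ) / n * σ) / 240) * M :=
        Finset.sum_le_sum_of_subset_of_nonneg (Finset.filter_subset _ _)
          fun _ _ _ => by positivity
    _ = ℱ.card * (2 * Real.exp (-((k : ℝ) / n * σ) / 240)) * M := by
        rw [Finset.sum_const, nsmul_eq_mul]
        ring

open Classical in
/-- An event that contains all plantings along injections with the property `P` is as likely as the
fraction of these injections. -/
theorem ofReal_le_randomPlanting {V W : Type*} [Fintype V] [Fintype W] (G : SimpleGraph V)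
    (H : SimpleGraph W) (h : Fintype.card W ≤ Fintype.card V) (P : (W ↪ V) → Prop) {ε : ℝ}
    (hP : ((Finset.univ.filter fun φ : W ↪ V => ¬ P φ).card : ℝ) ≤ ε * Fintype.card (W ↪ V))
    {S : Set (SimpleGraph V)} (hS : ∀ φ, P φ → plant G H φ ∈ S) :
    ENNReal.ofReal (1 - ε) ≤ (randomPlanting G H h).toOuterMeasure S := by
  have : Nonempty (W ↪ V) := Function.Embedding.nonempty_of_card_le h
  have key : randomPlanting G H h = (PMF.uniformOfFintype (W ↪ V)).map (plant G H) := by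
    rw [randomPlanting]
    congr!
  rw [key, PMF.toOuterMeasure_map_apply, PMF.toOuterMeasure_uniformOfFintype_apply]
  have hM : 0 < Fintype.card (W ↪ V) := Fintype.card_pos
  have hsub : (Finset.univ.filter fun φ : W ↪ V => P φ).card ≤
      Fintype.card ↑(plant G H ⁻¹' S) := by
    rw [← Set.toFinset_card]
    refine Finset.card_le_card fun φ hφ => ?_
    rw [Set.mem_toFinset]
    exact hS φ (by simpa using hφ)
  have hsplit : (Finset.univ.filter fun φ : W ↪ V => P φ).card +
      (Finset.univ.filter fun φ : W ↪ V => ¬ P φ).card = Fintype.card (W ↪ V) := by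
    rw [Finset.card_filter_add_card_filter_not, Finset.card_univ]
  rw [← ENNReal.ofReal_natCast, ← ENNReal.ofReal_natCast (Fintype.card (W ↪ V)),
    ← ENNReal.ofReal_div_of_pos (by exact_mod_cast hM)]
  refine ENNReal.ofReal_le_ofReal ?_
  rw [le_div_iff₀ (by exact_mod_cast hM)]
  have h1 : ((Finset.univ.filter fun φ : W ↪ V => P φ).card : ℝ) ≤
      Fintype.card ↑(plant G H ⁻¹' S) := by exact_mod_cast hsub
  have h2 : ((Finset.univ.filter fun φ : W ↪ V => P φ).card : ℝ) +
      (Finset.univ.filter fun φ : W ↪ V => ¬ P φ).card = Fintype.card (W ↪ V) := by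
    exact_mod_cast hsplit
  linarith

end Planting

/-! ### Codegrees -/

section Codegree
variable {n k : ℕ} (G : SimpleGraph (Fin n))

/-- The vertices not adjacent to `v`, among them `v` itself. -/
noncomputable def nonNeighbors (v : Fin n) : Finset (Fin n) :=
  open Classical in {u | ¬ G.Adj v u}

/-- The number of vertices not adjacent to `v`. -/
noncomputable def codegree (v : Fin n) : ℕ := (nonNeighbors G v).card

/-- The vertices of codegree at most `y`. -/
noncomputable def lowCodegree (y : ℝ) : Finset (Fin n) := {v | (codegree G v : ℝ) ≤ y}

variable {G}

theorem mem_nonNeighbors {u v : Fin n} : u ∈ nonNeighbors G v ↔ ¬ G.Adj v u := by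
  simp [nonNeighbors]

theorem mem_lowCodegree {y : ℝ} {v : Fin n} : v ∈ lowCodegree G y ↔ (codegree G v : ℝ) ≤ y := by
  simp [lowCodegree]

theorem length_adjList_add_codegree (v : Fin n) :
    (WordRAM.adjList G v).length + codegree G v = n := by
  classical
  rw [WordRAM.length_adjList, ← SimpleGraph.card_neighborFinset_eq_degree,
    SimpleGraph.neighborFinset_eq_filter, codegree, nonNeighbors]
  convert Finset.card_filter_add_card_filter_not (s := Finset.univ) (fun u => G.Adj v u)
  simp

theorem codegree_le_of_le {G' : SimpleGraph (Fin n)} (h : G ≤ G') (v : Fin n) :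
    codegree G' v ≤ codegree G v :=
  Finset.card_le_card fun u hu => by
    rw [mem_nonNeighbors] at hu ⊢
    exact fun hadj => hu (h hadj)

theorem rank_lt_of_codegree_lt {u v : Fin n} (h : codegree G u < codegree G v) :
    WordRAM.rank G u < WordRAM.rank G v := by
  refine WordRAM.rank_lt_rank G ?_
  have h1 := length_adjList_add_codegree (G := G) u
  have h2 := length_adjList_add_codegree (G := G) v
  have h3 : n - (WordRAM.adjList G u).length + 1 ≤ n - (WordRAM.adjList G v).length := by omega
  have h4 := Nat.mul_le_mul_right n h3
  have h5 := u.2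
  rw [Nat.succ_mul] at h4
  unfold WordRAM.sortKey
  omega

/-- The vertices of small codegree come first in the sorted order. -/
theorem mem_lowCodegree_of_rank_lt {y : ℝ} {v : Fin n}
    (h : WordRAM.rank G v < (lowCodegree G y).card) : v ∈ lowCodegree G y := by
  by_contra hv
  have hsub : (lowCodegree G y).image (WordRAM.rank G) ⊆ Finset.range (WordRAM.rank G v) := by
    intro x hx
    obtain ⟨u, hu, rfl⟩ := Finset.mem_image.1 hx
    rw [mem_lowCodegree] at hu hv
    rw [Finset.mem_range]
    refine rank_lt_of_codegree_lt ?_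
    exact_mod_cast hu.trans_lt (not_le.1 hv)
  have h1 := Finset.card_le_card hsub
  rw [Finset.card_image_of_injective _ (WordRAM.rank_injective G), Finset.card_range] at h1
  omega

theorem card_sortedBlock {q st : ℕ} (h : st + q ≤ n) : (sortedBlock G q st).card = q := by
  have h1 : (sortedBlock G q st).image (WordRAM.rank G) = Finset.Ico st (st + q) := by
    ext x
    simp only [sortedBlock, Finset.mem_image, Finset.mem_filter_univ, Finset.mem_Ico]
    constructor
    · rintro ⟨v, hv, rfl⟩
      exact hv
    · intro hx
      refine ⟨WordRAM.sortedVertex G ⟨x, by omega⟩, ?_⟩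
      rw [WordRAM.rank_sortedVertex]
      exact ⟨hx, rfl⟩
  rw [← Finset.card_image_of_injective _ (WordRAM.rank_injective G), h1, Nat.card_Ico]
  omega

/-- Among the blocks in an initial segment of the sorted order, one avoids a given small set. -/
theorem exists_sortedBlock_disjoint {q p : ℕ} (hq : 0 < q) (X : Finset (Fin n))
    (hX : X.card < p / q) : ∃ j, (j + 1) * q ≤ p ∧ ∀ v ∈ sortedBlock G q (j * q), v ∉ X := by
  have h1 : ¬ Finset.range (p / q) ⊆ X.image fun v => WordRAM.rank G v / q := by
    intro hsub
    have h2 := (Finset.card_le_card hsub).trans Finset.card_image_le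
    rw [Finset.card_range] at h2
    omega
  rw [Finset.not_subset] at h1
  obtain ⟨j, hj, hjX⟩ := h1
  rw [Finset.mem_range] at hj
  refine ⟨j, (Nat.le_div_iff_mul_le hq).1 hj, fun v hv hvX => hjX ?_⟩
  rw [sortedBlock, Finset.mem_filter_univ] at hv
  refine Finset.mem_image.2 ⟨v, hvX, ?_⟩
  refine Nat.div_eq_of_lt_le hv.1 ?_
  rw [Nat.succ_mul]
  exact hv.2

/-- In a block of vertices of very small codegree all sets have many common neighbours. -/
theorem le_card_commonNeighbors_of_codegree {q : ℕ} {m : ℝ} (hm : 2 * q ≤ m) (hq : q ≤ n)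
    (hq0 : 0 < q) {A : Finset (Fin n)} (hA : A.card ≤ q)
    (hlow : ∀ v ∈ A, (codegree G v : ℝ) ≤ n / m) : q ≤ 3 * (commonNeighbors G A).card := by
  have hsub : (commonNeighbors G A)ᶜ ⊆ A.biUnion (nonNeighbors G) := by
    intro v hv
    rw [Finset.mem_compl, mem_commonNeighbors] at hv
    push Not at hv
    obtain ⟨a, ha, hav⟩ := hv
    exact Finset.mem_biUnion.2 ⟨a, ha, mem_nonNeighbors.2 hav⟩
  have h1 : ((commonNeighbors G A)ᶜ.card : ℝ) ≤ n / 2 := by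
    have hq0' : (0 : ℝ) < q := by exact_mod_cast hq0
    have hm0 : 0 < m := by linarith
    calc ((commonNeighbors G A)ᶜ.card : ℝ) ≤ ((A.biUnion (nonNeighbors G)).card : ℝ) := by
          exact_mod_cast Finset.card_le_card hsub
      _ ≤ ∑ v ∈ A, (codegree G v : ℝ) := by exact_mod_cast Finset.card_biUnion_le
      _ ≤ ∑ v ∈ A, (n / m : ℝ) := Finset.sum_le_sum hlow
      _ = A.card * (n / m) := by rw [Finset.sum_const, nsmul_eq_mul]
      _ ≤ m / 2 * (n / m) := by
          refine mul_le_mul_of_nonneg_right ?_ (by positivity)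
          have : (A.card : ℝ) ≤ q := by exact_mod_cast hA
          linarith
      _ = n / 2 := by field_simp
  rw [Finset.card_compl, Nat.cast_sub (Finset.card_le_univ _), Fintype.card_fin] at h1
  have h2 : (q : ℝ) ≤ n := by exact_mod_cast hq
  have h3 : (q : ℝ) ≤ 3 * (commonNeighbors G A).card := by linarith
  exact_mod_cast h3

end Codegree

/-! ### The planted graph -/

section Planted
variable {n k : ℕ} {G : SimpleGraph (Fin n)} {φ : Fin k ⊕ Fin k ↪ Fin n}

theorem le_plant : G ≤ plant G (balancedBiclique k) φ := le_sup_left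

theorem plant_adj_of_mem {u v : Fin n} (hu : u ∈ leftSide φ) (hv : v ∈ rightSide φ) :
    (plant G (balancedBiclique k) φ).Adj u v := by
  obtain ⟨i, -, rfl⟩ := Finset.mem_image.1 hu
  obtain ⟨j, -, rfl⟩ := Finset.mem_image.1 hv
  refine Or.inr ((SimpleGraph.map_adj _ _ _ _).2 ⟨.inl i, .inr j, ?_, rfl, rfl⟩)
  simp [balancedBiclique]

theorem plant_adj_iff {u v : Fin n} (hu : u ∉ leftSide φ ∪ rightSide φ) :
    (plant G (balancedBiclique k) φ).Adj u v ↔ G.Adj u v := by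
  refine ⟨fun h => ?_, fun h => le_plant h⟩
  rcases h with h | h
  · exact h
  · obtain ⟨x, y, -, rfl, rfl⟩ := (SimpleGraph.map_adj _ _ _ _).1 h
    refine absurd ?_ hu
    rcases x with i | i
    · exact Finset.mem_union_left _ (Finset.mem_image_of_mem _ (Finset.mem_univ i))
    · exact Finset.mem_union_right _ (Finset.mem_image_of_mem _ (Finset.mem_univ i))

theorem disjoint_sides : Disjoint (leftSide φ) (rightSide φ) := by
  rw [Finset.disjoint_left]
  intro v hl hr
  obtain ⟨i, -, rfl⟩ := Finset.mem_image.1 hl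
  obtain ⟨j, -, h⟩ := Finset.mem_image.1 hr
  exact absurd (φ.injective h) (by simp)

theorem card_leftSide : (leftSide φ).card = k := by
  refine (Finset.card_image_of_injective _ (φ.injective.comp Sum.inl_injective)).trans ?_
  simp

theorem card_rightSide : (rightSide φ).card = k := by
  refine (Finset.card_image_of_injective _ (φ.injective.comp Sum.inr_injective)).trans ?_
  simp

theorem codegree_plant_of_notMem {v : Fin n} (hv : v ∉ leftSide φ ∪ rightSide φ) :
    codegree (plant G (balancedBiclique k) φ) v = codegree G v := by
  rw [codegree, codegree]
  congr 1
  ext u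
  rw [mem_nonNeighbors, mem_nonNeighbors, plant_adj_iff hv]

/-- Planting joins a vertex on one side to its former non-neighbours on the other side. -/
theorem codegree_plant_add_card_le {v : Fin n} {S : Finset (Fin n)}
    (hv : ∀ u ∈ S, (plant G (balancedBiclique k) φ).Adj v u) :
    codegree (plant G (balancedBiclique k) φ) v + (S ∩ nonNeighbors G v).card ≤ codegree G v := by
  rw [codegree, codegree, ← Finset.card_union_of_disjoint]
  · refine Finset.card_le_card fun u hu => ?_
    rcases Finset.mem_union.1 hu with h | h
    · rw [mem_nonNeighbors] at h ⊢
      exact fun hadj => h (le_plant hadj)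
    · exact (Finset.mem_inter.1 h).2
  · rw [Finset.disjoint_left]
    intro u h1 h2
    exact mem_nonNeighbors.1 h1 (hv u (Finset.mem_inter.1 h2).1)

/-- In a block of planted vertices every selectable set has many common neighbours: if it lies on
one side of the planted biclique these include the other side, and otherwise they include the rest
of the block. -/
theorem le_card_commonNeighbors_of_planted {q : ℕ} {A B : Finset (Fin n)}
    (hB : B ⊆ leftSide φ ∪ rightSide φ) (hcard : B.card = q) (hqk : q ≤ k)
    (hA : Selectable (plant G (balancedBiclique k) φ) B A) :
    q ≤ 3 * (commonNeighbors (plant G (balancedBiclique k) φ) A).card := by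
  obtain ⟨hAB, hsize, hA | ⟨h2, hA⟩⟩ := hA
  · have hc := hA (fun v => decide (v ∈ leftSide φ)) ?_
    · suffices h : k ≤ (commonNeighbors (plant G (balancedBiclique k) φ) A).card by omega
      by_cases hl : ∃ u ∈ A, u ∈ leftSide φ
      · obtain ⟨u, hu, hul⟩ := hl
        refine (card_rightSide (φ := φ)).symm.trans_le ?_
        refine Finset.card_le_card fun v hv => mem_commonNeighbors.2 fun a ha => ?_
        refine plant_adj_of_mem ?_ hv
        simpa [hul] using hc u hu a ha
      · push Not at hl
        refine (card_leftSide (φ := φ)).symm.trans_le ?_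
        refine Finset.card_le_card fun v hv => mem_commonNeighbors.2 fun a ha => ?_
        refine (plant_adj_of_mem hv ?_).symm
        exact (Finset.mem_union.1 (hB (hAB ha))).resolve_left (hl a ha)
    · intro u hu v hv hne
      by_cases hul : u ∈ leftSide φ
      · by_cases hvl : v ∈ leftSide φ
        · simp [hul, hvl] at hne
        · exact plant_adj_of_mem hul ((Finset.mem_union.1 (hB hv)).resolve_left hvl)
      · by_cases hvl : v ∈ leftSide φ
        · exact (plant_adj_of_mem hvl ((Finset.mem_union.1 (hB hu)).resolve_left hul)).symm
        · simp [hul, hvl] at hne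
  · have h3 : (B \ A).card ≤ (commonNeighbors (plant G (balancedBiclique k) φ) A).card :=
      Finset.card_le_card fun v hv => mem_commonNeighbors.2 fun a ha => hA a ha v hv
    rw [Finset.card_sdiff_of_subset hAB] at h3
    omega

end Planted

/-! ### A good block -/

section Ladder
variable {n k : ℕ} (G : SimpleGraph (Fin n))

/-- The sets that the planted sides should meet evenly: the non-neighbourhoods of the vertices, and
the sets of vertices of codegree at most a given bound. -/
noncomputable def testSets : Finset (Finset (Fin n)) :=
  Finset.univ.image (nonNeighbors G) ∪
    (Finset.range (n + 1)).image fun y : ℕ => lowCodegree G (y : ℝ)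

theorem card_testSets_le : (testSets G).card ≤ 2 * n + 1 := by
  refine (Finset.card_union_le _ _).trans ?_
  have h1 := Finset.card_image_le (s := Finset.univ) (f := nonNeighbors G)
  have h2 := Finset.card_image_le (s := Finset.range (n + 1))
    (f := fun y : ℕ => lowCodegree G (y : ℝ))
  rw [Finset.card_univ, Fintype.card_fin] at h1
  rw [Finset.card_range] at h2
  omega

variable {G}

theorem lowCodegree_mem_testSets {y : ℝ} (hy0 : 0 ≤ y) (hy : y ≤ n) :
    lowCodegree G y ∈ testSets G := by
  refine Finset.mem_union_right _ (Finset.mem_image.2 ⟨⌊y⌋₊, ?_, ?_⟩)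
  · rw [Finset.mem_range, Nat.lt_succ_iff]
    exact Nat.floor_le_of_le hy
  · ext v
    rw [mem_lowCodegree, mem_lowCodegree, Nat.cast_le, Nat.le_floor_iff hy0]

theorem nonNeighbors_mem_testSets (v : Fin n) : nonNeighbors G v ∈ testSets G :=
  Finset.mem_union_left _ (Finset.mem_image_of_mem _ (Finset.mem_univ v))

/-- Consider the first step in which the sequence drops below the proportion `ρ`. -/
theorem exists_drop_or_le {x : ℕ → ℝ} {ρ : ℝ} (hρ : 0 ≤ ρ) (I : ℕ) :
    (∃ i < I, ρ ^ i * x 0 ≤ x i ∧ x (i + 1) < ρ * x i) ∨ ρ ^ I * x 0 ≤ x I := by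
  induction I with
  | zero => right; simp
  | succ I ih =>
    rcases ih with ⟨i, hi, h⟩ | h
    · exact Or.inl ⟨i, by omega, h⟩
    · by_cases hd : x (I + 1) < ρ * x I
      · exact Or.inl ⟨I, by omega, h, hd⟩
      · right
        rw [pow_succ]
        nlinarith

/-- Some block of the sorted order has no selectable set with fewer than `q / 3` common neighbours.
Consider the numbers of vertices of codegree at most `(1 - β) ^ i * n` for `i ≤ I`. If they drop by
more than the factor `ρ` in one step, some block contains planted vertices only. Otherwise the
vertices in the first block have codegree at most `n / m`. -/
theorem exists_good_block {φ : Fin k ⊕ Fin k ↪ Fin n} {β σ ρ m : ℝ} {q I : ℕ}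
    (hβ : β = 7 / 8 * (k / n)) (hφ : MeetsEvenly (testSets G) σ φ) (hq0 : 0 < q)
    (hn : 0 < n) (hkn : 2 * k ≤ n) (hρ0 : 0 < ρ) (hρ1 : ρ ≤ 1) (hI : (1 - β) ^ I * m ≤ 1)
    (hσ : σ ≤ ρ ^ I * n) (hqσ : q ≤ β * σ) (hqρ : q * ρ ≤ β) (hσm : 2 * σ ≤ n / m)
    (hqm : 2 * q ≤ m) (hqk : q ≤ k) :
    ∃ j, (j + 1) * q ≤ n ∧ ∀ A,
      Selectable (plant G (balancedBiclique k) φ)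
        (sortedBlock (plant G (balancedBiclique k) φ) q (j * q)) A →
      q ≤ 3 * (commonNeighbors (plant G (balancedBiclique k) φ) A).card := by
  set G' := plant G (balancedBiclique k) φ with hG'
  have hn' : (0 : ℝ) < n := by exact_mod_cast hn
  have hq0' : (1 : ℝ) ≤ q := by exact_mod_cast hq0
  have hm0 : 0 < m := by linarith
  have hβ0 : 0 ≤ β := by rw [hβ]; positivity
  have hβ1 : β ≤ 1 / 2 := by
    have h1 : (k : ℝ) / n ≤ 1 / 2 := by
      rw [div_le_iff₀ hn']
      have : (2 * k : ℝ) ≤ n := by exact_mod_cast hkn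
      linarith
    rw [hβ]
    linarith
  have hσ0 : q ≤ σ := by
    have hσpos : 0 < σ := by
      by_contra! h
      nlinarith
    nlinarith
  set y : ℕ → ℝ := fun i => (1 - β) ^ i * n with hy
  set x : ℕ → ℝ := fun i => (lowCodegree G (y i)).card with hx
  have hy0 : ∀ i, 0 ≤ y i := fun i => mul_nonneg (pow_nonneg (by linarith) i) hn'.le
  have hyn : ∀ i, y i ≤ n := fun i =>
    mul_le_of_le_one_left hn'.le (pow_le_one₀ (by linarith) (by linarith))
  have hx0 : x 0 = n := by
    have : lowCodegree G (y 0) = Finset.univ := by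
      ext v
      simp only [mem_lowCodegree, hy, pow_zero, one_mul, Finset.mem_univ, iff_true, Nat.cast_le]
      simpa [codegree] using Finset.card_le_univ (nonNeighbors G v)
    simp [hx, this]
  -- The first block does if sufficiently many vertices have codegree at most `n / m`.
  have hend : ∀ i, y i ≤ n / m → σ ≤ x i → ∃ j, (j + 1) * q ≤ n ∧ ∀ A,
      Selectable G' (sortedBlock G' q (j * q)) A → q ≤ 3 * (commonNeighbors G' A).card := by
    intro i hi hxi
    have hcard : q ≤ (lowCodegree G' (n / m)).card := by
      have h1 : (lowCodegree G (y i)).card ≤ (lowCodegree G' (n / m)).card := by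
        refine Finset.card_le_card fun v hv => ?_
        rw [mem_lowCodegree] at hv ⊢
        have h2 : (codegree G' v : ℝ) ≤ codegree G v := by
          exact_mod_cast codegree_le_of_le le_plant v
        linarith
      have h2 : (q : ℝ) ≤ (lowCodegree G (y i)).card := hσ0.trans hxi
      exact (show q ≤ _ by exact_mod_cast h2).trans h1
    have hqn : q ≤ n := hcard.trans (by simpa using Finset.card_le_univ (lowCodegree G' (n / m)))
    refine ⟨0, by simpa using hqn, fun A hA => ?_⟩
    refine le_card_commonNeighbors_of_codegree hqm hqn hq0 ?_ fun v hv => ?_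
    · refine (Finset.card_le_card hA.1).trans_eq (card_sortedBlock (by simpa using hqn))
    · have hv' := hA.1 hv
      rw [sortedBlock, Finset.mem_filter_univ] at hv'
      exact mem_lowCodegree.1 (mem_lowCodegree_of_rank_lt (by omega))
  rcases exists_drop_or_le (x := x) hρ0.le I with ⟨i, hiI, hxi, hdrop⟩ | hxI
  · have hxσ : σ ≤ x i := by
      refine hσ.trans (le_trans ?_ (hx0 ▸ hxi))
      exact mul_le_mul_of_nonneg_right (pow_le_pow_of_le_one hρ0.le hρ1 hiI.le) hn'.le
    by_cases hyi : y i ≤ n / m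
    · exact hend i hyi hxσ
    · push Not at hyi
      set S := lowCodegree G (y i) with hS
      obtain ⟨hL, hR⟩ := hφ S (lowCodegree_mem_testSets (hy0 i) (hyn i)) hxσ
      rw [← hβ] at hL hR
      set P := lowCodegree G' (y (i + 1)) with hP
      have hy1 : y (i + 1) = (1 - β) * y i := by
        simp only [hy, pow_succ]
        ring
      -- The codegree of a planted vertex drops by the factor `1 - β`, unless it is small anyway.
      have hmem : ∀ v ∈ S, ∀ R, (∀ u ∈ R, G'.Adj v u) → (σ ≤ codegree G v →
          β * codegree G v ≤ (R ∩ nonNeighbors G v).card) → v ∈ P := by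
        intro v hv R hR hσv
        rw [hS, mem_lowCodegree] at hv
        rw [hP, mem_lowCodegree, hy1]
        have h1 : (codegree G' v : ℝ) + (R ∩ nonNeighbors G v).card ≤ codegree G v := by
          exact_mod_cast codegree_plant_add_card_le hR
        by_cases h : σ ≤ codegree G v
        · have h2 := hσv h
          nlinarith
        · have h3 : (0 : ℝ) ≤ (R ∩ nonNeighbors G v).card := by positivity
          nlinarith
      have hsub : (leftSide φ ∩ S) ∪ (rightSide φ ∩ S) ⊆ P := by
        intro v hv
        rcases Finset.mem_union.1 hv with hv | hv
        · refine hmem v (Finset.mem_inter.1 hv).2 (rightSide φ)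
            (fun u hu => plant_adj_of_mem (Finset.mem_inter.1 hv).1 hu) fun h => ?_
          rw [hβ]
          exact (hφ _ (nonNeighbors_mem_testSets v) h).2
        · refine hmem v (Finset.mem_inter.1 hv).2 (leftSide φ)
            (fun u hu => (plant_adj_of_mem hu (Finset.mem_inter.1 hv).1).symm) fun h => ?_
          rw [hβ]
          exact (hφ _ (nonNeighbors_mem_testSets v) h).1
      -- Vertices of small codegree in the planted graph that are planted are numerous.
      have hPcard : 2 * β * x i ≤ P.card := by
        have h1 := Finset.card_le_card hsub
        rw [Finset.card_union_of_disjoint (disjoint_sides.mono Finset.inter_subset_left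
          Finset.inter_subset_left)] at h1
        have h2 : ((leftSide φ ∩ S).card : ℝ) + (rightSide φ ∩ S).card ≤ P.card := by
          exact_mod_cast h1
        simp only [hx]
        linarith
      -- Those that are not planted had the same small codegree before, and are few.
      have hXcard : ((P \ (leftSide φ ∪ rightSide φ)).card : ℝ) ≤ x (i + 1) := by
        simp only [hx, Nat.cast_le]
        refine Finset.card_le_card fun v hv => ?_
        obtain ⟨h1, h2⟩ := Finset.mem_sdiff.1 hv
        rw [hP, mem_lowCodegree, codegree_plant_of_notMem h2] at h1
        exact mem_lowCodegree.2 h1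
      have hfloor : (P \ (leftSide φ ∪ rightSide φ)).card < P.card / q := by
        have h1 : (P.card : ℝ) < q * ((P.card / q : ℕ) + 1) := by
          exact_mod_cast Nat.lt_mul_div_succ P.card hq0
        have h2 : ((P \ (leftSide φ ∪ rightSide φ)).card : ℝ) < (P.card / q : ℕ) := by
          have h3 : q * ρ * x i ≤ β * x i := mul_le_mul_of_nonneg_right hqρ (by positivity)
          have h4 : q ≤ β * x i := hqσ.trans (mul_le_mul_of_nonneg_left hxσ hβ0)
          have h5 : q * ((P \ (leftSide φ ∪ rightSide φ)).card : ℝ) < q * (P.card / q : ℕ) := by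
            nlinarith
          exact lt_of_mul_lt_mul_left h5 (by positivity)
        exact_mod_cast h2
      obtain ⟨j, hj, hjX⟩ := exists_sortedBlock_disjoint (G := G') hq0 _ hfloor
      have hPn : P.card ≤ n := by simpa using Finset.card_le_univ P
      have hjn : (j + 1) * q ≤ n := hj.trans hPn
      refine ⟨j, hjn, fun A hA => ?_⟩
      rw [Nat.succ_mul] at hj hjn
      refine le_card_commonNeighbors_of_planted (fun v hv => ?_) (card_sortedBlock hjn) hqk hA
      by_contra hcon
      refine hjX v hv (Finset.mem_sdiff.2 ⟨mem_lowCodegree_of_rank_lt ?_, hcon⟩)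
      rw [sortedBlock, Finset.mem_filter_univ] at hv
      change _ < P.card
      omega
  · -- After `I` steps the bound on the codegree is at most `n / m`.
    refine hend I ?_ (hσ.trans (hx0 ▸ hxI))
    rw [le_div_iff₀ hm0]
    simp only [hy]
    nlinarith

end Ladder

/-! ### The choice of parameters -/

/-- For `m = 2 ^ t` and `ρ = 2 ^ (-t)` there is a number `I` of steps in which the codegree bound
decreases from `n = 2 ^ L` to `n / m`, while the numbers of vertices, if they never drop by more than
the factor `ρ`, stay above `n ^ (1 / 20)`. This is where the square root in `t` comes from: `I` is of
order `t / c`, and `t * I` has to stay below `L`. -/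
theorem exists_number_of_steps {β c L t : ℝ} (hc : 0 < c) (hc1 : c ≤ 1) (hβ : 2 / 5 * c ≤ β)
    (hβ1 : β ≤ 1) (hL : 5000 ≤ L) (ht : t = √(c * L / 2)) :
    ∃ I : ℕ, (1 - β) ^ I * (2 : ℝ) ^ t ≤ 1 ∧ (2 : ℝ) ^ (L / 20) ≤ ((2 : ℝ) ^ (-t)) ^ I * 2 ^ L := by
  have hβ0 : 0 < β := by linarith
  have ht0 : 0 ≤ t := ht ▸ Real.sqrt_nonneg _
  have htt : t * t = c * L / 2 := by
    rw [ht]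
    exact Real.mul_self_sqrt (by positivity)
  have htL : t ≤ L / 50 := by
    by_contra! h
    nlinarith
  have hlog := Real.log_two_lt_d9
  have hlog0 := Real.log_pos (one_lt_two (α := ℝ))
  refine ⟨⌈t * Real.log 2 / β⌉₊, ?_, ?_⟩
  · have h1 := Nat.le_ceil (t * Real.log 2 / β)
    generalize ⌈t * Real.log 2 / β⌉₊ = I at h1
    rw [div_le_iff₀ hβ0] at h1
    calc (1 - β) ^ I * (2 : ℝ) ^ t ≤ Real.exp (-β) ^ I * Real.exp (Real.log 2 * t) := by
          rw [Real.rpow_def_of_pos two_pos]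
          exact mul_le_mul_of_nonneg_right
            (pow_le_pow_left₀ (by linarith) (Real.one_sub_le_exp_neg β) I) (Real.exp_pos _).le
      _ = Real.exp (t * Real.log 2 - I * β) := by
          rw [← Real.exp_nat_mul, ← Real.exp_add]
          congr 1
          ring
      _ ≤ 1 := Real.exp_le_one_iff.2 (by linarith)
  · have h1 := (Nat.ceil_lt_add_one (show 0 ≤ t * Real.log 2 / β by positivity)).le
    generalize ⌈t * Real.log 2 / β⌉₊ = I at h1
    rw [← Real.rpow_natCast, ← Real.rpow_mul two_pos.le, ← Real.rpow_add two_pos]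
    refine Real.rpow_le_rpow_of_exponent_le one_le_two ?_
    -- `t * I ≤ log 2 * t ^ 2 / β + t`, where `t ^ 2 / β ≤ (5 / 4) * L` and `(5 / 4) * log 2 < 0.87`.
    have h2 : t * (t * Real.log 2 / β) ≤ 87 / 100 * L := by
      have h3 : t * (t * Real.log 2 / β) = c * L / 2 * Real.log 2 / β := by
        rw [← htt]
        ring
      rw [h3, div_le_iff₀ hβ0]
      have h4 : c * L / 2 * Real.log 2 ≤ c * L / 2 * 0.6931471808 :=
        mul_le_mul_of_nonneg_left hlog.le (by positivity)
      have h5 : 2 / 5 * c * L ≤ β * L := mul_le_mul_of_nonneg_right hβ (by linarith)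
      have h6 : 0 ≤ c * L := by positivity
      linarith
    have h3 : t * I ≤ t * (t * Real.log 2 / β + 1) := mul_le_mul_of_nonneg_left h1 ht0
    linarith

section Large
variable {n k : ℕ} {c L : ℝ}

/-- The rounding of `k` to an integer costs little, as `c * n` is at least `1000`. -/
theorem le_density (hc : 0 < c) (hL : 5000 ≤ L) (hcL : 100 ≤ c * L) (hnL : 10 * L ≤ n)
    (hk : k = ⌊c * n / 2⌋₊) : 2 / 5 * c ≤ 7 / 8 * ((k : ℝ) / n) := by
  have hn : (0 : ℝ) < n := by linarith
  have h1 : c * n / 2 < k + 1 := hk ▸ Nat.lt_floor_add_one _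
  have h2 : c * (10 * L) ≤ c * n := mul_le_mul_of_nonneg_left hnL hc.le
  rw [mul_div_assoc', le_div_iff₀ hn]
  linarith

/-- A planted graph whose sides meet the test sets evenly has a block of vertices, consecutive in
the sorted order, all of whose selectable sets yield large bicliques. -/
theorem exists_block_of_meetsEvenly {G : SimpleGraph (Fin n)} {φ : Fin k ⊕ Fin k ↪ Fin n}
    (hc : 0 < c) (hc1 : c ≤ 1) (hL : 5000 ≤ L) (hcL : 100 ≤ c * L) (hnL : 10 * L ≤ n)
    (hLn : (2 : ℝ) ^ L = n) (hk : k = ⌊c * n / 2⌋₊)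
    (hφ : MeetsEvenly (testSets G) ((2 : ℝ) ^ (L / 20)) φ) :
    ∃ e j, (j + 1) * 2 ^ e ≤ n ∧ ∀ A,
      Selectable (plant G (balancedBiclique k) φ)
        (sortedBlock (plant G (balancedBiclique k) φ) (2 ^ e) (j * 2 ^ e)) A →
      c / 48 * (2 : ℝ) ^ √(c * L / 2) ≤
        min A.card (commonNeighbors (plant G (balancedBiclique k) φ) A).card := by
  have hn : (0 : ℝ) < n := by linarith
  have hn0 : 0 < n := by exact_mod_cast hn
  have hβ := le_density hc hL hcL hnL hk
  have hkc : 2 / 5 * c * n ≤ k := by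
    have h1 : 2 / 5 * c ≤ (k : ℝ) / n := by
      have : 0 ≤ (k : ℝ) / n := by positivity
      linarith
    rwa [le_div_iff₀ hn] at h1
  have hk0 : 0 < k := by
    have h1 : (0 : ℝ) < k := lt_of_lt_of_le (by positivity) hkc
    exact_mod_cast h1
  have hkn : 2 * k ≤ n := by
    have h1 := card_balancedBiclique_le hc1 n
    rw [← hk, Fintype.card_sum, Fintype.card_fin, Fintype.card_fin] at h1
    omega
  have hβ1 : 7 / 8 * ((k : ℝ) / n) ≤ 1 / 2 := by
    have h1 : (k : ℝ) / n ≤ 1 / 2 := by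
      rw [div_le_iff₀ hn]
      have : (2 * k : ℝ) ≤ n := by exact_mod_cast hkn
      linarith
    linarith
  obtain ⟨t, ht⟩ : ∃ t, t = √(c * L / 2) := ⟨_, rfl⟩
  rw [← ht]
  have ht0 : 0 ≤ t := ht ▸ Real.sqrt_nonneg _
  have htL : t ≤ L / 50 := by
    have htt : t * t = c * L / 2 := by
      rw [ht]
      exact Real.mul_self_sqrt (by positivity)
    by_contra! h
    nlinarith
  have h2t : (0 : ℝ) < 2 ^ t := by positivity
  by_cases hY : c / 8 * (2 : ℝ) ^ t < 1
  · -- The bound is less than `1`, so that any vertex with a neighbour will do.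
    obtain ⟨v, u, hvu⟩ : ∃ v u, (plant G (balancedBiclique k) φ).Adj v u :=
      ⟨_, _, plant_adj_of_mem (Finset.mem_image_of_mem _ (Finset.mem_univ ⟨0, hk0⟩))
        (Finset.mem_image_of_mem _ (Finset.mem_univ ⟨0, hk0⟩))⟩
    generalize plant G (balancedBiclique k) φ = G' at hvu
    have hr := WordRAM.rank_lt G' v
    refine ⟨0, WordRAM.rank G' v, by simpa using hr, fun A hA => ?_⟩
    rw [pow_zero, mul_one] at hA
    have hcard := card_sortedBlock (G := G') (q := 1) (st := WordRAM.rank G' v) (by omega)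
    have hA1 : 1 ≤ A.card := by
      have := hA.2.1
      omega
    have hA2 : 1 ≤ (commonNeighbors G' A).card := by
      refine Finset.card_pos.2 ⟨u, mem_commonNeighbors.2 fun a ha => ?_⟩
      have h1 := hA.1 ha
      rw [sortedBlock, Finset.mem_filter_univ] at h1
      rwa [WordRAM.rank_injective G' (show WordRAM.rank G' a = WordRAM.rank G' v by omega)]
    have h2 : (1 : ℝ) ≤ (min A.card (commonNeighbors G' A).card : ℕ) := by
      exact_mod_cast le_min hA1 hA2
    linarith
  · -- The block size is the largest power of two that is at most `c / 8 * 2 ^ t`.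
    push Not at hY
    obtain ⟨e, he, he'⟩ := exists_nat_pow_near hY (one_lt_two (α := ℝ))
    obtain ⟨I, hI, hIσ⟩ := exists_number_of_steps hc hc1 hβ (by linarith) hL ht
    have hmn : (2 : ℝ) ^ t ≤ 2 ^ (L / 20) :=
      Real.rpow_le_rpow_of_exponent_le one_le_two (by linarith)
    have hmn' : (2 : ℝ) ^ t ≤ n := by
      rw [← hLn]
      exact Real.rpow_le_rpow_of_exponent_le one_le_two (by linarith)
    have hmul : (2 : ℝ) ^ t * 2 ^ (-t) = 1 := by
      rw [← Real.rpow_add two_pos, add_neg_cancel, Real.rpow_zero]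
    obtain ⟨j, hj, hgood⟩ := exists_good_block (q := 2 ^ e) (I := I) (m := (2 : ℝ) ^ t)
      (ρ := (2 : ℝ) ^ (-t)) rfl hφ (by positivity) hn0 hkn (by positivity)
      (Real.rpow_le_one_of_one_le_of_nonpos one_le_two (by linarith)) hI (hLn ▸ hIσ)
      (by
        push_cast
        have h1 : 2 / 5 * c * (2 : ℝ) ^ t ≤ 7 / 8 * ((k : ℝ) / n) * 2 ^ (L / 20) :=
          mul_le_mul hβ hmn h2t.le (by positivity)
        have h2 : 0 < c * (2 : ℝ) ^ t := by positivity
        linarith)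
      (by
        push_cast
        have h1 : (2 : ℝ) ^ e * 2 ^ (-t) ≤ c / 8 * 2 ^ t * 2 ^ (-t) :=
          mul_le_mul_of_nonneg_right he (by positivity)
        rw [mul_assoc, hmul] at h1
        linarith)
      (by
        rw [le_div_iff₀ h2t]
        nth_rewrite 1 [← Real.rpow_one 2]
        rw [← Real.rpow_add two_pos, ← Real.rpow_add two_pos, ← hLn]
        exact Real.rpow_le_rpow_of_exponent_le one_le_two (by linarith))
      (by
        push_cast
        have h1 : c * (2 : ℝ) ^ t ≤ 1 * 2 ^ t := mul_le_mul_of_nonneg_right hc1 h2t.le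
        linarith)
      (by
        have h1 : c * (2 : ℝ) ^ t ≤ c * n := mul_le_mul_of_nonneg_left hmn' hc.le
        have h3 : 0 ≤ c * (n : ℝ) := by positivity
        have h2 : ((2 ^ e : ℕ) : ℝ) ≤ k := by
          push_cast
          linarith
        exact_mod_cast h2)
    refine ⟨e, j, hj, fun A hA => ?_⟩
    have h1 := hgood A hA
    have h2 := hA.2.1
    rw [card_sortedBlock (by rwa [Nat.succ_mul] at hj)] at h2
    have h1' : (2 : ℝ) ^ e ≤ 3 * (commonNeighbors (plant G (balancedBiclique k) φ) A).card := by
      exact_mod_cast h1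
    have h2' : (2 : ℝ) ^ e ≤ 3 * A.card := by exact_mod_cast h2
    rw [pow_succ] at he'
    rw [Nat.cast_min]
    exact le_min (by linarith) (by linarith)

theorem mul_self_le_ncard_edgeSet_plant (G : SimpleGraph (Fin n)) (φ : Fin k ⊕ Fin k ↪ Fin n) :
    k * k ≤ (plant G (balancedBiclique k) φ).edgeSet.ncard := by
  have h1 : Function.Injective fun x : Fin k × Fin k => s(φ (.inl x.1), φ (.inr x.2)) := by
    rintro ⟨a, b⟩ ⟨a', b'⟩ h
    rcases Sym2.eq_iff.1 h with ⟨h1, h2⟩ | ⟨h1, h2⟩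
    · exact Prod.ext (Sum.inl_injective (φ.injective h1)) (Sum.inr_injective (φ.injective h2))
    · exact absurd (φ.injective h1) (by simp)
  have h2 := Set.ncard_image_of_injective Set.univ h1
  rw [Set.ncard_univ, Nat.card_eq_fintype_card, Fintype.card_prod, Fintype.card_fin] at h2
  rw [← h2]
  refine Set.ncard_le_ncard ?_ (Set.toFinite _)
  rintro _ ⟨x, -, rfl⟩
  exact plant_adj_of_mem (Finset.mem_image_of_mem _ (Finset.mem_univ _))
    (Finset.mem_image_of_mem _ (Finset.mem_univ _))

/-- The planted graph is so dense that the algorithm does not give up on it. -/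
theorem mul_self_le_ncard_edgeSet_plant_mul_size (hc : 0 < c) (hL : 5000 ≤ L) (hcL : 100 ≤ c * L)
    (hnL : 10 * L ≤ n) (hLn : (2 : ℝ) ^ L = n) (hk : k = ⌊c * n / 2⌋₊) (G : SimpleGraph (Fin n))
    (φ : Fin k ⊕ Fin k ↪ Fin n) :
    n * n ≤ 2 * (plant G (balancedBiclique k) φ).edgeSet.ncard * (Nat.size n * Nat.size n) := by
  have hn : (0 : ℝ) < n := by linarith
  have hβ := le_density hc hL hcL hnL hk
  have hkc : 2 / 5 * c * n ≤ k := by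
    have h1 : 2 / 5 * c ≤ (k : ℝ) / n := by
      have : 0 ≤ (k : ℝ) / n := by positivity
      linarith
    rwa [le_div_iff₀ hn] at h1
  have hLs : L ≤ Nat.size n := by
    rw [← Real.rpow_le_rpow_left_iff one_lt_two, hLn, Real.rpow_natCast]
    exact_mod_cast (Nat.lt_size_self n).le
  have h1 : (n : ℝ) ≤ k * Nat.size n := by
    have h2 : 2 / 5 * c * n * L ≤ k * Nat.size n :=
      mul_le_mul hkc hLs (by linarith) (by positivity)
    have h3 : 100 * (n : ℝ) ≤ c * L * n := mul_le_mul_of_nonneg_right hcL hn.le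
    linarith
  have h2 : n ≤ k * Nat.size n := by exact_mod_cast h1
  calc n * n ≤ (k * Nat.size n) * (k * Nat.size n) := Nat.mul_le_mul h2 h2
    _ = (k * k) * (Nat.size n * Nat.size n) := by ring
    _ ≤ _ := Nat.mul_le_mul_right _ ((mul_self_le_ncard_edgeSet_plant G φ).trans (by omega))

/-- The planted sides meet all test sets evenly with probability at least `1 - n ^ (-a)`. -/
theorem card_not_meetsEvenly_testSets_le {a : ℝ} (ha : 1 ≤ a) (hc : 0 < c) (hL : 5000 ≤ L) (hcL : 100 ≤ c * L)
    (hnL : 10 * L ≤ n) (hk : k = ⌊c * n / 2⌋₊)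
    (hσ : 6 * (a + 2) * (L * Real.log n) ≤ (2 : ℝ) ^ (L / 20)) (G : SimpleGraph (Fin n)) :
    open Classical in
    ((Finset.univ.filter fun φ : Fin k ⊕ Fin k ↪ Fin n =>
      ¬ MeetsEvenly (testSets G) ((2 : ℝ) ^ (L / 20)) φ).card : ℝ) ≤
      (n : ℝ) ^ (-a) * Fintype.card (Fin k ⊕ Fin k ↪ Fin n) := by
  have hn : (0 : ℝ) < n := by linarith
  have hn0 : 0 < n := by exact_mod_cast hn
  refine (card_not_meetsEvenly_le hn0 (testSets G) _).trans
    (mul_le_mul_of_nonneg_right ?_ (by positivity))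
  have hβ := le_density hc hL hcL hnL hk
  have h1 : 2 / 5 * c ≤ (k : ℝ) / n := by
    have : 0 ≤ (k : ℝ) / n := by positivity
    linarith
  have h2 : 240 * ((a + 2) * Real.log n) ≤ (k : ℝ) / n * 2 ^ (L / 20) := by
    have h3 : 2 / 5 * c * (2 : ℝ) ^ (L / 20) ≤ (k : ℝ) / n * 2 ^ (L / 20) :=
      mul_le_mul_of_nonneg_right h1 (by positivity)
    have h4 : 2 / 5 * c * (6 * (a + 2) * (L * Real.log n)) ≤ 2 / 5 * c * (2 : ℝ) ^ (L / 20) :=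
      mul_le_mul_of_nonneg_left hσ (by positivity)
    have h5 : 0 ≤ (a + 2) * Real.log n := mul_nonneg (by linarith) (Real.log_natCast_nonneg n)
    have h6 := mul_le_mul_of_nonneg_right hcL h5
    linarith
  have h3 : ((testSets G).card : ℝ) ≤ 2 * n + 1 := by exact_mod_cast card_testSets_le G
  calc ((testSets G).card : ℝ) * (2 * Real.exp (-((k : ℝ) / n * 2 ^ (L / 20)) / 240)) ≤
      (2 * n + 1) * (2 * Real.exp (-((a + 2) * Real.log n))) := by
        refine mul_le_mul h3 ?_ (by positivity) (by positivity)
        refine mul_le_mul_of_nonneg_left (Real.exp_le_exp.2 ?_) two_pos.le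
        linarith
    _ = (4 * n + 2) * ((n : ℝ) ^ (-a) * ((n : ℝ) ^ 2)⁻¹) := by
        have : Real.exp (-((a + 2) * Real.log n)) = (n : ℝ) ^ (-a) * ((n : ℝ) ^ 2)⁻¹ := by
          rw [← Real.rpow_natCast, ← Real.rpow_neg hn.le, ← Real.rpow_add hn,
            Real.rpow_def_of_pos hn]
          congr 1
          push_cast
          ring
        rw [this]
        ring
    _ = (n : ℝ) ^ (-a) * ((4 * n + 2) * ((n : ℝ) ^ 2)⁻¹) := by ring
    _ ≤ (n : ℝ) ^ (-a) * 1 := by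
        refine mul_le_mul_of_nonneg_left ?_ (by positivity)
        rw [← div_eq_mul_inv, div_le_one (by positivity)]
        nlinarith
    _ = (n : ℝ) ^ (-a) := mul_one _

end Large

theorem eventually_large (a : ℝ) {c : ℕ → ℝ} (hpos : ∀ n, 0 < c n)
    (hω : (fun n : ℕ => 1 / Real.logb 2 (n : ℝ)) =o[atTop] c) :
    ∀ᶠ n : ℕ in atTop, 5000 ≤ Real.logb 2 n ∧ 100 ≤ c n * Real.logb 2 n ∧
      10 * Real.logb 2 n ≤ n ∧
      6 * (a + 2) * (Real.logb 2 n * Real.log n) ≤ (2 : ℝ) ^ (Real.logb 2 n / 20) := by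
  have hlog2 := Real.log_pos (one_lt_two (α := ℝ))
  have h1 : ∀ᶠ n : ℕ in atTop, 5000 ≤ Real.logb 2 n :=
    ((Real.tendsto_logb_atTop one_lt_two).comp tendsto_natCast_atTop_atTop).eventually_ge_atTop _
  have h2 := hω.bound (show (0 : ℝ) < 1 / 100 by norm_num)
  have h3 := (Real.isLittleO_log_id_atTop.comp_tendsto
    (tendsto_natCast_atTop_atTop (R := ℝ))).bound (show 0 < Real.log 2 / 10 by positivity)
  have h4 := ((isLittleO_log_rpow_rpow_atTop 2 (show (0 : ℝ) < 1 / 20 by norm_num)).comp_tendsto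
    (tendsto_natCast_atTop_atTop (R := ℝ))).bound
      (show 0 < Real.log 2 / (6 * (|a| + 2)) by positivity)
  filter_upwards [h1, h2, h3, h4, eventually_gt_atTop 0] with n h1 h2 h3 h4 hn
  have hn' : (0 : ℝ) < n := by exact_mod_cast hn
  have hlogb : Real.logb 2 n = Real.log n / Real.log 2 := rfl
  have hlog0 : 0 ≤ Real.log n := Real.log_natCast_nonneg n
  refine ⟨h1, ?_, ?_, ?_⟩
  · rw [Real.norm_of_nonneg (by positivity), Real.norm_of_nonneg (hpos n).le,
      div_le_iff₀ (by linarith)] at h2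
    linarith
  · simp only [Function.comp, id] at h3
    rw [Real.norm_of_nonneg hlog0, Real.norm_of_nonneg hn'.le] at h3
    rw [hlogb, mul_div_assoc', div_le_iff₀ hlog2]
    linarith
  · simp only [Function.comp] at h4
    rw [Real.norm_of_nonneg (by positivity), Real.norm_of_nonneg (by positivity), Real.rpow_two,
      div_mul_eq_mul_div, le_div_iff₀ (by positivity)] at h4
    have h5 : (2 : ℝ) ^ (Real.logb 2 n / 20) = (n : ℝ) ^ (1 / 20 : ℝ) := by
      rw [div_eq_mul_one_div, Real.rpow_mul two_pos.le, Real.rpow_logb two_pos (by norm_num) hn']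
    have h6 : Real.log n ^ 2 * (6 * (a + 2)) ≤ Real.log n ^ 2 * (6 * (|a| + 2)) :=
      mul_le_mul_of_nonneg_left (by linarith [le_abs_self a]) (by positivity)
    rw [h5, hlogb, div_mul_eq_mul_div, mul_div_assoc', div_le_iff₀ hlog2]
    linarith

theorem mainTheorem2 :
    ∃ (A : WordRAM.Cmd) (κ : ℕ),
      (∀ (a : ℝ), 1 ≤ a →
        ∀ (c : ℕ → ℝ) (_hpos : ∀ n, 0 < c n) (hle : ∀ n, c n ≤ 1)
          (_hω : (fun n : ℕ => 1 / Real.logb 2 (n : ℝ)) =o[atTop] c),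
          ∀ᶠ n : ℕ in atTop, ∀ G : SimpleGraph (Fin n),
            ENNReal.ofReal (1 - (n : ℝ) ^ (-a)) ≤
              (randomPlanting G (balancedBiclique ⌊c n * n / 2⌋₊)
                (card_balancedBiclique_le (hle n) n)).toOuterMeasure
                {Ghat | ∃ L R : Finset (Fin n), WordRAM.Returns A κ Ghat L R ∧
                  IsBalancedBiclique Ghat L R ∧
                  c n / 48 * (2 : ℝ) ^ Real.sqrt (c n * Real.logb 2 (n : ℝ) / 2) ≤ L.card}) ∧
      WordRAM.RunsInSoftLinearTime A κ := by
  classical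
  refine ⟨WordRAM.findBiclique, 11, ?_, 2000, 3, fun n G => ?_⟩
  · intro a ha c hpos hle hω
    filter_upwards [eventually_large a hpos hω] with n ⟨hL, hcL, hnL, hσ⟩ G
    have hn : (0 : ℝ) < n := by linarith
    have hLn : (2 : ℝ) ^ Real.logb 2 n = n := Real.rpow_logb two_pos (by norm_num) hn
    refine ofReal_le_randomPlanting G _ _
      (MeetsEvenly (testSets G) ((2 : ℝ) ^ (Real.logb 2 n / 20))) ?_ fun φ hφ => ?_
    · convert card_not_meetsEvenly_testSets_le ha (hpos n) hL hcL hnL rfl hσ G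
    · obtain ⟨s, t, hrun, -, hout⟩ := WordRAM.findBiclique_achieves
        (plant G (balancedBiclique ⌊c n * n / 2⌋₊) φ)
      obtain ⟨L, R, hLR, hbic, hbeats⟩ := hout
        (mul_self_le_ncard_edgeSet_plant_mul_size (hpos n) hL hcL hnL hLn rfl G φ)
      refine ⟨L, R, ⟨s, t, hrun, hLR⟩, hbic, ?_⟩
      obtain ⟨e, j, hj, hgood⟩ :=
        exists_block_of_meetsEvenly (hpos n) (hle n) hL hcL hnL hLn rfl hφ
      obtain ⟨A, hA, hAL⟩ := hbeats e j hj
      refine (hgood A hA).trans ?_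
      exact_mod_cast hAL
  · obtain ⟨s, t, hrun, ht, -⟩ := WordRAM.findBiclique_achieves G
    exact ⟨s, t, hrun, ht⟩
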